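/- Fix a dimension $d\ge 1$. Let $\mathbb X=\{x\in\mathbb R^d : x_i\ge 0 \text{ for all } i\}$. For a finite set $P\subset\mathbb R^d$, $u\in\mathbb R^d$ and $1\le k\le |P|$, let $\omega_k(u,P)$ be the $k$-th largest of the scores $\langle u,p\rangle$, $p\in P$ (points with equal scores are counted separately), and let $\omega(u,P)=\omega_1(u,P)$. For finite sets $\emptyset\ne Q\subseteq P\subset\mathbb X$, the $k$-regret ratio of $Q$ with respect to $P$ is $$\ell_k(Q,P)=\sup_{u\in\mathbb X}\frac{\max\{0,\ \omega_k(u,P)-\omega(u,Q)\}}{\omega_k(u,P)},$$ where the quotient is read as $0$ if $\omega_k(u,P)=0$. A subset $Q\subseteq P$ is an $\varepsilon$-kernel coreset of $P$ if $\mathrm{width}(u,Q)\ge(1-\varepsilon)\,\mathrm{width}(u,P)$ for all $u\in\mathbb R^d$, where $\mathrm{width}(u,P)=\omega(u,P)+\omega(-u,P)$. Theorem. For every $d\ge1$ there are a constant $C$ and a single algorithm, depending only on $d$, such that the following holds. Given a set $P\subset\mathbb X$ of $n$ points (in any order), a real number $\varepsilon>0$ and an integer $k$ with $1\le k\le n$,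 the algorithm computes in at most $C\,(n+\varepsilon^{-(d-1)})$ steps a nonempty subset $Q\subseteq P$ that is an $\varepsilon$-kernel coreset of $P$ and satisfies $$|Q|\le C\,\max\{1,\varepsilon^{-(d-1)/2}\}\qquad\text{and}\qquad \ell_k(Q,P)\le\varepsilon .$$ The model of computation is the real RAM with floor function: registers and arrays of real numbers, integer literals, exact $+,-,\times,\div$, comparison of reals, and rounding down, all at unit cost; array indices and results of rounding down are moreover restricted to integers in $[0,\,C(n+\varepsilon^{-(d-1)}))$, and the memory outside the input is initially arbitrary. -/

import Mathlib

open Finset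

noncomputable section

namespace RegretSet

/-! ### Scores, regret ratio and kernels -/

/-- Points, and also preference vectors: elements of `ℝ^d`. -/
abbrev Point (d : ℕ) : Type := Fin d → ℝ

/-- The orthant of vectors with nonnegative coordinates, which contains the objects and the
user preferences. -/
def orthant (d : ℕ) : Set (Point d) := {x | ∀ i, 0 ≤ x i}

/-- The score `⟨u, p⟩` of `p` for the preference `u`. -/
def score {d : ℕ} (u p : Point d) : ℝ := ∑ i, u i * p i

/-- The `k`-th largest score of the points of `P` in direction `u`, as the largest threshold that
is reached by at least `k` points of `P` (for `1 ≤ k ≤ #P`; see `kthScore_spec`). -/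
def kthScore {d : ℕ} (k : ℕ) (u : Point d) (P : Finset (Point d)) : ℝ :=
  sSup {t : ℝ | k ≤ #{p ∈ P | t ≤ score u p}}

/-- The largest score of a point of `P` in direction `u`. -/
def topScore {d : ℕ} (u : Point d) (P : Finset (Point d)) : ℝ := kthScore 1 u P

/-- The regret of `Q` with respect to `P` for the preference `u`. For point sets `Q ⊆ P` in the
orthant the numerator vanishes when the denominator does, and the quotient is then read as `0`. -/
def regret {d : ℕ} (k : ℕ) (u : Point d) (Q P : Finset (Point d)) : ℝ :=
  max 0 (kthScore k u P - topScore u Q) / kthScore k u P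

/-- The `k`-regret ratio of `Q` with respect to `P`: the supremum of the regret over all
preferences with nonnegative coordinates (a bounded set of numbers, see `bddAbove_regret`). -/
def regretRatio {d : ℕ} (k : ℕ) (Q P : Finset (Point d)) : ℝ :=
  ⨆ u : orthant d, regret k u.1 Q P

/-- The directional width of `P` in direction `u`. -/
def width {d : ℕ} (u : Point d) (P : Finset (Point d)) : ℝ := topScore u P + topScore (-u) P

/-- `Q` is an `ε`-kernel coreset of `P`. -/
def IsKernel {d : ℕ} (ε : ℝ) (Q P : Finset (Point d)) : Prop :=
  Q ⊆ P ∧ ∀ u : Point d, (1 - ε) * width u P ≤ width u Q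

theorem kthScore_isGreatest {d : ℕ} {k : ℕ} (u : Point d) {P : Finset (Point d)} (hk : 1 ≤ k)
    (hkP : k ≤ #P) :
    IsGreatest {t : ℝ | k ≤ #{p ∈ P | t ≤ score u p}} (kthScore k u P) ∧
      ∃ p ∈ P, score u p = kthScore k u P := by
  classical
  have key : ∀ t : ℝ, k ≤ #{p ∈ P | t ≤ score u p} →
      ∃ q ∈ P, t ≤ score u q ∧ k ≤ #{p ∈ P | score u q ≤ score u p} := by
    intro t ht
    have hne : ({p ∈ P | t ≤ score u p} : Finset (Point d)).Nonempty := by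
      rw [← Finset.card_pos]; omega
    obtain ⟨q, hq, hmin⟩ := Finset.exists_min_image _ (score u) hne
    rw [Finset.mem_filter] at hq
    refine ⟨q, hq.1, hq.2, ht.trans (Finset.card_le_card ?_)⟩
    intro p hp
    exact Finset.mem_filter.2 ⟨(Finset.mem_filter.1 hp).1, hmin p hp⟩
  have hPne : P.Nonempty := by rw [← Finset.card_pos]; omega
  obtain ⟨q₀, hq₀, hmin₀⟩ := Finset.exists_min_image P (score u) hPne
  have hA : ({q ∈ P | k ≤ #{p ∈ P | score u q ≤ score u p}} : Finset (Point d)).Nonempty := by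
    refine ⟨q₀, Finset.mem_filter.2 ⟨hq₀, ?_⟩⟩
    rw [Finset.filter_true_of_mem hmin₀]; exact hkP
  obtain ⟨m, hm, hmax⟩ := Finset.exists_max_image _ (score u) hA
  rw [Finset.mem_filter] at hm
  have hG : IsGreatest {t : ℝ | k ≤ #{p ∈ P | t ≤ score u p}} (score u m) := by
    refine ⟨hm.2, ?_⟩
    intro t ht
    obtain ⟨q, hq, htq, hqk⟩ := key t ht
    exact htq.trans (hmax q (Finset.mem_filter.2 ⟨hq, hqk⟩))
  have hE : kthScore k u P = score u m := hG.csSup_eq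
  exact ⟨hE ▸ hG, m, hm.1, hE.symm⟩

/-- `kthScore k u P` is the score of a point of `P`, fewer than `k` points have a larger score, and
at least `k` points have at least this score. -/
theorem kthScore_spec {d : ℕ} {k : ℕ} (u : Point d) {P : Finset (Point d)} (hk : 1 ≤ k)
    (hkP : k ≤ #P) :
    (∃ p ∈ P, score u p = kthScore k u P) ∧ #{p ∈ P | kthScore k u P < score u p} < k ∧
      k ≤ #{p ∈ P | kthScore k u P ≤ score u p} := by
  obtain ⟨hG, hp⟩ := kthScore_isGreatest u hk hkP
  refine ⟨hp, ?_, hG.1⟩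
  by_contra hlt
  rw [not_lt] at hlt
  have hne : ({p ∈ P | kthScore k u P < score u p} : Finset (Point d)).Nonempty := by
    rw [← Finset.card_pos]; omega
  obtain ⟨q, hq, hmin⟩ := Finset.exists_min_image _ (score u) hne
  have hq' : score u q ≤ kthScore k u P := by
    refine hG.2 (hlt.trans (Finset.card_le_card ?_))
    intro p hp
    exact Finset.mem_filter.2 ⟨(Finset.mem_filter.1 hp).1, hmin p hp⟩
  exact absurd (Finset.mem_filter.1 hq).2 (not_lt.2 hq')

theorem score_nonneg {d : ℕ} {u p : Point d} (hu : u ∈ orthant d) (hp : p ∈ orthant d) :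
    0 ≤ score u p :=
  Finset.sum_nonneg fun i _ => mul_nonneg (hu i) (hp i)

theorem kthScore_nonneg {d : ℕ} {k : ℕ} {u : Point d} {P : Finset (Point d)} (hk : 1 ≤ k)
    (hkP : k ≤ #P) (hu : u ∈ orthant d) (hP : ∀ p ∈ P, p ∈ orthant d) : 0 ≤ kthScore k u P := by
  obtain ⟨p, hp, he⟩ := (kthScore_spec u hk hkP).1
  exact he ▸ score_nonneg hu (hP p hp)

/-- For point sets in the orthant the regret lies between `0` and `1`. -/
theorem regret_mem_Icc {d : ℕ} {k : ℕ} {u : Point d} {Q P : Finset (Point d)} (hk : 1 ≤ k)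
    (hkP : k ≤ #P) (hu : u ∈ orthant d) (hP : ∀ p ∈ P, p ∈ orthant d) (hQ : Q.Nonempty)
    (hQP : Q ⊆ P) : regret k u Q P ∈ Set.Icc (0 : ℝ) 1 := by
  have h1 : 0 ≤ kthScore k u P := kthScore_nonneg hk hkP hu hP
  have h2 : 0 ≤ topScore u Q :=
    kthScore_nonneg le_rfl (Finset.card_pos.2 hQ) hu fun p hp => hP p (hQP hp)
  refine ⟨div_nonneg (le_max_left _ _) h1, div_le_one_of_le₀ (max_le h1 ?_) h1⟩
  linarith

/-- The supremum in `regretRatio` is one of a bounded set. -/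
theorem bddAbove_regret {d : ℕ} {k : ℕ} {Q P : Finset (Point d)} (hk : 1 ≤ k)
    (hkP : k ≤ #P) (hP : ∀ p ∈ P, p ∈ orthant d) (hQ : Q.Nonempty) (hQP : Q ⊆ P) :
    BddAbove (Set.range fun u : orthant d => regret k u.1 Q P) := by
  refine ⟨1, ?_⟩
  rintro _ ⟨u, rfl⟩
  exact (regret_mem_Icc hk hkP u.2 hP hQ hQP).2

/-! ### A real RAM with a step count

A machine has real registers and finitely many (as many as the program names) arrays of reals.
Programs use integer literals, exact real arithmetic, comparisons, and rounding down; the only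
integers that rounding down can produce, and the only indices of arrays that can be used, are those
in `[0, W)`, where the capacity `W` is a parameter of the machine. -/

/-- Expressions. -/
inductive RExpr : Type
  | lit (z : ℤ) : RExpr
  | reg (r : ℕ) : RExpr
  | load (a : ℕ) (e : RExpr) : RExpr
  | add (e₁ e₂ : RExpr) : RExpr
  | sub (e₁ e₂ : RExpr) : RExpr
  | mul (e₁ e₂ : RExpr) : RExpr
  | div (e₁ e₂ : RExpr) : RExpr
  | floor (e : RExpr) : RExpr

/-- Programs: assignment to a register, assignment `a[e₁] := e₂` to an entry of an array,
composition, `if e₁ < e₂ then c₁ else c₂` and `while e₁ < e₂ do c`. -/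
inductive RProg : Type
  | skip : RProg
  | assign (r : ℕ) (e : RExpr) : RProg
  | store (a : ℕ) (e₁ e₂ : RExpr) : RProg
  | seq (c₁ c₂ : RProg) : RProg
  | cond (e₁ e₂ : RExpr) (c₁ c₂ : RProg) : RProg
  | loop (e₁ e₂ : RExpr) (c : RProg) : RProg

/-- A configuration of the memory: registers `reg r` and arrays `arr a`. -/
structure RState : Type where
  reg : ℕ → ℝ
  arr : ℕ → ℕ → ℝ

/-- The value of an expression (meaningful where its evaluation is `RExpr.Safe`). -/
def RExpr.val (s : RState) : RExpr → ℝ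
  | .lit z => (z : ℝ)
  | .reg r => s.reg r
  | .load a e => s.arr a ⌊e.val s⌋₊
  | .add e₁ e₂ => e₁.val s + e₂.val s
  | .sub e₁ e₂ => e₁.val s - e₂.val s
  | .mul e₁ e₂ => e₁.val s * e₂.val s
  | .div e₁ e₂ => e₁.val s / e₂.val s
  | .floor e => (⌊e.val s⌋₊ : ℝ)

/-- `x` is an index that a machine of capacity `W` can use. -/
def IsIndex (W x : ℝ) : Prop := ∃ i : ℕ, x = (i : ℝ) ∧ (i : ℝ) < W

/-- The evaluation of an expression does not fail: no division by zero, no array access at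
anything but an integer in `[0, W)`, no rounding outside `[0, W)`. -/
def RExpr.Safe (W : ℝ) (s : RState) : RExpr → Prop
  | .lit _ => True
  | .reg _ => True
  | .load _ e => e.Safe W s ∧ IsIndex W (e.val s)
  | .add e₁ e₂ => e₁.Safe W s ∧ e₂.Safe W s
  | .sub e₁ e₂ => e₁.Safe W s ∧ e₂.Safe W s
  | .mul e₁ e₂ => e₁.Safe W s ∧ e₂.Safe W s
  | .div e₁ e₂ => e₁.Safe W s ∧ e₂.Safe W s ∧ e₂.val s ≠ 0
  | .floor e => e.Safe W s ∧ 0 ≤ e.val s ∧ e.val s < W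

/-- The number of steps of an evaluation: one for every literal, register, array access and
operation. -/
def RExpr.cost : RExpr → ℕ
  | .lit _ => 1
  | .reg _ => 1
  | .load _ e => e.cost + 1
  | .add e₁ e₂ => e₁.cost + e₂.cost + 1
  | .sub e₁ e₂ => e₁.cost + e₂.cost + 1
  | .mul e₁ e₂ => e₁.cost + e₂.cost + 1
  | .div e₁ e₂ => e₁.cost + e₂.cost + 1
  | .floor e => e.cost + 1

/-- The configuration after writing `x` into register `r`. -/
def RState.setReg (s : RState) (r : ℕ) (x : ℝ) : RState :=
  { s with reg := Function.update s.reg r x }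

/-- The configuration after writing `x` into entry `i` of the array `a`. -/
def RState.setArr (s : RState) (a i : ℕ) (x : ℝ) : RState :=
  { s with arr := Function.update s.arr a (Function.update (s.arr a) i x) }

/-- `Exec W c s t s'`: on a machine of capacity `W`, the program `c` started in the configuration
`s` halts without failure after exactly `t` steps, in the configuration `s'`. -/
inductive Exec (W : ℝ) : RProg → RState → ℕ → RState → Prop
  | skip (s : RState) : Exec W .skip s 1 s
  | assign (r : ℕ) (e : RExpr) (s : RState) (he : e.Safe W s) :
      Exec W (.assign r e) s (e.cost + 1) (s.setReg r (e.val s))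
  | store (a : ℕ) (e₁ e₂ : RExpr) (s : RState) (h₁ : e₁.Safe W s) (h₂ : e₂.Safe W s)
      (hi : IsIndex W (e₁.val s)) :
      Exec W (.store a e₁ e₂) s (e₁.cost + e₂.cost + 1) (s.setArr a ⌊e₁.val s⌋₊ (e₂.val s))
  | seq {c₁ c₂ : RProg} {s s₁ s₂ : RState} {t₁ t₂ : ℕ} (h₁ : Exec W c₁ s t₁ s₁)
      (h₂ : Exec W c₂ s₁ t₂ s₂) : Exec W (.seq c₁ c₂) s (t₁ + t₂) s₂
  | cond_true {e₁ e₂ : RExpr} {c₁ c₂ : RProg} {s s' : RState} {t : ℕ} (h₁ : e₁.Safe W s)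
      (h₂ : e₂.Safe W s) (hlt : e₁.val s < e₂.val s) (h : Exec W c₁ s t s') :
      Exec W (.cond e₁ e₂ c₁ c₂) s (e₁.cost + e₂.cost + 1 + t) s'
  | cond_false {e₁ e₂ : RExpr} {c₁ c₂ : RProg} {s s' : RState} {t : ℕ} (h₁ : e₁.Safe W s)
      (h₂ : e₂.Safe W s) (hge : e₂.val s ≤ e₁.val s) (h : Exec W c₂ s t s') :
      Exec W (.cond e₁ e₂ c₁ c₂) s (e₁.cost + e₂.cost + 1 + t) s'
  | loop_done {e₁ e₂ : RExpr} {c : RProg} {s : RState} (h₁ : e₁.Safe W s)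
      (h₂ : e₂.Safe W s) (hge : e₂.val s ≤ e₁.val s) :
      Exec W (.loop e₁ e₂ c) s (e₁.cost + e₂.cost + 1) s
  | loop_step {e₁ e₂ : RExpr} {c : RProg} {s s₁ s₂ : RState} {t₁ t₂ : ℕ} (h₁ : e₁.Safe W s)
      (h₂ : e₂.Safe W s) (hlt : e₁.val s < e₂.val s) (hbody : Exec W c s t₁ s₁)
      (hrest : Exec W (.loop e₁ e₂ c) s₁ t₂ s₂) :
      Exec W (.loop e₁ e₂ c) s (e₁.cost + e₂.cost + 1 + t₁ + t₂) s₂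

/-- The initial configurations for the input `(p₀, …, pₙ₋₁), ε, k`: registers `0`, `1`, `2` hold
`n`, `k`, `ε`, and array `0` holds the coordinates of the points, point by point. The rest of the
memory is arbitrary. -/
def IsInput {d n : ℕ} (p : Fin n → Point d) (ε : ℝ) (k : ℕ) (s : RState) : Prop :=
  s.reg 0 = (n : ℝ) ∧ s.reg 1 = (k : ℝ) ∧ s.reg 2 = ε ∧
    ∀ (i : Fin n) (j : Fin d), s.arr 0 (i.1 * d + j.1) = p i j

/-- A final configuration outputs the set `Q` of input points: register `0` holds `#Q`, and the
first `#Q` entries of array `1` are the indices, without repetition, of the points of `Q`. -/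
def IsOutput {d n : ℕ} (p : Fin n → Point d) (Q : Finset (Point d)) (s : RState) : Prop :=
  s.reg 0 = (#Q : ℝ) ∧ ∃ idx : Fin #Q → Fin n, Function.Injective idx ∧
    (∀ i : Fin #Q, s.arr 1 i.1 = ((idx i).1 : ℝ)) ∧
    (Q : Set (Point d)) = Set.range fun i => p (idx i)

end RegretSet

end

namespace RegretSet

/-! ### Running programs -/

/-! The regret bound is a consequence of the kernel property. For `u ≥ 0` and points in the orthant,
`ω(-u, P) ≤ 0`, so the width of `P` is at most its top score; a kernel therefore loses at most `ε
ω(u, P)`, and since `ω_k ≤ ω`, the bound holds for every `k` at once (`regretRatio_le_of_isKernel`).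
It remains to compute a small kernel in linear time. Write `d = D + 1`.

Fatness. After translating one point to the origin, Gaussian elimination with a pivot of largest
absolute value in each column writes the points as `∑ c_l b_l` with all `|c_l| ≤ 1`. A functional
bounded by `M` on the translated points is bounded by `2 ^ l M` on the pivot row `b_l`
(`Eliminated.step`). With `M` the width in direction `u`, the coefficients `θ_l = ⟨u, b_l⟩` are thus
at most `2 ^ D` times the width, so an additive error for the normalized functional `θ / max |θ_l|`
is a relative error for the width (`Eliminated.exists_le`).

Few directions. Some coordinate of the normalized functional `w` is `±1`, which selects one of the
`2 (D + 1)` faces of the cube. On a face the height is lowered by the paraboloid `|x|² / 2` in the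
other `D` coordinates `x`. If `i` is a point and `v` approximates `x_i + w` up to `κ` in each
coordinate, a maximizer of the lowered height plus `⟨x, v⟩` has `w`-score at least that of `i` minus
`D κ² / 2`, by completing squares (`gain_sub_le`). The error is quadratic in the mesh, so a mesh of
order `√ε` and hence `O(ε^{-D/2})` directions per face suffice (`Covers.exists_le`).

Linear time. In the linear term, the points are rounded to a finer grid of cells, with mesh of order
`ε`, and only the highest point of each cell is kept. Maximizing over all cells for all directions
is separable: one axis at a time, each row of the table is replaced by the values of an upper
envelope of lines at equally spaced arguments. The slopes are already sorted, so a stack scan and a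
monotone pointer take time linear in the row (`hullScan_run`, `hullWalk_run`), and
`IsTransform.step` composes the axes. The total is `O(n + ε^{-D})`. The grid constants contain `2 ^
(D + 4)` to absorb the fatness factor and leave an error of `ε / 2` on each side (`error_le`,
`isKernel_of_topScore`). -/

/-- The program `c`, started in `s`, halts after `t` steps in a configuration `s'` such that
`Q t s'` holds. -/
def Run (W : ℝ) (c : RProg) (s : RState) (Q : ℕ → RState → Prop) : Prop :=
  ∃ t s', Exec W c s t s' ∧ Q t s'

/-- Whether a program contains an assignment to the register `r`. -/
def RProg.setsReg (r : ℕ) : RProg → Bool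
  | .skip => false
  | .assign x _ => r == x
  | .store _ _ _ => false
  | .seq c₁ c₂ => c₁.setsReg r || c₂.setsReg r
  | .cond _ _ c₁ c₂ => c₁.setsReg r || c₂.setsReg r
  | .loop _ _ c => c.setsReg r

/-- Whether a program contains an assignment to an entry of the array `a`. -/
def RProg.setsArr (a : ℕ) : RProg → Bool
  | .skip => false
  | .assign _ _ => false
  | .store x _ _ => a == x
  | .seq c₁ c₂ => c₁.setsArr a || c₂.setsArr a
  | .cond _ _ c₁ c₂ => c₁.setsArr a || c₂.setsArr a
  | .loop _ _ c => c.setsArr a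

/-- The memory that the program `c` does not name for writing is the same in `s` and `s'`. -/
structure Keeps (c : RProg) (s s' : RState) : Prop where
  reg : ∀ r, c.setsReg r = false → s'.reg r = s.reg r
  arr : ∀ a, c.setsArr a = false → s'.arr a = s.arr a

@[simp] theorem setReg_reg (s : RState) (r : ℕ) (x : ℝ) (q : ℕ) :
    (s.setReg r x).reg q = if q = r then x else s.reg q := by
  simp [RState.setReg, Function.update_apply]

@[simp] theorem setReg_arr (s : RState) (r : ℕ) (x : ℝ) : (s.setReg r x).arr = s.arr := rfl

@[simp] theorem setArr_reg (s : RState) (a i : ℕ) (x : ℝ) : (s.setArr a i x).reg = s.reg := rfl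

theorem setArr_arr (s : RState) (a i : ℕ) (x : ℝ) (b : ℕ) :
    (s.setArr a i x).arr b = if b = a then Function.update (s.arr a) i x else s.arr b := by
  by_cases h : b = a
  · subst h; simp [RState.setArr]
  · simp [RState.setArr, h]

@[simp] theorem setArr_arr_apply (s : RState) (a i : ℕ) (x : ℝ) (b k : ℕ) :
    (s.setArr a i x).arr b k = if b = a ∧ k = i then x else s.arr b k := by
  rw [setArr_arr]
  by_cases h : b = a
  · subst h; simp [Function.update_apply]
  · simp [h]

theorem Keeps.refl (c : RProg) (s : RState) : Keeps c s s := ⟨fun _ _ => rfl, fun _ _ => rfl⟩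

theorem Keeps.trans {c : RProg} {s₁ s₂ s₃ : RState} (h : Keeps c s₁ s₂) (h' : Keeps c s₂ s₃) :
    Keeps c s₁ s₃ :=
  ⟨fun r hr => (h'.reg r hr).trans (h.reg r hr), fun a ha => (h'.arr a ha).trans (h.arr a ha)⟩

/-- This is the frame rule. Its side conditions are Boolean functions that compute on the concrete
programs, so they can be discharged by `rfl`. -/
theorem Exec.keeps {W : ℝ} {c : RProg} {s s' : RState} {t : ℕ} (h : Exec W c s t s') :
    Keeps c s s' := by
  induction h with
  | skip s => exact Keeps.refl _ _
  | assign r e s he =>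
    refine ⟨fun q hq => ?_, fun _ _ => rfl⟩
    have : q ≠ r := by simpa [RProg.setsReg] using hq
    simp [this]
  | store a e₁ e₂ s h₁ h₂ hi =>
    refine ⟨fun q hq => rfl, fun b hb => ?_⟩
    have : b ≠ a := by simpa [RProg.setsArr] using hb
    simp [setArr_arr, this]
  | seq h₁ h₂ ih₁ ih₂ =>
    constructor
    · intro r hr
      simp only [RProg.setsReg, Bool.or_eq_false_iff] at hr
      exact (ih₂.reg r hr.2).trans (ih₁.reg r hr.1)
    · intro r hr
      simp only [RProg.setsArr, Bool.or_eq_false_iff] at hr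
      exact (ih₂.arr r hr.2).trans (ih₁.arr r hr.1)
  | cond_true _ _ _ _ ih =>
    constructor
    · intro r hr
      simp only [RProg.setsReg, Bool.or_eq_false_iff] at hr
      exact ih.reg r hr.1
    · intro r hr
      simp only [RProg.setsArr, Bool.or_eq_false_iff] at hr
      exact ih.arr r hr.1
  | cond_false _ _ _ _ ih =>
    constructor
    · intro r hr
      simp only [RProg.setsReg, Bool.or_eq_false_iff] at hr
      exact ih.reg r hr.2
    · intro r hr
      simp only [RProg.setsArr, Bool.or_eq_false_iff] at hr
      exact ih.arr r hr.2
  | loop_done => exact Keeps.refl _ _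
  | loop_step _ _ _ _ _ ih₁ ih₂ =>
    exact ⟨fun r hr => (ih₂.reg r hr).trans (ih₁.reg r hr),
      fun r hr => (ih₂.arr r hr).trans (ih₁.arr r hr)⟩

/-! ### Rules for total correctness with step bounds -/

section Rules

variable {W : ℝ} {s : RState} {Q : ℕ → RState → Prop}

theorem Run.mono {c : RProg} {Q' : ℕ → RState → Prop} (h : Run W c s Q')
    (hQ : ∀ t s', Keeps c s s' → Q' t s' → Q t s') : Run W c s Q := by
  obtain ⟨t, s', he, hq⟩ := h
  exact ⟨t, s', he, hQ t s' he.keeps hq⟩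

theorem Run.skip (h : Q 1 s) : Run W .skip s Q := ⟨1, s, .skip s, h⟩

theorem Run.seq {c₁ c₂ : RProg}
    (h : Run W c₁ s fun t s' => Run W c₂ s' fun t' => Q (t + t')) :
    Run W (.seq c₁ c₂) s Q := by
  obtain ⟨t, s', he, t', s'', he', hq⟩ := h
  exact ⟨_, _, he.seq he', hq⟩

theorem Run.assign {r : ℕ} {e : RExpr} (x : ℝ) (he : e.Safe W s) (hx : e.val s = x)
    (h : Q (e.cost + 1) (s.setReg r x)) : Run W (.assign r e) s Q :=
  ⟨_, _, .assign r e s he, hx ▸ h⟩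

theorem Run.load {r a : ℕ} {e : RExpr} (i : ℕ) (x : ℝ) (he : e.Safe W s) (hi : e.val s = i)
    (hW : (i : ℝ) < W) (hx : s.arr a i = x) (h : Q (e.cost + 2) (s.setReg r x)) :
    Run W (.assign r (.load a e)) s Q :=
  Run.assign x ⟨he, i, hi, hW⟩ (by simp [RExpr.val, hi, hx]) h

theorem Run.floor {r : ℕ} {e : RExpr} (i : ℕ) (he : e.Safe W s) (h0 : 0 ≤ e.val s)
    (hW : e.val s < W) (hi : ⌊e.val s⌋₊ = i) (h : Q (e.cost + 2) (s.setReg r i)) :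
    Run W (.assign r (.floor e)) s Q :=
  Run.assign (i : ℝ) ⟨he, h0, hW⟩ (by simp [RExpr.val, hi]) h

theorem Run.store {a : ℕ} {e₁ e₂ : RExpr} (i : ℕ) (x : ℝ) (h₁ : e₁.Safe W s) (h₂ : e₂.Safe W s)
    (hi : e₁.val s = i) (hW : (i : ℝ) < W) (hx : e₂.val s = x)
    (h : Q (e₁.cost + e₂.cost + 1) (s.setArr a i x)) : Run W (.store a e₁ e₂) s Q := by
  have := Exec.store a e₁ e₂ s h₁ h₂ ⟨i, hi, hW⟩
  rw [hi, Nat.floor_natCast, hx] at this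
  exact ⟨_, _, this, h⟩

theorem Run.cond {e₁ e₂ : RExpr} {c₁ c₂ : RProg} (x y : ℝ) (h₁ : e₁.Safe W s) (h₂ : e₂.Safe W s)
    (hx : e₁.val s = x) (hy : e₂.val s = y)
    (ht : x < y → Run W c₁ s fun t => Q (e₁.cost + e₂.cost + 1 + t))
    (hf : y ≤ x → Run W c₂ s fun t => Q (e₁.cost + e₂.cost + 1 + t)) :
    Run W (.cond e₁ e₂ c₁ c₂) s Q := by
  subst hx hy
  rcases lt_or_ge (e₁.val s) (e₂.val s) with h | h
  · obtain ⟨t, s', he, hq⟩ := ht h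
    exact ⟨_, _, .cond_true h₁ h₂ h he, hq⟩
  · obtain ⟨t, s', he, hq⟩ := hf h
    exact ⟨_, _, .cond_false h₁ h₂ h he, hq⟩

/-- A loop with a decreasing natural number `m` and a body of at most `T` steps. -/
theorem Run.loop {e₁ e₂ : RExpr} {c : RProg} (I : ℕ → RState → Prop) (T m : ℕ)
    (hsafe : ∀ m s', I m s' → e₁.Safe W s' ∧ e₂.Safe W s') (h0 : I m s)
    (hstep : ∀ m s', Keeps c s s' → I m s' → e₁.val s' < e₂.val s' →
      Run W c s' fun t s'' => t ≤ T ∧ ∃ m' < m, I m' s'')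
    (hdone : ∀ m' t s', Keeps c s s' → I m' s' → e₂.val s' ≤ e₁.val s' →
      t ≤ m * (T + e₁.cost + e₂.cost + 1) + (e₁.cost + e₂.cost + 1) → Q t s') :
    Run W (.loop e₁ e₂ c) s Q := by
  -- Generalized to every configuration reachable from `s`, since the induction restarts the loop
  -- after each round. Only the variant of the current configuration enters the time bound.
  suffices H : ∀ m s', Keeps c s s' → I m s' → ∃ t s'', Exec W (.loop e₁ e₂ c) s' t s'' ∧
      t ≤ m * (T + e₁.cost + e₂.cost + 1) + (e₁.cost + e₂.cost + 1) ∧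
      e₂.val s'' ≤ e₁.val s'' ∧ ∃ m', I m' s'' by
    obtain ⟨t, s', he, ht, hg, m', hI⟩ := H m s (Keeps.refl _ _) h0
    exact ⟨t, s', he, hdone m' t s' ⟨he.keeps.reg, he.keeps.arr⟩ hI hg ht⟩
  intro m
  induction m using Nat.strong_induction_on with
  | _ m ih =>
  intro s' hk hI
  obtain ⟨h₁, h₂⟩ := hsafe m s' hI
  rcases lt_or_ge (e₁.val s') (e₂.val s') with h | h
  · obtain ⟨t, s₁, he, ht, m', hm', hI'⟩ := hstep m s' hk hI h
    obtain ⟨t', s₂, he', ht', hg, hI''⟩ := ih m' hm' s₁ (hk.trans he.keeps) hI'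
    refine ⟨_, s₂, .loop_step h₁ h₂ h he he', ?_, hg, hI''⟩
    -- The variant may drop by more than one; the surplus `q` only makes the time bound weaker.
    obtain ⟨q, rfl⟩ := Nat.exists_eq_add_of_lt hm'
    nlinarith
  · exact ⟨_, s', .loop_done h₁ h₂ h, by omega, h, m, hI⟩

/-- `for r < e do c`. -/
def RProg.for (r : ℕ) (e : RExpr) (c : RProg) : RProg :=
  .seq (.assign r (.lit 0)) (.loop (.reg r) e (.seq c (.assign r (.add (.reg r) (.lit 1)))))

/-- The invariant for `i + 1` is demanded after the counter has been advanced, so it may be stated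
about the very configuration in which the next round starts. The variant is `N - i`. -/
theorem Run.for {r : ℕ} {e : RExpr} {c : RProg} (I : ℕ → RState → Prop) (N T : ℕ)
    (hr : c.setsReg r = false)
    (he : ∀ s', Keeps (RProg.for r e c) s s' → e.Safe W s' ∧ e.val s' = N)
    (h0 : I 0 (s.setReg r 0))
    (hstep : ∀ i s', i < N → Keeps (RProg.for r e c) s s' → s'.reg r = i → I i s' →
      Run W c s' fun t s'' => t ≤ T ∧ I (i + 1) (s''.setReg r ((i + 1 : ℕ) : ℝ)))
    (hdone : ∀ t s', Keeps (RProg.for r e c) s s' → I N s' →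
      t ≤ N * (T + e.cost + 6) + (e.cost + 4) → Q t s') :
    Run W (RProg.for r e c) s Q := by
  have hk0 : Keeps (RProg.for r e c) s (s.setReg r 0) := by
    refine ⟨fun q hq => ?_, fun _ _ => rfl⟩
    have : q ≠ r := by
      simp only [RProg.for, RProg.setsReg, Bool.or_eq_false_iff] at hq
      simpa using hq.1
    simp [this]
  have hk : ∀ s', Keeps (.seq c (.assign r (.add (.reg r) (.lit 1)))) (s.setReg r 0) s' →
      Keeps (RProg.for r e c) s s' := by
    intro s' h
    refine hk0.trans ⟨fun q hq => h.reg q ?_, fun q hq => h.arr q ?_⟩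
    · simp only [RProg.for, RProg.setsReg, Bool.or_eq_false_iff] at hq ⊢
      exact hq.2
    · simpa only [RProg.for, RProg.setsArr, Bool.false_or] using hq
  refine Run.seq <| Run.assign 0 trivial (by simp [RExpr.val]) ?_
  refine Run.loop (fun m s' => Keeps (RProg.for r e c) s s' ∧
      ∃ i, i + m = N ∧ s'.reg r = i ∧ I i s') (T + 4) N ?_ ⟨hk0, 0, by simp, by simp, h0⟩ ?_ ?_
  · rintro m s' ⟨h, -⟩
    exact ⟨trivial, (he s' h).1⟩
  · rintro m s' hks ⟨h, i, him, hri, hI⟩ hlt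
    rw [(he s' h).2] at hlt
    simp only [RExpr.val, hri, Nat.cast_lt] at hlt
    refine Run.seq <| (hstep i s' hlt h hri hI).mono fun t s'' hk' ⟨ht, hI'⟩ => ?_
    have hr' : s''.reg r = i := (hk'.reg r hr).trans hri
    refine Run.assign ((i + 1 : ℕ) : ℝ) ⟨trivial, trivial⟩ (by simp [RExpr.val, hr']) ?_
    refine ⟨by simp [RExpr.cost]; omega, m - 1, by omega, ?_, i + 1, by omega, by simp, hI'⟩
    refine h.trans ⟨fun q hq => ?_, fun q hq => ?_⟩
    · simp only [RProg.for, RProg.setsReg, Bool.or_eq_false_iff] at hq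
      have : q ≠ r := by simpa using hq.1
      simp [this, hk'.reg q hq.2.1]
    · simp only [RProg.for, RProg.setsArr, Bool.or_eq_false_iff] at hq
      simp [hk'.arr q hq.2.1]
  · rintro m' t s' hks ⟨h, i, him, hri, hI⟩ hge ht
    rw [(he s' h).2] at hge
    simp only [RExpr.val, hri, Nat.cast_le] at hge
    obtain rfl : i = N := by omega
    refine hdone _ _ h hI ?_
    simp only [RExpr.cost] at ht ⊢
    nlinarith

end Rules

/-! ### Upper envelopes of lines -/

/-- The stack `st 0 < ⋯ < st (m - 1)` of an upper hull scan that is about to treat the line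
`v ↦ w i + i * v`: the stacked lines are in strictly concave position and dominate all lines treated
so far, except possibly where the `i`-th line does. -/
structure HullScan (w : ℕ → ℝ) (E i m : ℕ) (st : ℕ → ℕ) : Prop where
  lt : ∀ t < m, st t < i
  mono : ∀ t, t + 1 < m → st t < st (t + 1)
  concave : ∀ t, t + 2 < m → (w (st (t + 2)) - w (st (t + 1))) * ((st (t + 1) : ℝ) - st t) <
    (w (st (t + 1)) - w (st t)) * ((st (t + 2) : ℝ) - st (t + 1))
  dom : ∀ i' < i, ∀ v : ℝ, (∃ t < m, w i' + i' * v ≤ w (st t) + st t * v) ∨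
    (i < E ∧ w i' + i' * v ≤ w i + i * v)

theorem HullScan.zero (w : ℕ → ℝ) (E : ℕ) (st : ℕ → ℕ) : HullScan w E 0 0 st :=
  ⟨by simp, by simp, by simp, by simp⟩

/-- A line of intermediate slope that makes no strict concave turn lies below the maximum of its two
neighbours everywhere. The right neighbour is the line still to be pushed, which is why `dom` admits
it as a dominating line. -/
theorem HullScan.pop {w : ℕ → ℝ} {E i m : ℕ} {st : ℕ → ℕ} (h : HullScan w E i (m + 2) st)
    (hi : i < E) (hp : (w (st (m + 1)) - w (st m)) * ((i : ℝ) - st (m + 1)) ≤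
      (w i - w (st (m + 1))) * ((st (m + 1) : ℝ) - st m)) :
    HullScan w E i (m + 1) st := by
  refine ⟨fun t ht => h.lt t (by omega), fun t ht => h.mono t (by omega),
    fun t ht => h.concave t (by omega), fun i' hi' v => ?_⟩
  rcases h.dom i' hi' v with ⟨t, ht, hle⟩ | h'
  · rcases Nat.lt_succ_iff_lt_or_eq.1 ht with ht | rfl
    · exact Or.inl ⟨t, ht, hle⟩
    have hab : (st m : ℝ) < st (m + 1) := by exact_mod_cast h.mono m (by omega)
    have hbc : (st (m + 1) : ℝ) < i := by exact_mod_cast h.lt (m + 1) (by omega)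
    rcases le_or_gt (w (st (m + 1)) + st (m + 1) * v) (w (st m) + st m * v) with h1 | h1
    · exact Or.inl ⟨m, by omega, hle.trans h1⟩
    -- Where the popped line is above its predecessor, the argument lies right of their crossing,
    -- hence also right of the crossing with the new line. The products below express this without
    -- division.
    · refine Or.inr ⟨hi, hle.trans ?_⟩
      by_contra h2
      rw [not_le] at h2
      have e1 := mul_pos (sub_pos.2 h1) (sub_pos.2 hbc)
      have e2 := mul_pos (sub_pos.2 h2) (sub_pos.2 hab)
      nlinarith
  · exact Or.inr h'

theorem HullScan.push {w : ℕ → ℝ} {E i m : ℕ} {st : ℕ → ℕ} (h : HullScan w E i m st)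
    (hp : ∀ q, m = q + 2 → (w i - w (st (q + 1))) * ((st (q + 1) : ℝ) - st q) <
      (w (st (q + 1)) - w (st q)) * ((i : ℝ) - st (q + 1))) :
    HullScan w E (i + 1) (m + 1) (Function.update st m i) := by
  have hne : ∀ t < m, Function.update st m i t = st t := fun t ht =>
    Function.update_of_ne ht.ne _ _
  refine ⟨fun t ht => ?_, fun t ht => ?_, fun t ht => ?_, fun i' hi' v => ?_⟩
  · rcases Nat.lt_succ_iff_lt_or_eq.1 ht with ht | rfl
    · rw [hne t ht]; exact (h.lt t ht).trans (Nat.lt_succ_self i)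
    · simp
  · rcases Nat.lt_succ_iff_lt_or_eq.1 ht with ht | rfl
    · rw [hne _ ht, hne t (by omega)]; exact h.mono t ht
    · rw [hne t (by omega)]; simpa using h.lt t (by omega)
  · rcases Nat.lt_succ_iff_lt_or_eq.1 ht with ht | rfl
    · rw [hne _ ht, hne t (by omega), hne (t + 1) (by omega)]; exact h.concave t ht
    · rw [hne t (by omega), hne (t + 1) (by omega)]; simpa using hp t rfl
  · refine Or.inl ?_
    rcases Nat.lt_succ_iff_lt_or_eq.1 hi' with hi' | rfl
    · rcases h.dom i' hi' v with ⟨t, ht, hle⟩ | ⟨-, hle⟩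
      · exact ⟨t, by omega, by rwa [hne t ht]⟩
      · exact ⟨m, by omega, by simpa using hle⟩
    · exact ⟨m, by omega, by simp⟩

/-- Past a descent, the values of the stacked lines decrease. -/
theorem HullScan.le_of_descent {w : ℕ → ℝ} {E i m : ℕ} {st : ℕ → ℕ} (h : HullScan w E i m st)
    {v : ℝ} {p : ℕ} (hp : p + 1 < m → w (st (p + 1)) + st (p + 1) * v < w (st p) + st p * v) :
    ∀ t, p ≤ t → t < m → w (st t) + st t * v ≤ w (st p) + st p * v := by
  -- Strict concavity makes consecutive crossing arguments increase along the stack, so an argument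
  -- left of one crossing is left of all later ones.
  have key : ∀ q, p + q + 1 < m → w (st (p + q + 1)) + st (p + q + 1) * v <
      w (st (p + q)) + st (p + q) * v := by
    intro q
    induction q with
    | zero => exact hp
    | succ q ih =>
      intro hq
      have h1 := ih (by omega)
      have hc := h.concave (p + q) (by omega)
      have hab : (st (p + q) : ℝ) < st (p + q + 1) := by exact_mod_cast h.mono _ (by omega)
      have hbc : (st (p + q + 1) : ℝ) < st (p + q + 2) := by
        exact_mod_cast h.mono (p + q + 1) (by omega)
      by_contra h2
      rw [not_lt] at h2
      change w (st (p + q + 1)) + st (p + q + 1) * v ≤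
        w (st (p + q + 2)) + st (p + q + 2) * v at h2
      have e1 := mul_pos (sub_pos.2 h1) (sub_pos.2 hbc)
      have e2 := mul_nonneg (sub_nonneg.2 h2) (sub_pos.2 hab).le
      nlinarith
  intro t hpt
  induction t, hpt using Nat.le_induction with
  | base => exact fun _ => le_rfl
  | succ t hpt ih =>
    intro ht
    obtain ⟨q, rfl⟩ := Nat.exists_eq_add_of_le hpt
    exact (key q ht).le.trans (ih (by omega))

/-! ### The transform of one row -/

/-- The grid of cells of the points in one coordinate. -/
noncomputable def cellPos (H : ℝ) (i : ℕ) : ℝ := i / H - 1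

/-- The grid of directions in one coordinate. -/
noncomputable def dirPos (K : ℝ) (j : ℕ) : ℝ := j / K - 2

/-- Pushes the entries of row `reg 21` of the table `arr 4` to an upper hull stack. -/
def hullStep : RProg :=
  .seq (.assign 17 (.load 4 (.add (.mul (.reg 21) (.reg 7)) (.reg 23)))) <|
  .seq (.assign 24 (.lit 0)) <|
  .seq (.cond (.lit 1) (.reg 22)
    (.seq (.assign 25 (.load 8 (.sub (.reg 22) (.lit 2)))) <|
     .seq (.assign 26 (.load 8 (.sub (.reg 22) (.lit 1)))) <|
     .seq (.assign 27 (.load 10 (.sub (.reg 22) (.lit 2)))) <|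
     .seq (.assign 28 (.load 10 (.sub (.reg 22) (.lit 1)))) <|
     .cond (.mul (.sub (.reg 17) (.reg 28)) (.sub (.reg 26) (.reg 25)))
       (.mul (.sub (.reg 28) (.reg 27)) (.sub (.reg 23) (.reg 26))) .skip (.assign 24 (.lit 1)))
    .skip) <|
  .cond (.lit 0) (.reg 24) (.assign 22 (.sub (.reg 22) (.lit 1)))
    (.seq (.store 8 (.reg 22) (.reg 23)) <|
     .seq (.store 10 (.reg 22) (.reg 17)) <|
     .seq (.assign 22 (.add (.reg 22) (.lit 1))) <|
     .assign 23 (.add (.reg 23) (.lit 1)))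

/-- The upper hull scan of one row. -/
def hullScan : RProg :=
  .seq (.assign 22 (.lit 0)) <| .seq (.assign 23 (.lit 0)) <| .loop (.reg 23) (.reg 7) hullStep

/-- The memory of an upper hull scan. -/
structure ScanState (w : ℕ → ℝ) (E i m : ℕ) (st : ℕ → ℕ) (s : RState) : Prop where
  hull : HullScan w E i m st
  size : s.reg 22 = m
  idx : ∀ t < m, s.arr 8 t = st t
  val : ∀ t < m, s.arr 10 t = w (st t)

/-- Each line is pushed once and popped at most once. The variant `2 E + m - 2 i` drops by exactly
one at a push and at a pop, which gives linear time although one line may trigger many pops. -/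
theorem hullScan_run {W : ℝ} {s : RState} {Q : ℕ → RState → Prop} {E row : ℕ}
    (hE : s.reg 7 = E) (hrow : s.reg 21 = row)
    (hW : (((row + 1) * E : ℕ) : ℝ) ≤ W) (hWE : (E : ℝ) ≤ W) (hE0 : 0 < E)
    (hQ : ∀ t s', Keeps hullScan s s' → t ≤ 200 * E + 100 →
      (∃ m st, 0 < m ∧ ScanState (fun i => s.arr 4 (row * E + i)) E E m st s') → Q t s') :
    Run W hullScan s Q := by
  set w : ℕ → ℝ := fun i => s.arr 4 (row * E + i) with hw
  refine Run.seq <| Run.assign 0 trivial (by simp [RExpr.val]) <| Run.seq <|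
    Run.assign 0 trivial (by simp [RExpr.val]) ?_
  refine Run.loop (fun μ s' => s'.reg 7 = E ∧ ∃ i m st, i ≤ E ∧ s'.reg 23 = i ∧ (0 < i → 0 < m) ∧
    2 * E + m = μ + 2 * i ∧ ScanState w E i m st s') 90 (2 * E)
    (fun m s' _ => ⟨trivial, trivial⟩) ?_ ?_ ?_
  · refine ⟨by simp [hE], 0, 0, fun _ => 0, by omega, by simp, by simp, by omega, ?_⟩
    exact ⟨.zero _ _ _, by simp, by simp, by simp⟩
  · rintro μ s' hk ⟨h7, i, m, st, hiE, h23, hm0, hμ, hS⟩ hlt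
    simp only [RExpr.val, h23, h7, Nat.cast_lt] at hlt
    have h21 : s'.reg 21 = row := (hk.reg 21 rfl).trans (by simp [hrow])
    have h4 : s'.arr 4 = s.arr 4 := (hk.arr 4 rfl).trans rfl
    -- Stacked indices increase strictly from the bottom and stay below `i`, so stack positions are
    -- admissible array indices.
    have hmi : m ≤ i := by
      have : ∀ t, t < m → t ≤ st t := by
        intro t
        induction t with
        | zero => simp
        | succ t ih => intro ht; have := ih (by omega); have := hS.hull.mono t ht; omega
      rcases Nat.eq_zero_or_pos m with h | h
      · omega
      · have := this (m - 1) (by omega); have := hS.hull.lt (m - 1) (by omega); omega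
    have hidx : ∀ t < E, (t : ℝ) < W := fun t ht =>
      lt_of_lt_of_le (by exact_mod_cast ht) hWE
    -- The push is reached in two ways, from a stack with fewer than two lines and from a strictly
    -- concave turn; it is treated once for both.
    have hpush : ∀ (t : ℕ) (s₁ : RState), t ≤ 70 → s₁.reg 7 = E → s₁.reg 23 = i → s₁.reg 17 = w i →
        s₁.reg 22 = m → s₁.arr = s'.arr →
        (∀ q, m = q + 2 → (w i - w (st (q + 1))) * ((st (q + 1) : ℝ) - st q) <
          (w (st (q + 1)) - w (st q)) * ((i : ℝ) - st (q + 1))) →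
        Run W (.seq (.store 8 (.reg 22) (.reg 23)) <|
          .seq (.store 10 (.reg 22) (.reg 17)) <|
          .seq (.assign 22 (.add (.reg 22) (.lit 1))) <|
          .assign 23 (.add (.reg 23) (.lit 1))) s₁ fun t' s₂ => t + t' ≤ 90 ∧ ∃ μ' < μ,
          s₂.reg 7 = E ∧ ∃ i m st, i ≤ E ∧ s₂.reg 23 = i ∧ (0 < i → 0 < m) ∧
            2 * E + m = μ' + 2 * i ∧ ScanState w E i m st s₂ := by
      intro t s₁ ht e7 e23 e17 e22 earr hp
      refine Run.seq <| Run.store m i trivial trivial (by simp [RExpr.val, e22])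
        (hidx _ (by omega)) (by simp [RExpr.val, e23]) <|
        Run.seq <| Run.store m (w i) trivial trivial (by simp [RExpr.val, e22])
        (hidx _ (by omega)) (by simp [RExpr.val, e17]) <|
        Run.seq <| Run.assign ((m + 1 : ℕ) : ℝ) ⟨trivial, trivial⟩ (by simp [RExpr.val, e22]) <|
        Run.assign ((i + 1 : ℕ) : ℝ) ⟨trivial, trivial⟩ (by simp [RExpr.val, e23]) ?_
      refine ⟨by simp [RExpr.cost]; omega, μ - 1, by omega, by simp [e7], i + 1, m + 1,
        Function.update st m i, by omega, by simp, by simp, by omega, hS.hull.push hp, by simp,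
        fun t ht => ?_, fun t ht => ?_⟩
      · rcases Nat.lt_succ_iff_lt_or_eq.1 ht with h | rfl
        · simp [h.ne, earr, hS.idx t h]
        · simp
      · rcases Nat.lt_succ_iff_lt_or_eq.1 ht with h | rfl
        · simp [h.ne, earr, hS.val t h]
        · simp
    refine Run.seq <| Run.load (row * E + i) (w i) ⟨⟨trivial, trivial⟩, trivial⟩
      (by simp [RExpr.val, h21, h7, h23])
      (lt_of_lt_of_le (by exact_mod_cast (by nlinarith : row * E + i < (row + 1) * E)) hW)
      (by simp [h4, hw]) <|
      Run.seq <| Run.assign 0 trivial (by simp [RExpr.val]) <|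
      Run.seq <| Run.cond 1 m trivial trivial (by simp [RExpr.val]) (by simp [RExpr.val, hS.size])
      ?_ ?_
    · intro hm
      obtain ⟨q, rfl⟩ : ∃ q, m = q + 2 := ⟨m - 2, by have : 1 < m := by exact_mod_cast hm
                                                     omega⟩
      refine Run.seq <| Run.load q (st q) ⟨trivial, trivial⟩ (by simp [RExpr.val, hS.size])
        (hidx _ (by omega)) (by simp [hS.idx]) <|
        Run.seq <| Run.load (q + 1) (st (q + 1)) ⟨trivial, trivial⟩
        (by simp [RExpr.val, hS.size]; ring) (hidx _ (by omega)) (by simp [hS.idx]) <|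
        Run.seq <| Run.load q (w (st q)) ⟨trivial, trivial⟩ (by simp [RExpr.val, hS.size])
        (hidx _ (by omega)) (by simp [hS.val]) <|
        Run.seq <| Run.load (q + 1) (w (st (q + 1))) ⟨trivial, trivial⟩
        (by simp [RExpr.val, hS.size]; ring) (hidx _ (by omega)) (by simp [hS.val]) <|
        Run.cond ((w i - w (st (q + 1))) * ((st (q + 1) : ℝ) - st q))
          ((w (st (q + 1)) - w (st q)) * ((i : ℝ) - st (q + 1)))
          ⟨⟨trivial, trivial⟩, trivial, trivial⟩ ⟨⟨trivial, trivial⟩, trivial, trivial⟩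
          (by simp [RExpr.val]) (by simp [RExpr.val, h23]) ?_ ?_
      · intro hlt'
        refine Run.skip <| Run.cond 0 0 trivial trivial (by simp [RExpr.val])
          (by simp [RExpr.val]) (by simp) fun _ => ?_
        refine (hpush 70 _ le_rfl (by simp [h7]) (by simp [h23]) (by simp) (by simp [hS.size])
          (by simp) (fun q' hq' => ?_)).mono fun t' s₂ _ h => ⟨?_, h.2⟩
        · obtain rfl : q = q' := by omega
          exact hlt'
        · have := h.1; simp [RExpr.cost]; omega
      · intro hle
        refine Run.assign 1 trivial (by simp [RExpr.val]) <| Run.cond 0 1 trivial trivial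
          (by simp [RExpr.val]) (by simp [RExpr.val]) (fun _ => ?_) (by simp)
        refine Run.assign ((q + 1 : ℕ) : ℝ) ⟨trivial, trivial⟩
          (by simp [RExpr.val, hS.size]; ring) ?_
        refine ⟨by simp [RExpr.cost], μ - 1, by omega, by simp [h7], i, q + 1, st, hiE,
          by simp [h23], by simp, by omega, hS.hull.pop hlt hle, by simp, fun t ht => ?_,
          fun t ht => ?_⟩
        · simp [hS.idx t (by omega)]
        · simp [hS.val t (by omega)]
    · intro hm
      refine Run.skip <| Run.cond 0 0 trivial trivial (by simp [RExpr.val])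
        (by simp [RExpr.val]) (by simp) fun _ => ?_
      refine (hpush 70 _ le_rfl (by simp [h7]) (by simp [h23]) (by simp) (by simp [hS.size])
          (by simp) (fun q' hq' => ?_)).mono fun t' s₂ _ h => ⟨?_, h.2⟩
      · have : m ≤ 1 := by exact_mod_cast hm
        omega
      · have := h.1; simp [RExpr.cost]; omega
  · rintro μ t s' hk ⟨h7, i, m, st, hiE, h23, hm0, hμ, hS⟩ hge ht
    simp only [RExpr.val, h23, h7, Nat.cast_le] at hge
    obtain rfl : i = E := by omega
    refine hQ _ s' ?_ ?_ ⟨m, st, hm0 hE0, hS⟩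
    · refine ⟨fun r hr => ?_, fun a ha => hk.arr a ha⟩
      simp only [hullScan, RProg.setsReg, Bool.or_eq_false_iff, beq_eq_false_iff_ne] at hr
      rw [hk.reg r hr.2.2]
      simp [hr.1, hr.2.1]
    · simp only [RExpr.cost] at ht ⊢
      omega

/-- Advances the pointer `reg 29` on the stack, or writes entry `reg 31` of the transformed row. -/
def walkStep : RProg :=
  .seq (.assign 18 (.sub (.div (.reg 31) (.reg 6)) (.lit 2))) <|
  .seq (.assign 25 (.load 8 (.reg 29))) <|
  .seq (.assign 27 (.load 10 (.reg 29))) <|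
  .seq (.assign 27 (.add (.reg 27)
    (.mul (.sub (.div (.reg 25) (.reg 5)) (.lit 1)) (.reg 18)))) <|
  .seq (.assign 24 (.lit 0)) <|
  .seq (.cond (.add (.reg 29) (.lit 1)) (.reg 22)
    (.seq (.assign 26 (.load 8 (.add (.reg 29) (.lit 1)))) <|
     .seq (.assign 28 (.load 10 (.add (.reg 29) (.lit 1)))) <|
     .seq (.assign 28 (.add (.reg 28)
       (.mul (.sub (.div (.reg 26) (.reg 5)) (.lit 1)) (.reg 18)))) <|
     .cond (.reg 28) (.reg 27) .skip (.assign 24 (.lit 1)))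
    .skip) <|
  .cond (.lit 0) (.reg 24) (.assign 29 (.add (.reg 29) (.lit 1)))
    (.seq (.store 6 (.add (.mul (.reg 31) (.reg 20)) (.reg 21)) (.reg 27)) <|
     .seq (.assign 16 (.load 5 (.add (.mul (.reg 21) (.reg 7)) (.reg 25)))) <|
     .seq (.store 7 (.add (.mul (.reg 31) (.reg 20)) (.reg 21)) (.reg 16)) <|
     .assign 31 (.add (.reg 31) (.lit 1)))

/-- Evaluates the envelope on the stack at all directions of the grid. -/
def hullWalk : RProg :=
  .seq (.assign 29 (.lit 0)) <| .seq (.assign 31 (.lit 0)) <| .loop (.reg 31) (.reg 8) walkStep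

/-- Transforms row `reg 21` of the table. -/
def rowTransform : RProg := .seq hullScan hullWalk

/-- The registers with the dimensions of the table and the current row. -/
structure RowEnv (H K : ℝ) (E G R row : ℕ) (s : RState) : Prop where
  r5 : s.reg 5 = H
  r6 : s.reg 6 = K
  r7 : s.reg 7 = E
  r8 : s.reg 8 = G
  r20 : s.reg 20 = R
  r21 : s.reg 21 = row

/-- Column entry `(j, row)` of the new table holds the maximum over row `row` of the old table. -/
def IsRowMax (H K : ℝ) (E R row j : ℕ) (val val' id id' : ℕ → ℝ) : Prop :=
  (∃ a < E, val' (j * R + row) = val (row * E + a) + cellPos H a * dirPos K j ∧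
    id' (j * R + row) = id (row * E + a)) ∧
  ∀ i < E, val (row * E + i) + cellPos H i * dirPos K j ≤ val' (j * R + row)

/-- As the direction increases, the maximizing line moves to larger slopes, so the pointer never has
to go back. Every round advances the direction or the pointer, and the variant is `G + m - j - p`.
-/
theorem hullWalk_run {W : ℝ} {s : RState} {Q : ℕ → RState → Prop} {H K : ℝ} {E G R row m : ℕ}
    {st : ℕ → ℕ} {w : ℕ → ℝ} (hs : RowEnv H K E G R row s) (hH : 0 < H) (hK : 0 < K)
    (hrow : row < R) (hw : ∀ i, w i = s.arr 4 (row * E + i)) (hm0 : 0 < m)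
    (hS : ScanState w E E m st s)
    (hRE : ((R * E : ℕ) : ℝ) ≤ W) (hRG : ((G * R : ℕ) : ℝ) ≤ W) (hWE : (E : ℝ) ≤ W)
    (hQ : ∀ t s', Keeps hullWalk s s' → t ≤ 200 * (E + G) + 100 →
      (∀ j < G, IsRowMax H K E R row j (s.arr 4) (s'.arr 6) (s.arr 5) (s'.arr 7)) →
      (∀ x, (∀ j < G, x ≠ j * R + row) →
        s'.arr 6 x = s.arr 6 x ∧ s'.arr 7 x = s.arr 7 x) → Q t s') :
    Run W hullWalk s Q := by
  have hmE : m ≤ E := by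
    have : ∀ t, t < m → t ≤ st t := by
      intro t
      induction t with
      | zero => simp
      | succ t ih => intro ht; have := ih (by omega); have := hS.hull.mono t ht; omega
    have := this (m - 1) (by omega); have := hS.hull.lt (m - 1) (by omega); omega
  have hidx : ∀ t < E, (t : ℝ) < W := fun t ht => lt_of_lt_of_le (by exact_mod_cast ht) hWE
  have hstE : ∀ t < m, st t < E := hS.hull.lt
  have hstm : ∀ a b, a ≤ b → b < m → st a ≤ st b := by
    intro a b hab
    induction b, hab using Nat.le_induction with
    | base => exact fun _ => le_rfl
    | succ b _ ih => exact fun hb => (ih (by omega)).trans (hS.hull.mono b hb).le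
  -- the value of a stacked line
  set f : ℕ → ℝ → ℝ := fun t v => w (st t) + cellPos H (st t) * v with hf
  -- The scan used the integer slopes `i`, while the cells have slopes `i / H - 1`. Up to the common
  -- term `-v`, the same envelope is evaluated at `v / H`.
  have hfv : ∀ i v, w i + cellPos H i * v = w i + i * (v / H) - v := by
    intro i v; simp only [cellPos]; field_simp; ring
  refine Run.seq <| Run.assign 0 trivial (by simp [RExpr.val]) <| Run.seq <|
    Run.assign 0 trivial (by simp [RExpr.val]) ?_
  refine Run.loop (fun μ s' => s'.reg 31 ≤ G ∧ ∃ j p, μ + j + p = G + m ∧ s'.reg 31 = j ∧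
    s'.reg 29 = p ∧ p < m ∧ (∀ t ≤ p, f t (dirPos K j) ≤ f p (dirPos K j)) ∧
    (∀ j' < j, IsRowMax H K E R row j' (s.arr 4) (s'.arr 6) (s.arr 5) (s'.arr 7)) ∧
    (∀ x, (∀ j < G, x ≠ j * R + row) → s'.arr 6 x = s.arr 6 x ∧ s'.arr 7 x = s.arr 7 x))
    120 (G + m) (fun m s' _ => ⟨trivial, trivial⟩) ?_ ?_ ?_
  · refine ⟨by simp, 0, 0, by omega, by simp, by simp, hm0, ?_, by simp, by simp⟩
    intro t ht; rw [Nat.le_zero.1 ht]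
  · rintro μ s' hk ⟨-, j, p, hμ, h31, h29, hpm, hmax, hdone, hfr⟩ hlt
    have h8 : s'.reg 8 = G := (hk.reg 8 rfl).trans (by simp [hs.r8])
    have h5 : s'.reg 5 = H := (hk.reg 5 rfl).trans (by simp [hs.r5])
    have h6 : s'.reg 6 = K := (hk.reg 6 rfl).trans (by simp [hs.r6])
    have h7 : s'.reg 7 = E := (hk.reg 7 rfl).trans (by simp [hs.r7])
    have h20 : s'.reg 20 = R := (hk.reg 20 rfl).trans (by simp [hs.r20])
    have h21 : s'.reg 21 = row := (hk.reg 21 rfl).trans (by simp [hs.r21])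
    have h22 : s'.reg 22 = m := (hk.reg 22 rfl).trans (by simp [hS.size])
    have a5 : s'.arr 5 = s.arr 5 := (hk.arr 5 rfl).trans rfl
    have a8 : s'.arr 8 = s.arr 8 := (hk.arr 8 rfl).trans rfl
    have a10 : s'.arr 10 = s.arr 10 := (hk.arr 10 rfl).trans rfl
    simp only [RExpr.val, h31, h8, Nat.cast_lt] at hlt
    have hjR : j * R + row < G * R := by nlinarith
    have hwrite : ∀ (t : ℕ) (s₁ : RState), t ≤ 90 → s₁.reg 31 = j → s₁.reg 20 = R →
        s₁.reg 21 = row → s₁.reg 7 = E → s₁.reg 25 = st p → s₁.reg 27 = f p (dirPos K j) →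
        s₁.reg 29 = p → s₁.arr = s'.arr →
        (p + 1 < m → f (p + 1) (dirPos K j) < f p (dirPos K j)) →
        Run W (.seq (.store 6 (.add (.mul (.reg 31) (.reg 20)) (.reg 21)) (.reg 27)) <|
          .seq (.assign 16 (.load 5 (.add (.mul (.reg 21) (.reg 7)) (.reg 25)))) <|
          .seq (.store 7 (.add (.mul (.reg 31) (.reg 20)) (.reg 21)) (.reg 16)) <|
          .assign 31 (.add (.reg 31) (.lit 1))) s₁ fun t' s'' => t + t' ≤ 120 ∧ ∃ μ' < μ,
          s''.reg 31 ≤ G ∧ ∃ j p, μ' + j + p = G + m ∧ s''.reg 31 = j ∧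
          s''.reg 29 = p ∧ p < m ∧ (∀ t ≤ p, f t (dirPos K j) ≤ f p (dirPos K j)) ∧
          (∀ j' < j, IsRowMax H K E R row j' (s.arr 4) (s''.arr 6) (s.arr 5) (s''.arr 7)) ∧
          (∀ x, (∀ j < G, x ≠ j * R + row) →
            s''.arr 6 x = s.arr 6 x ∧ s''.arr 7 x = s.arr 7 x) := by
      intro t s₁ ht e31 e20 e21 e7 e25 e27 e29 earr hdesc
      have hRE' : row * E + st p < R * E := by
        have := hstE p hpm
        nlinarith
      refine Run.seq <| Run.store (j * R + row) (f p (dirPos K j)) ⟨⟨trivial, trivial⟩, trivial⟩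
        trivial (by simp [RExpr.val, e31, e20, e21])
        (lt_of_lt_of_le (by exact_mod_cast hjR) hRG) (by simp [RExpr.val, e27]) <|
        Run.seq <| Run.load (row * E + st p) (s.arr 5 (row * E + st p))
        ⟨⟨trivial, trivial⟩, trivial⟩ (by simp [RExpr.val, e21, e7, e25])
        (lt_of_lt_of_le (by exact_mod_cast hRE') hRE) (by simp [earr, a5]) <|
        Run.seq <| Run.store (j * R + row) (s.arr 5 (row * E + st p))
        ⟨⟨trivial, trivial⟩, trivial⟩ trivial (by simp [RExpr.val, e31, e20, e21])
        (lt_of_lt_of_le (by exact_mod_cast hjR) hRG) (by simp [RExpr.val]) <|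
        Run.assign ((j + 1 : ℕ) : ℝ) ⟨trivial, trivial⟩ (by simp [RExpr.val, e31]) ?_
      refine ⟨by simp [RExpr.cost]; omega, μ - 1, by omega, ?_, j + 1, p, by omega, by simp,
        by simp [e29], hpm, ?_, ?_, ?_⟩
      · simp only [setReg_reg, if_true]; exact_mod_cast hlt
      · intro t ht
        -- Passing to the next direction adds `cellPos / K`, which is no larger for a line stacked
        -- below `p`; dominance over the lines left of the pointer persists.
        have h1 := hmax t ht
        have h2 : (st t : ℝ) ≤ st p := by exact_mod_cast hstm t p ht hpm
        have h3 : dirPos K (j + 1) = dirPos K j + 1 / K := by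
          simp only [dirPos]; push_cast; ring
        have h4 : cellPos H (st t) ≤ cellPos H (st p) := by
          simp only [cellPos]; gcongr
        have h5 := mul_le_mul_of_nonneg_right h4 (by positivity : 0 ≤ 1 / K)
        simp only [hf] at h1 ⊢
        rw [h3, mul_add, mul_add]
        linarith
      · intro j' hj'
        rcases Nat.lt_succ_iff_lt_or_eq.1 hj' with hj' | rfl
        · have hR0 : R ≠ 0 := by omega
          simpa [IsRowMax, hj'.ne, hR0, earr] using hdone j' hj'
        · refine ⟨⟨st p, hstE p hpm, ?_, by simp⟩, ?_⟩
          · simp [hf, hw]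
          · intro i hi
            have : s.arr 4 (row * E + i) + cellPos H i * dirPos K j' ≤ f p (dirPos K j') := by
              rw [← hw, hfv]
              simp only [hf]
              rw [hfv]
              -- Lines left of the pointer are dominated by the invariant, lines right of it by the
              -- descent that ended the advance.
              have hdesc' := hS.hull.le_of_descent (v := dirPos K j' / H) (p := p) (by
                intro h
                have := hdesc h
                simp only [hf] at this
                rw [hfv, hfv] at this
                linarith)
              rcases hS.hull.dom i hi (dirPos K j' / H) with ⟨t, ht, hle⟩ | ⟨h, -⟩
              · rcases le_total p t with h | h
                · have := hdesc' t h ht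
                  linarith
                · have h1 := hmax t h
                  simp only [hf] at h1
                  rw [hfv, hfv] at h1
                  linarith
              -- The pending line does not exist once the scan has reached `E`.
              · omega
            simpa using this
      · intro x hx
        have hne := hx j hlt
        simpa [hne, earr] using hfr x hx
    refine Run.seq <| Run.assign (dirPos K j) ⟨⟨trivial, trivial, ?_⟩, trivial⟩
      (by simp [RExpr.val, h31, h6, dirPos]) <|
      Run.seq <| Run.load p (st p) trivial (by simp [RExpr.val, h29]) (hidx p (by omega))
      (by simp [a8, hS.idx p hpm]) <|
      Run.seq <| Run.load p (w (st p)) trivial (by simp [RExpr.val, h29]) (hidx p (by omega))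
      (by simp [a10, hS.val p hpm]) <|
      Run.seq <| Run.assign (f p (dirPos K j)) ⟨trivial, ⟨⟨trivial, trivial, ?_⟩, trivial⟩, trivial⟩
      (by simp [RExpr.val, h5, hf, cellPos]) <|
      Run.seq <| Run.assign 0 trivial (by simp [RExpr.val]) <|
      Run.seq <| Run.cond ((p + 1 : ℕ) : ℝ) m ⟨trivial, trivial⟩ trivial
      (by simp [RExpr.val, h29]) (by simp [RExpr.val, h22]) ?_ ?_
    · simp [RExpr.val, h6, hK.ne']
    · simp [RExpr.val, h5, hH.ne']
    · intro hpm'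
      have hpm' : p + 1 < m := by exact_mod_cast hpm'
      refine Run.seq <| Run.load (p + 1) (st (p + 1)) ⟨trivial, trivial⟩
        (by simp [RExpr.val, h29]) (hidx _ (by omega)) (by simp [a8, hS.idx _ hpm']) <|
        Run.seq <| Run.load (p + 1) (w (st (p + 1))) ⟨trivial, trivial⟩
        (by simp [RExpr.val, h29]) (hidx _ (by omega)) (by simp [a10, hS.val _ hpm']) <|
        Run.seq <| Run.assign (f (p + 1) (dirPos K j))
        ⟨trivial, ⟨⟨trivial, trivial, ?_⟩, trivial⟩, trivial⟩
        (by simp [RExpr.val, h5, hf, cellPos]) <|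
        Run.cond (f (p + 1) (dirPos K j)) (f p (dirPos K j)) trivial trivial
        (by simp [RExpr.val]) (by simp [RExpr.val]) ?_ ?_
      · simp [RExpr.val, h5, hH.ne']
      · intro hlt'
        refine Run.skip <| Run.cond 0 0 trivial trivial (by simp [RExpr.val])
          (by simp [RExpr.val]) (by simp) fun _ => ?_
        refine (hwrite 90 _ le_rfl (by simp [h31]) (by simp [h20]) (by simp [h21]) (by simp [h7])
          (by simp) (by simp) (by simp [h29]) (by simp) (fun _ => hlt')).mono
          fun t' s₂ _ h => ⟨?_, h.2⟩
        have := h.1; simp [RExpr.cost]; omega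
      · intro hle
        refine Run.assign 1 trivial (by simp [RExpr.val]) <| Run.cond 0 1 trivial trivial
          (by simp [RExpr.val]) (by simp [RExpr.val]) (fun _ => ?_) (by simp)
        refine Run.assign ((p + 1 : ℕ) : ℝ) ⟨trivial, trivial⟩ (by simp [RExpr.val, h29]) ?_
        refine ⟨by simp [RExpr.cost], μ - 1, by omega, ?_, j, p + 1, by omega, by simp [h31],
          by simp, hpm', ?_, by simpa using hdone, by simpa using hfr⟩
        · simp [h31, hlt.le]
        · intro t ht
          rcases Nat.le_succ_iff.1 ht with h | rfl
          · exact (hmax t h).trans hle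
          · exact le_rfl
    · intro hpm'
      have hpm' : m ≤ p + 1 := by exact_mod_cast hpm'
      refine Run.skip <| Run.cond 0 0 trivial trivial (by simp [RExpr.val])
        (by simp [RExpr.val]) (by simp) fun _ => ?_
      refine (hwrite 90 _ le_rfl (by simp [h31]) (by simp [h20]) (by simp [h21]) (by simp [h7])
        (by simp) (by simp) (by simp [h29]) (by simp) (fun _ => by omega)).mono
        fun t' s₂ _ h => ⟨?_, h.2⟩
      have := h.1; simp [RExpr.cost]; omega
  · rintro μ t s' hk ⟨h31G, j, p, hμ, h31, h29, hpm, hmax, hdone, hfr⟩ hge ht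
    have h8 : s'.reg 8 = G := (hk.reg 8 rfl).trans (by simp [hs.r8])
    simp only [RExpr.val, h31, h8, Nat.cast_le] at hge
    rw [h31] at h31G
    obtain rfl : j = G := le_antisymm (by exact_mod_cast h31G) hge
    refine hQ _ s' ⟨fun r hr => ?_, fun a ha => hk.arr a ha⟩ ?_ hdone hfr
    · simp only [hullWalk, RProg.setsReg, Bool.or_eq_false_iff, beq_eq_false_iff_ne] at hr
      rw [hk.reg r hr.2.2]
      simp [hr.1, hr.2.1]
    · simp only [RExpr.cost] at ht ⊢
      have : (j + m) * (120 + 1 + 1 + 1) ≤ (j + E) * (120 + 1 + 1 + 1) := by gcongr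
      omega

theorem rowTransform_run {W : ℝ} {s : RState} {Q : ℕ → RState → Prop} {H K : ℝ} {E G R row : ℕ}
    (hs : RowEnv H K E G R row s) (hH : 0 < H) (hK : 0 < K) (hrow : row < R) (hE : 0 < E)
    (hRE : ((R * E : ℕ) : ℝ) ≤ W) (hRG : ((G * R : ℕ) : ℝ) ≤ W) (hWE : (E : ℝ) ≤ W)
    (hQ : ∀ t s', Keeps rowTransform s s' → t ≤ 400 * (E + G) + 200 →
      (∀ j < G, IsRowMax H K E R row j (s.arr 4) (s'.arr 6) (s.arr 5) (s'.arr 7)) →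
      (∀ x, (∀ j < G, x ≠ j * R + row) →
        s'.arr 6 x = s.arr 6 x ∧ s'.arr 7 x = s.arr 7 x) → Q t s') :
    Run W rowTransform s Q := by
  refine Run.seq <| hullScan_run hs.r7 hs.r21 ?_ hWE hE fun t s' hk ht ⟨m, st, hm, hS⟩ => ?_
  · refine le_trans ?_ hRE
    exact_mod_cast Nat.mul_le_mul_right E hrow
  have a4 : s'.arr 4 = s.arr 4 := hk.arr 4 rfl
  have a5 : s'.arr 5 = s.arr 5 := hk.arr 5 rfl
  have a6 : s'.arr 6 = s.arr 6 := hk.arr 6 rfl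
  have a7 : s'.arr 7 = s.arr 7 := hk.arr 7 rfl
  have hs' : RowEnv H K E G R row s' := ⟨(hk.reg 5 rfl).trans hs.r5, (hk.reg 6 rfl).trans hs.r6,
    (hk.reg 7 rfl).trans hs.r7, (hk.reg 8 rfl).trans hs.r8, (hk.reg 20 rfl).trans hs.r20,
    (hk.reg 21 rfl).trans hs.r21⟩
  refine hullWalk_run hs' hH hK hrow (fun i => by rw [a4]) hm hS hRE hRG hWE
    fun t' s'' hk' ht' hmax hfr => ?_
  refine hQ _ s'' ⟨fun r hr => ?_, fun a ha => ?_⟩ (by omega) (by rwa [a4, a5] at hmax)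
    (by rwa [a6, a7] at hfr)
  · simp only [rowTransform, RProg.setsReg, Bool.or_eq_false_iff] at hr
    exact (hk'.reg r hr.2).trans (hk.reg r hr.1)
  · simp only [rowTransform, RProg.setsArr, Bool.or_eq_false_iff] at ha
    exact (hk'.arr a ha.2).trans (hk.arr a ha.1)

/-! ### The transform of the whole table -/

/-- Copies the new table to the old one. -/
def copyTable : RProg :=
  RProg.for 14 (.mul (.reg 8) (.reg 20)) <|
    .seq (.assign 16 (.load 6 (.reg 14))) <| .seq (.store 4 (.reg 14) (.reg 16)) <|
    .seq (.assign 16 (.load 7 (.reg 14))) <| .store 5 (.reg 14) (.reg 16)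

/-- Transforms the last axis of the table and makes it the first one. -/
def axisTransform : RProg :=
  .seq (RProg.for 21 (.reg 20) rowTransform) <| .seq copyTable <|
    .assign 20 (.div (.mul (.reg 20) (.reg 8)) (.reg 7))

/-- The registers with the dimensions of the table. -/
structure TableEnv (H K : ℝ) (E G : ℕ) (s : RState) : Prop where
  r5 : s.reg 5 = H
  r6 : s.reg 6 = K
  r7 : s.reg 7 = E
  r8 : s.reg 8 = G

theorem copyTable_run {W : ℝ} {s : RState} {Q : ℕ → RState → Prop} {G R : ℕ}
    (h8 : s.reg 8 = G) (h20 : s.reg 20 = R) (hW : ((G * R : ℕ) : ℝ) ≤ W)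
    (hQ : ∀ t s', Keeps copyTable s s' → t ≤ 50 * (G * R) + 10 →
      (∀ x < G * R, s'.arr 4 x = s.arr 6 x ∧ s'.arr 5 x = s.arr 7 x) → Q t s') :
    Run W copyTable s Q := by
  refine Run.for (fun i s' => ∀ x < i, s'.arr 4 x = s.arr 6 x ∧ s'.arr 5 x = s.arr 7 x)
    (G * R) 20 rfl (fun s' hk => ⟨⟨trivial, trivial⟩, ?_⟩) (by simp) ?_ ?_
  · have e8 : s'.reg 8 = G := (hk.reg 8 rfl).trans h8
    have e20 : s'.reg 20 = R := (hk.reg 20 rfl).trans h20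
    simp [RExpr.val, e8, e20]
  · intro i s' hi hk h14 hI
    have hiW : (i : ℝ) < W := lt_of_lt_of_le (by exact_mod_cast hi) hW
    refine Run.seq <| Run.load i (s.arr 6 i) trivial (by simp [RExpr.val, h14]) hiW
      (by simp [hk.arr 6 rfl]) <|
      Run.seq <| Run.store i (s.arr 6 i) trivial trivial (by simp [RExpr.val, h14]) hiW
      (by simp [RExpr.val]) <|
      Run.seq <| Run.load i (s.arr 7 i) trivial (by simp [RExpr.val, h14]) hiW
      (by simp [hk.arr 7 rfl]) <|
      Run.store i (s.arr 7 i) trivial trivial (by simp [RExpr.val, h14]) hiW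
      (by simp [RExpr.val]) ⟨by simp [RExpr.cost], fun x hx => ?_⟩
    rcases Nat.lt_succ_iff_lt_or_eq.1 hx with h | rfl
    · simpa [h.ne] using hI x h
    · simp
  · intro t s' hk hI ht
    simp only [RExpr.cost] at ht
    refine hQ t s' hk (by omega) hI

theorem axisTransform_run {W : ℝ} {s : RState} {Q : ℕ → RState → Prop} {H K : ℝ} {E G R M : ℕ}
    (hs : TableEnv H K E G s) (h20 : s.reg 20 = R) (hH : 0 < H) (hK : 0 < K) (hE : 0 < E)
    (hRE : R * E ≤ M) (hRG : G * R ≤ M) (hEM : E ≤ M) (hMW : (M : ℝ) ≤ W)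
    (hQ : ∀ t s', Keeps axisTransform s s' → t ≤ 1200 * M + 100 → s'.reg 20 = R * G / E →
      (∀ row < R, ∀ j < G, IsRowMax H K E R row j (s.arr 4) (s'.arr 4) (s.arr 5) (s'.arr 5)) →
      Q t s') :
    Run W axisTransform s Q := by
  have hW : ∀ x ≤ M, (x : ℝ) ≤ W := fun x hx => le_trans (by exact_mod_cast hx) hMW
  -- The target index determines its row modulo `R`, so transforming one row leaves the results of
  -- the others intact.
  have hinj : ∀ row row' j j' : ℕ, row < R → row' < R → j * R + row = j' * R + row' →
      row = row' := by
    intro row row' j j' h h' he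
    have := congrArg (· % R) he
    simpa [Nat.mul_add_mod', Nat.mod_eq_of_lt h, Nat.mod_eq_of_lt h'] using this
  refine Run.seq <| Run.for (fun i s' => ∀ row < i, ∀ j < G,
    IsRowMax H K E R row j (s.arr 4) (s'.arr 6) (s.arr 5) (s'.arr 7)) R (400 * (E + G) + 200) rfl
    (fun s' hk => ⟨trivial, (hk.reg 20 rfl).trans h20⟩) (by simp) ?_ ?_
  · intro row s' hrow hk h21 hI
    have a4 : s'.arr 4 = s.arr 4 := hk.arr 4 rfl
    have a5 : s'.arr 5 = s.arr 5 := hk.arr 5 rfl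
    refine rowTransform_run (H := H) (K := K) (E := E) (G := G) (R := R) (row := row)
      ⟨(hk.reg 5 rfl).trans hs.r5, (hk.reg 6 rfl).trans hs.r6,
      (hk.reg 7 rfl).trans hs.r7, (hk.reg 8 rfl).trans hs.r8, (hk.reg 20 rfl).trans h20, h21⟩
      hH hK hrow hE (hW _ hRE) (hW _ hRG) (hW _ hEM)
      fun t s'' hk' ht hmax hfr => ⟨ht, fun row' hrow' j hj => ?_⟩
    rw [a4, a5] at hmax
    rcases Nat.lt_succ_iff_lt_or_eq.1 hrow' with h | rfl
    · have := hfr (j * R + row') fun j' _ he =>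
        h.ne (hinj _ _ _ _ (h.trans hrow) hrow he)
      simpa [IsRowMax, this.1, this.2] using hI row' h j hj
    · exact hmax j hj
  · intro t₁ s₁ hk₁ hmax ht₁
    have e7 : s₁.reg 7 = E := (hk₁.reg 7 rfl).trans hs.r7
    have e8 : s₁.reg 8 = G := (hk₁.reg 8 rfl).trans hs.r8
    have e20 : s₁.reg 20 = R := (hk₁.reg 20 rfl).trans h20
    refine Run.seq <| copyTable_run e8 e20 (hW _ hRG) fun t₂ s₂ hk₂ ht₂ hcopy => ?_
    refine Run.assign (R * G / E : ℝ) ⟨⟨trivial, trivial⟩, trivial, ?_⟩ ?_ ?_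
    · simp [RExpr.val, hk₂.reg 7 rfl, e7, hE.ne']
    · simp [RExpr.val, hk₂.reg 7 rfl, e7, hk₂.reg 8 rfl, e8, hk₂.reg 20 rfl, e20]
    refine hQ _ _ ⟨fun r hr => ?_, fun a ha => ?_⟩ ?_ (by simp) fun row hrow j hj => ?_
    · simp only [axisTransform, RProg.setsReg, Bool.or_eq_false_iff,
        beq_eq_false_iff_ne] at hr
      simp [hr.2.2, (hk₂.reg r hr.2.1), hk₁.reg r hr.1]
    · simp only [axisTransform, RProg.setsArr, Bool.or_eq_false_iff] at ha
      simp [(hk₂.arr a ha.2.1), hk₁.arr a ha.1]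
    · simp only [RExpr.cost] at ht₁ ⊢
      have hRM : R ≤ M := (Nat.le_mul_of_pos_right R hE).trans hRE
      have : R * (400 * (E + G) + 200 + 1 + 6) = 400 * (R * E) + 400 * (G * R) + 207 * R := by ring
      omega
    · have hlt : j * R + row < G * R := by nlinarith
      have := hcopy _ hlt
      simpa [IsRowMax, this.1, this.2] using hmax row hrow j hj

/-- The inner product of the cell with index `lo` and the direction with index `jj`, on the first
`m` axes. -/
noncomputable def pairing (H K : ℝ) (E G : ℕ) : ℕ → ℕ → ℕ → ℝ
  | 0, _, _ => 0
  | m + 1, jj, lo => pairing H K E G m (jj % G ^ m) (lo % E ^ m) +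
      cellPos H (lo / E ^ m) * dirPos K (jj / G ^ m)

/-- The table after the transform of `m` of its `m + r` axes. -/
def IsTransform (H K : ℝ) (E G m r : ℕ) (val₀ val id₀ id : ℕ → ℝ) : Prop :=
  ∀ jj < G ^ m, ∀ ii < E ^ r,
    (∀ lo < E ^ m, val₀ (ii * E ^ m + lo) + pairing H K E G m jj lo ≤ val (jj * E ^ r + ii)) ∧
    ∃ lo < E ^ m, val (jj * E ^ r + ii) = val₀ (ii * E ^ m + lo) + pairing H K E G m jj lo ∧
      id (jj * E ^ r + ii) = id₀ (ii * E ^ m + lo)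

theorem IsTransform.zero (H K : ℝ) (E G r : ℕ) (val id : ℕ → ℝ) :
    IsTransform H K E G 0 r val val id id := by
  intro jj hjj ii hii
  obtain rfl : jj = 0 := by simpa using hjj
  simp [pairing]

/-- The leading digits of a direction and a cell belong to the same axis, so a new leading digit
adds a single product. -/
theorem pairing_succ (H K : ℝ) {E G m jj lo : ℕ} (i j : ℕ) (hlo : lo < E ^ m) (hjj : jj < G ^ m) :
    pairing H K E G (m + 1) (j * G ^ m + jj) (i * E ^ m + lo) =
      pairing H K E G m jj lo + cellPos H i * dirPos K j := by
  have h1 : (j * G ^ m + jj) % G ^ m = jj := by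
    rw [Nat.mul_add_mod', Nat.mod_eq_of_lt hjj]
  have h2 : (i * E ^ m + lo) % E ^ m = lo := by
    rw [Nat.mul_add_mod', Nat.mod_eq_of_lt hlo]
  have h3 : (j * G ^ m + jj) / G ^ m = j := by
    rw [mul_comm, Nat.mul_add_div (by omega), Nat.div_eq_of_lt hjj, add_zero]
  have h4 : (i * E ^ m + lo) / E ^ m = i := by
    rw [mul_comm, Nat.mul_add_div (by omega), Nat.div_eq_of_lt hlo, add_zero]
  simp only [pairing, h1, h2, h3, h4]

theorem exists_digit {b m x : ℕ} (hx : x < b ^ (m + 1)) :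
    ∃ i < b, ∃ lo < b ^ m, x = i * b ^ m + lo := by
  have hb : 0 < b := by
    rcases Nat.eq_zero_or_pos b with rfl | h
    · simp at hx
    · exact h
  have hpos : 0 < b ^ m := by positivity
  refine ⟨x / b ^ m, ?_, x % b ^ m, Nat.mod_lt _ hpos, (Nat.div_add_mod' x _).symm⟩
  rw [Nat.div_lt_iff_lt_mul hpos]
  rwa [pow_succ'] at hx

theorem digit_lt {b m i lo : ℕ} (hi : i < b) (hlo : lo < b ^ m) : i * b ^ m + lo < b ^ (m + 1) := by
  rw [pow_succ']
  calc i * b ^ m + lo < i * b ^ m + b ^ m := by omega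
    _ = (i + 1) * b ^ m := by ring
    _ ≤ b * b ^ m := Nat.mul_le_mul_right _ hi

/-- The maximum of a sum over independent axes is an iterated maximum. In the index, the lowest
digit `a` of the cell disappears and the digit `j` of the direction is put in front; the
reassociations `hix`, `hia` and `hil` record this rotation of digits. -/
theorem IsTransform.step {H K : ℝ} {E G m r : ℕ} {val₀ val val' id₀ id id' : ℕ → ℝ}
    (h : IsTransform H K E G m (r + 1) val₀ val id₀ id)
    (hmax : ∀ row < G ^ m * E ^ r, ∀ j < G, IsRowMax H K E (G ^ m * E ^ r) row j val val' id id') :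
    IsTransform H K E G (m + 1) r val₀ val' id₀ id' := by
  intro jj₀ hjj₀ ii hii
  obtain ⟨j, hj, jj, hjj, rfl⟩ := exists_digit hjj₀
  have hrow : jj * E ^ r + ii < G ^ m * E ^ r :=
    calc jj * E ^ r + ii < (jj + 1) * E ^ r := by rw [add_mul, one_mul]; omega
      _ ≤ G ^ m * E ^ r := Nat.mul_le_mul_right _ hjj
  have hix : (j * G ^ m + jj) * E ^ r + ii = j * (G ^ m * E ^ r) + (jj * E ^ r + ii) := by ring
  have hia : ∀ a, (jj * E ^ r + ii) * E + a = jj * E ^ (r + 1) + (ii * E + a) := by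
    intro a; ring
  have hil : ∀ a lo, (ii * E + a) * E ^ m + lo = ii * E ^ (m + 1) + (a * E ^ m + lo) := by
    intro a lo; ring
  have hlt : ∀ a < E, ii * E + a < E ^ (r + 1) := by
    intro a ha
    calc ii * E + a < (ii + 1) * E := by rw [add_mul, one_mul]; omega
      _ ≤ E ^ r * E := Nat.mul_le_mul_right _ hii
  obtain ⟨⟨a, ha, hv, hid⟩, hle⟩ := hmax _ hrow j hj
  rw [hix]
  constructor
  · intro lo₀ hlo₀
    obtain ⟨i, hi, lo, hlo, rfl⟩ := exists_digit hlo₀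
    have h1 := (h jj hjj (ii * E + i) (hlt i hi)).1 lo hlo
    have h2 := hle i hi
    rw [hia] at h2
    rw [hil] at h1
    rw [pairing_succ H K i j hlo hjj]
    linarith
  · obtain ⟨lo, hlo, hv', hid'⟩ := (h jj hjj (ii * E + a) (hlt a ha)).2
    refine ⟨a * E ^ m + lo, digit_lt ha hlo, ?_, ?_⟩
    · rw [hv, hia, hv', hil, pairing_succ H K a j hlo hjj]; ring
    · rw [hid, hia, hid', hil]

/-- Transforms all `D` axes of the table. -/
def tableTransform (D : ℕ) : RProg :=
  .seq (.assign 20 (.div (.reg 9) (.reg 7))) <| RProg.for 30 (.lit D) axisTransform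

theorem tableTransform_run {W : ℝ} {s : RState} {Q : ℕ → RState → Prop} {H K : ℝ} {D E G U : ℕ}
    (hs : TableEnv H K E G s) (h9 : s.reg 9 = (E : ℝ) ^ D) (hH : 0 < H) (hK : 0 < K) (hE : 0 < E)
    (hEU : E ≤ U) (hGU : G ≤ U) (hW : ((U ^ D : ℕ) : ℝ) ≤ W)
    (hQ : ∀ t s', Keeps (tableTransform D) s s' → t ≤ D * (1200 * U ^ D + 200) + 200 →
      s'.reg 20 * E = (G : ℝ) ^ D →
      IsTransform H K E G D 0 (s.arr 4) (s'.arr 4) (s.arr 5) (s'.arr 5) → Q t s') :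
    Run W (tableTransform D) s Q := by
  have hE' : (E : ℝ) ≠ 0 := by exact_mod_cast hE.ne'
  refine Run.seq <| Run.assign ((E : ℝ) ^ D / E) ⟨trivial, trivial, ?_⟩
    (by simp [RExpr.val, h9, hs.r7]) ?_
  · simp [RExpr.val, hs.r7, hE']
  -- Register 20 holds the number of rows for the next axis. After the last axis it is `G ^ D / E`,
  -- not necessarily an integer; hence the invariant speaks of its product with `E`, which is also
  -- all that `collect` uses.
  refine Run.for (fun m s' => s'.reg 20 * E = (G : ℝ) ^ m * (E : ℝ) ^ (D - m) ∧
    IsTransform H K E G m (D - m) (s.arr 4) (s'.arr 4) (s.arr 5) (s'.arr 5)) D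
    (1200 * U ^ D + 100) rfl (fun s' hk => ⟨trivial, by simp [RExpr.val]⟩) ?_ ?_ ?_
  · refine ⟨?_, .zero _ _ _ _ _ _ _⟩
    simp
    field_simp
  · rintro m s' hm hk - ⟨hR, hT⟩
    obtain ⟨r, rfl⟩ : ∃ r, D = m + (r + 1) := ⟨D - m - 1, by omega⟩
    have e1 : m + (r + 1) - m = r + 1 := by omega
    have e2 : m + (r + 1) - (m + 1) = r := by omega
    rw [e1] at hR hT
    have h20 : s'.reg 20 = ((G ^ m * E ^ r : ℕ) : ℝ) := by
      push_cast
      apply mul_right_cancel₀ hE'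
      rw [hR, pow_succ]; ring
    refine axisTransform_run (H := H) (K := K) (E := E) (G := G) (R := G ^ m * E ^ r) (M := U ^ (m + (r + 1)))
      ⟨(hk.reg 5 rfl).trans (by simp [hs.r5]), (hk.reg 6 rfl).trans (by simp [hs.r6]),
      (hk.reg 7 rfl).trans (by simp [hs.r7]), (hk.reg 8 rfl).trans (by simp [hs.r8])⟩
      h20 hH hK hE ?_ ?_ ?_ hW fun t s'' hk' ht h20' hmax => ⟨ht, ?_, ?_⟩
    · calc G ^ m * E ^ r * E = G ^ m * E ^ (r + 1) := by ring
        _ ≤ U ^ m * U ^ (r + 1) := by gcongr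
        _ = _ := by ring
    · calc G * (G ^ m * E ^ r) = G ^ m * (G * E ^ r) := by ring
        _ ≤ U ^ m * (U * U ^ r) := by gcongr
        _ = _ := by ring
    · calc E ≤ U := hEU
        _ ≤ U ^ (m + (r + 1)) := Nat.le_self_pow (by omega) U
    · rw [e2]
      simp only [setReg_reg, h20']
      push_cast
      field_simp
      rw [pow_succ]
    · rw [e2]
      exact hT.step hmax
  · rintro t s' hk ⟨hR, hT⟩ ht
    refine hQ _ s' ⟨fun r hr => ?_, fun a ha => hk.arr a ha⟩ ?_ ?_ ?_
    · simp only [tableTransform, RProg.setsReg, Bool.or_eq_false_iff, beq_eq_false_iff_ne] at hr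
      rw [hk.reg r hr.2]
      simp [hr.1]
    · simp only [RExpr.cost] at ht ⊢
      have : D * (1200 * U ^ D + 100 + 1 + 6) ≤ D * (1200 * U ^ D + 200) := Nat.mul_le_mul_left _ (by omega)
      omega
    · simpa using hR
    · simpa using hT

/-! ### Cells and directions -/

/-- The number with base-`b` digits `f 0, …, f (m - 1)`, the lowest first. -/
def encode (b : ℕ) (f : ℕ → ℕ) (m : ℕ) : ℕ := ∑ k ∈ range m, f k * b ^ k

theorem encode_succ (b : ℕ) (f : ℕ → ℕ) (m : ℕ) :
    encode b f (m + 1) = f m * b ^ m + encode b f m := by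
  rw [encode, sum_range_succ, add_comm]; rfl

theorem encode_lt {b : ℕ} {f : ℕ → ℕ} {m : ℕ} (h : ∀ k < m, f k < b) : encode b f m < b ^ m := by
  induction m with
  | zero => simp [encode]
  | succ m ih =>
    rw [encode_succ]
    exact digit_lt (h m (by omega)) (ih fun k hk => h k (by omega))

theorem pairing_encode (H K : ℝ) {E G : ℕ} {f g : ℕ → ℕ} {m : ℕ} (hf : ∀ k < m, f k < E)
    (hg : ∀ k < m, g k < G) : pairing H K E G m (encode G g m) (encode E f m) =
      ∑ k ∈ range m, cellPos H (f k) * dirPos K (g k) := by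
  induction m with
  | zero => simp [pairing]
  | succ m ih =>
    rw [encode_succ, encode_succ, pairing_succ H K _ _ (encode_lt fun k hk => hf k (by omega))
      (encode_lt fun k hk => hg k (by omega)), sum_range_succ,
      ih (fun k hk => hf k (by omega)) fun k hk => hg k (by omega)]

theorem abs_cellPos_le {H i : ℕ} (hH : 0 < H) (hi : i < 2 * H + 1) : |cellPos H i| ≤ 1 := by
  have h : (0 : ℝ) < H := by exact_mod_cast hH
  have hi' : (i : ℝ) ≤ 2 * H := by exact_mod_cast Nat.lt_succ_iff.1 hi
  rw [cellPos, abs_le]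
  constructor
  · have : (0 : ℝ) ≤ i / H := by positivity
    linarith
  · have : (i : ℝ) / H ≤ 2 := by rw [div_le_iff₀ h]; exact hi'
    linarith

theorem abs_dirPos_le {K j : ℕ} (hK : 0 < K) (hj : j < 4 * K + 1) : |dirPos K j| ≤ 2 := by
  have h : (0 : ℝ) < K := by exact_mod_cast hK
  have hj' : (j : ℝ) ≤ 4 * K := by exact_mod_cast Nat.lt_succ_iff.1 hj
  rw [dirPos, abs_le]
  constructor
  · have : (0 : ℝ) ≤ j / K := by positivity
    linarith
  · have : (j : ℝ) / K ≤ 4 := by rw [div_le_iff₀ h]; exact hj'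
    linarith

theorem abs_pairing_le {H K : ℕ} (hH : 0 < H) (hK : 0 < K) {m : ℕ} : ∀ {jj lo : ℕ},
    jj < (4 * K + 1) ^ m → lo < (2 * H + 1) ^ m →
    |pairing H K (2 * H + 1) (4 * K + 1) m jj lo| ≤ 2 * m := by
  induction m with
  | zero => simp [pairing]
  | succ m ih =>
    intro jj₀ lo₀ hjj₀ hlo₀
    obtain ⟨j, hj, jj, hjj, rfl⟩ := exists_digit hjj₀
    obtain ⟨i, hi, lo, hlo, rfl⟩ := exists_digit hlo₀
    rw [pairing_succ _ _ i j hlo hjj]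
    have h1 := ih hjj hlo
    have h2 : |cellPos H i * dirPos K j| ≤ 1 * 2 := by
      rw [abs_mul]
      exact mul_le_mul (abs_cellPos_le hH hi) (abs_dirPos_le hK hj) (abs_nonneg _) zero_le_one
    have h3 := abs_add_le (pairing H K (2 * H + 1) (4 * K + 1) m jj lo) (cellPos H i * dirPos K j)
    push_cast
    linarith

/-- The cell of a coordinate. -/
noncomputable def cellOf (H : ℕ) (x : ℝ) : ℕ := ⌊(x + 1) * H⌋₊

theorem cellOf_arg_mem {H : ℕ} {x : ℝ} (hx : |x| ≤ 1) :
    0 ≤ (x + 1) * (H : ℝ) ∧ (x + 1) * (H : ℝ) < ((2 * H + 1 : ℕ) : ℝ) := by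
  have := abs_le.1 hx
  have h0 : (0 : ℝ) ≤ H := by positivity
  push_cast
  constructor <;> nlinarith

theorem cellOf_lt {H : ℕ} {x : ℝ} (hx : |x| ≤ 1) : cellOf H x < 2 * H + 1 :=
  (Nat.floor_lt (cellOf_arg_mem hx).1).2 (cellOf_arg_mem hx).2

theorem abs_sub_cellPos_le {H : ℕ} (hH : 0 < H) {x : ℝ} (hx : |x| ≤ 1) :
    |x - cellPos H (cellOf H x)| ≤ 1 / H := by
  have h : (0 : ℝ) < H := by exact_mod_cast hH
  have h1 := Nat.floor_le (cellOf_arg_mem (H := H) hx).1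
  have h2 := Nat.lt_floor_add_one ((x + 1) * (H : ℝ))
  have e : x - cellPos H (cellOf H x) = ((x + 1) * H - (cellOf H x : ℝ)) / H := by
    simp only [cellPos]; field_simp; ring
  rw [e, abs_div, abs_of_pos h]
  gcongr
  rw [abs_le]
  simp only [cellOf]
  constructor <;> linarith

/-! ### Lifted points and the table of cells -/

/-- Skips the coordinate `j`. -/
def skipAxis (j k : ℕ) : ℕ := if k < j then k else k + 1

/-- The height of the `i`-th point over the face of the cube orthogonal to the axis `j`, lowered by
a paraboloid. -/
noncomputable def lifted (D : ℕ) (c : ℕ → ℝ) (σ : ℝ) (j i : ℕ) : ℝ :=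
  σ * c (i * (D + 1) + j) - ∑ k ∈ range D, c (i * (D + 1) + skipAxis j k) ^ 2 / 2

/-- The cell of the `i`-th point in the face orthogonal to the axis `j`. -/
noncomputable def cellCode (D H : ℕ) (c : ℕ → ℝ) (j i : ℕ) : ℕ :=
  encode (2 * H + 1) (fun k => cellOf H (c (i * (D + 1) + skipAxis j k))) D

/-- The table with the highest lifted point of every cell among the first `n'` points. -/
def IsCellTable (D H : ℕ) (c : ℕ → ℝ) (σ : ℝ) (j n' : ℕ) (B : ℝ) (val id : ℕ → ℝ) : Prop :=
  (∀ i < n', lifted D c σ j i ≤ val (cellCode D H c j i)) ∧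
  ∀ t < (2 * H + 1) ^ D, (val t = B ∧ id t = 0) ∨
    ∃ i < n', cellCode D H c j i = t ∧ val t = lifted D c σ j i ∧ id t = i

/-- Empties all cells. -/
def clearTable (B : ℤ) : RProg :=
  RProg.for 14 (.reg 9) <| .seq (.store 4 (.reg 14) (.lit B)) (.store 5 (.reg 14) (.lit 0))

/-- Takes one more coordinate into account for the cell and the height of a point. -/
def cellStep (D : ℕ) : RProg :=
  .seq (.cond (.reg 13) (.reg 10) (.assign 19 (.reg 13)) (.assign 19 (.add (.reg 13) (.lit 1)))) <|
  .seq (.assign 16 (.load 2 (.add (.mul (.reg 12) (.lit (D + 1 : ℕ))) (.reg 19)))) <|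
  .seq (.assign 17 (.sub (.reg 17) (.div (.mul (.reg 16) (.reg 16)) (.lit 2)))) <|
  .seq (.assign 18 (.floor (.mul (.add (.reg 16) (.lit 1)) (.reg 5)))) <|
  .seq (.assign 14 (.add (.reg 14) (.mul (.reg 18) (.reg 15)))) <|
  .assign 15 (.mul (.reg 15) (.reg 7))

/-- Inserts the point `reg 12` into its cell. -/
def insertPoint (D : ℕ) : RProg :=
  .seq (.assign 16 (.load 2 (.add (.mul (.reg 12) (.lit (D + 1 : ℕ))) (.reg 10)))) <|
  .seq (.assign 17 (.mul (.reg 11) (.reg 16))) <|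
  .seq (.assign 14 (.lit 0)) <|
  .seq (.assign 15 (.lit 1)) <|
  .seq (RProg.for 13 (.lit D) (cellStep D)) <|
  .seq (.assign 16 (.load 4 (.reg 14))) <|
  .cond (.reg 16) (.reg 17)
    (.seq (.store 4 (.reg 14) (.reg 17)) (.store 5 (.reg 14) (.reg 12))) .skip

/-- Builds the table of cells. -/
def buildTable (D : ℕ) (B : ℤ) : RProg :=
  .seq (clearTable B) (RProg.for 12 (.reg 3) (insertPoint D))

theorem insertPoint_run {W : ℝ} {s : RState} {Q : ℕ → RState → Prop} {D H n i j : ℕ} {σ B : ℝ}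
    (h5 : s.reg 5 = H) (h7 : s.reg 7 = (2 * H + 1 : ℕ)) (h10 : s.reg 10 = j) (h11 : s.reg 11 = σ)
    (h12 : s.reg 12 = i) (hi : i < n) (hj : j < D + 1)
    (hn : ((n * (D + 1) : ℕ) : ℝ) ≤ W) (hE : ((2 * H + 1 : ℕ) : ℝ) ≤ W)
    (hED : (((2 * H + 1) ^ D : ℕ) : ℝ) ≤ W)
    (hc : ∀ i < n, ∀ k < D + 1, |s.arr 2 (i * (D + 1) + k)| ≤ 1)
    (hT : IsCellTable D H (s.arr 2) σ j i B (s.arr 4) (s.arr 5))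
    (hQ : ∀ t s', Keeps (insertPoint D) s s' → t ≤ 60 * D + 100 →
      IsCellTable D H (s.arr 2) σ j (i + 1) B (s'.arr 4) (s'.arr 5) → Q t s') :
    Run W (insertPoint D) s Q := by
  set c := s.arr 2 with hcdef
  have hskip : ∀ k < D, skipAxis j k < D + 1 := by
    intro k hk; unfold skipAxis; split_ifs <;> omega
  have hidx : ∀ k < D + 1, ((i * (D + 1) + k : ℕ) : ℝ) < W := by
    intro k hk
    refine lt_of_lt_of_le ?_ hn
    have : i * (D + 1) + k < n * (D + 1) := by nlinarith
    exact_mod_cast this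
  suffices Run W (insertPoint D) s fun t s' => t ≤ 60 * D + 100 ∧
      IsCellTable D H c σ j (i + 1) B (s'.arr 4) (s'.arr 5) from
    this.mono fun t s' hk h => hQ t s' hk h.1 h.2
  refine Run.seq <| Run.load (i * (D + 1) + j) (c (i * (D + 1) + j)) ⟨⟨trivial, trivial⟩, trivial⟩
    (by simp [RExpr.val, h10, h12]) (hidx j hj) (by simp [hcdef]) <|
    Run.seq <| Run.assign (σ * c (i * (D + 1) + j)) ⟨trivial, trivial⟩
    (by simp [RExpr.val, h11]) <|
    Run.seq <| Run.assign 0 trivial (by simp [RExpr.val]) <|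
    Run.seq <| Run.assign 1 trivial (by simp [RExpr.val]) <| Run.seq <|
    -- After `m` coordinates the registers hold the height lowered by `m` squares, the code of the
    -- first `m` digits, and the place value of the next digit.
    Run.for (fun m s' =>
      s'.reg 17 = σ * c (i * (D + 1) + j) - ∑ k ∈ range m, c (i * (D + 1) + skipAxis j k) ^ 2 / 2 ∧
      s'.reg 14 = (encode (2 * H + 1) (fun k => cellOf H (c (i * (D + 1) + skipAxis j k))) m : ℕ) ∧
      s'.reg 15 = ((2 * H + 1 : ℕ) : ℝ) ^ m) D 50 rfl
    (fun s' hk => ⟨trivial, by simp [RExpr.val]⟩) ?_ ?_ ?_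
  · simp [encode]
  · rintro m s' hm hk h13 ⟨h17, h14, h15⟩
    have e10 : s'.reg 10 = j := (hk.reg 10 rfl).trans (by simp [h10])
    have e12 : s'.reg 12 = i := (hk.reg 12 rfl).trans (by simp [h12])
    have e5 : s'.reg 5 = H := (hk.reg 5 rfl).trans (by simp [h5])
    have e7 : s'.reg 7 = (2 * H + 1 : ℕ) := (hk.reg 7 rfl).trans (by simp [h7])
    have a2 : s'.arr 2 = c := (hk.arr 2 rfl).trans (by simp [hcdef])
    set x := c (i * (D + 1) + skipAxis j m) with hx
    have hx1 : |x| ≤ 1 := hc i hi _ (hskip m hm)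
    have rest : ∀ (t : ℕ) (s₁ : RState), t ≤ 8 → s₁.reg 19 = skipAxis j m →
        s₁.reg 12 = i → s₁.reg 5 = H → s₁.reg 7 = (2 * H + 1 : ℕ) →
        s₁.reg 17 = s'.reg 17 → s₁.reg 14 = s'.reg 14 → s₁.reg 15 = s'.reg 15 →
        s₁.arr = s'.arr → Run W
        (.seq (.assign 16 (.load 2 (.add (.mul (.reg 12) (.lit (D + 1 : ℕ))) (.reg 19)))) <|
         .seq (.assign 17 (.sub (.reg 17) (.div (.mul (.reg 16) (.reg 16)) (.lit 2)))) <|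
         .seq (.assign 18 (.floor (.mul (.add (.reg 16) (.lit 1)) (.reg 5)))) <|
         .seq (.assign 14 (.add (.reg 14) (.mul (.reg 18) (.reg 15)))) <|
         .assign 15 (.mul (.reg 15) (.reg 7))) s₁ fun t' s'' => t + t' ≤ 50 ∧
          (s''.setReg 13 ((m + 1 : ℕ) : ℝ)).reg 17 =
            σ * c (i * (D + 1) + j) -
              ∑ k ∈ range (m + 1), c (i * (D + 1) + skipAxis j k) ^ 2 / 2 ∧
          (s''.setReg 13 ((m + 1 : ℕ) : ℝ)).reg 14 =
            (encode (2 * H + 1) (fun k => cellOf H (c (i * (D + 1) + skipAxis j k))) (m + 1) : ℕ) ∧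
          (s''.setReg 13 ((m + 1 : ℕ) : ℝ)).reg 15 = ((2 * H + 1 : ℕ) : ℝ) ^ (m + 1) := by
      intro t s₁ ht e19 e12 e5 e7 e17 e14 e15 earr
      refine Run.seq <| Run.load (i * (D + 1) + skipAxis j m) x ⟨⟨trivial, trivial⟩, trivial⟩
        (by simp [RExpr.val, e12, e19]) (hidx _ (hskip m hm)) (by simp [earr, a2, hx]) <|
        Run.seq <| Run.assign (σ * c (i * (D + 1) + j) -
          ∑ k ∈ range (m + 1), c (i * (D + 1) + skipAxis j k) ^ 2 / 2)
        ⟨trivial, ⟨trivial, trivial⟩, trivial, by simp [RExpr.val]⟩ ?_ <|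
        Run.seq <| Run.floor (cellOf H x) ⟨⟨trivial, trivial⟩, trivial⟩ ?_ ?_ ?_ <|
        Run.seq <| Run.assign (encode (2 * H + 1)
          (fun k => cellOf H (c (i * (D + 1) + skipAxis j k))) (m + 1) : ℕ)
        ⟨trivial, trivial, trivial⟩ ?_ <|
        Run.assign (((2 * H + 1 : ℕ) : ℝ) ^ (m + 1)) ⟨trivial, trivial⟩ ?_ ?_
      · simp [RExpr.val, e17, h17, sum_range_succ, ← hx]; ring
      · simpa [RExpr.val, e5] using (cellOf_arg_mem (H := H) hx1).1
      · refine lt_of_lt_of_le ?_ hE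
        simpa [RExpr.val, e5] using (cellOf_arg_mem (H := H) hx1).2
      · simp [RExpr.val, e5, cellOf]
      · rw [encode_succ]
        simp [RExpr.val, e14, h14, e15, h15, ← hx]; ring
      · simp [RExpr.val, e15, h15, e7, pow_succ]
      · refine ⟨by simp [RExpr.cost]; omega, by simp, by simp, by simp⟩
    refine Run.seq <| Run.cond m j trivial trivial (by simp [RExpr.val, h13])
      (by simp [RExpr.val, e10]) (fun h => ?_) fun h => ?_
    · have h : m < j := by exact_mod_cast h
      refine Run.assign (skipAxis j m : ℕ) trivial (by simp [RExpr.val, h13, skipAxis, h]) ?_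
      exact rest _ _ (by simp [RExpr.cost]) (by simp) (by simp [e12]) (by simp [e5])
        (by simp [e7]) (by simp) (by simp) (by simp) (by simp)
    · have h : ¬ m < j := by rw [not_lt]; exact_mod_cast h
      refine Run.assign (skipAxis j m : ℕ) ⟨trivial, trivial⟩
        (by simp [RExpr.val, h13, skipAxis, h]) ?_
      exact rest _ _ (by simp [RExpr.cost]) (by simp) (by simp [e12]) (by simp [e5])
        (by simp [e7]) (by simp) (by simp) (by simp) (by simp)
  · rintro t s' hk ⟨h17, h14, h15⟩ ht
    have a4 : s'.arr 4 = s.arr 4 := (hk.arr 4 rfl).trans rfl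
    have a5 : s'.arr 5 = s.arr 5 := (hk.arr 5 rfl).trans rfl
    have e12 : s'.reg 12 = i := (hk.reg 12 rfl).trans (by simp [h12])
    have hcode : cellCode D H c j i < (2 * H + 1) ^ D :=
      encode_lt fun k hk => cellOf_lt (hc i hi _ (hskip k hk))
    have hcW : (cellCode D H c j i : ℝ) < W := lt_of_lt_of_le (by exact_mod_cast hcode) hED
    change s'.reg 17 = lifted D c σ j i at h17
    change s'.reg 14 = (cellCode D H c j i : ℕ) at h14
    simp only [RExpr.cost] at ht
    refine Run.seq <| Run.load (cellCode D H c j i) (s.arr 4 (cellCode D H c j i)) trivial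
      (by simp [RExpr.val, h14]) hcW (by rw [a4]) <|
      Run.cond (s.arr 4 (cellCode D H c j i)) (lifted D c σ j i) trivial trivial
      (by simp [RExpr.val]) (by simp [RExpr.val, h17]) (fun hlt => ?_) fun hge => ?_
    · refine Run.seq <| Run.store (cellCode D H c j i) (lifted D c σ j i) trivial trivial
        (by simp [RExpr.val, h14]) hcW (by simp [RExpr.val, h17]) <|
        Run.store (cellCode D H c j i) i trivial trivial (by simp [RExpr.val, h14]) hcW
        (by simp [RExpr.val, e12]) ?_
      refine ⟨by simp [RExpr.cost]; omega, fun i' hi' => ?_, fun t' ht' => ?_⟩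
      · rcases Nat.lt_succ_iff_lt_or_eq.1 hi' with h | rfl
        · by_cases he : cellCode D H c j i' = cellCode D H c j i
          · simp only [he, setArr_arr_apply]
            have := hT.1 i' h
            rw [he] at this
            simpa using this.trans hlt.le
          · simpa [he, a4] using hT.1 i' h
        · simp
      · by_cases he : t' = cellCode D H c j i
        · exact Or.inr ⟨i, by omega, he.symm, by simp [he], by simp [he]⟩
        · rcases hT.2 t' ht' with h | ⟨i', hi', h1, h2, h3⟩
          · exact Or.inl (by simpa [he, a4, a5] using h)
          · exact Or.inr ⟨i', by omega, h1, by simpa [he, a4] using h2,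
              by simpa [he, a5] using h3⟩
    · refine Run.skip ⟨by simp [RExpr.cost]; omega, fun i' hi' => ?_, fun t' ht' => ?_⟩
      · rcases Nat.lt_succ_iff_lt_or_eq.1 hi' with h | rfl
        · simpa [a4] using hT.1 i' h
        · simpa [a4] using hge
      · rcases hT.2 t' ht' with h | ⟨i', hi', h1, h2, h3⟩
        · exact Or.inl (by simpa [a4, a5] using h)
        · exact Or.inr ⟨i', by omega, h1, by simpa [a4] using h2, by simpa [a5] using h3⟩

theorem buildTable_run {W : ℝ} {s : RState} {Q : ℕ → RState → Prop} {D H n j : ℕ} {σ : ℝ} {B : ℤ}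
    (h3 : s.reg 3 = n) (h5 : s.reg 5 = H) (h7 : s.reg 7 = (2 * H + 1 : ℕ))
    (h9 : s.reg 9 = ((2 * H + 1) ^ D : ℕ)) (h10 : s.reg 10 = j)
    (h11 : s.reg 11 = σ) (hj : j < D + 1)
    (hn : ((n * (D + 1) : ℕ) : ℝ) ≤ W) (hE : ((2 * H + 1 : ℕ) : ℝ) ≤ W)
    (hED : (((2 * H + 1) ^ D : ℕ) : ℝ) ≤ W)
    (hc : ∀ i < n, ∀ k < D + 1, |s.arr 2 (i * (D + 1) + k)| ≤ 1)
    (hQ : ∀ t s', Keeps (buildTable D B) s s' →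
      t ≤ n * (60 * D + 110) + 50 * (2 * H + 1) ^ D + 20 →
      IsCellTable D H (s.arr 2) σ j n B (s'.arr 4) (s'.arr 5) → Q t s') :
    Run W (buildTable D B) s Q := by
  refine Run.seq <| Run.for (fun i s' => ∀ t < i, s'.arr 4 t = B ∧ s'.arr 5 t = 0)
    ((2 * H + 1) ^ D) 20 rfl (fun s' hk => ⟨trivial, (hk.reg 9 rfl).trans h9⟩) (by simp) ?_ ?_
  · intro i s' hi hk h14 hI
    have hiW : (i : ℝ) < W := lt_of_lt_of_le (by exact_mod_cast hi) hED
    refine Run.seq <| Run.store i B trivial trivial (by simp [RExpr.val, h14]) hiW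
      (by simp [RExpr.val]) <|
      Run.store i 0 trivial trivial (by simp [RExpr.val, h14]) hiW
      (by simp [RExpr.val]) ⟨by simp [RExpr.cost], fun x hx => ?_⟩
    rcases Nat.lt_succ_iff_lt_or_eq.1 hx with h | rfl
    · simpa [h.ne] using hI x h
    · simp
  · intro t₁ s₁ hk₁ hclear ht₁
    have a2 : s₁.arr 2 = s.arr 2 := hk₁.arr 2 rfl
    refine Run.for (fun i s' => IsCellTable D H (s.arr 2) σ j i B (s'.arr 4) (s'.arr 5))
      n (60 * D + 100) rfl
      (fun s' hk => ⟨trivial, (hk.reg 3 rfl).trans ((hk₁.reg 3 rfl).trans h3)⟩) ?_ ?_ ?_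
    · exact ⟨by simp, fun t ht => Or.inl (by simpa using hclear t ht)⟩
    · intro i s' hi hk h12 hI
      have e2 : s'.arr 2 = s.arr 2 := (hk.arr 2 rfl).trans a2
      refine insertPoint_run (B := B) (n := n) ((hk.reg 5 rfl).trans ((hk₁.reg 5 rfl).trans h5))
        ((hk.reg 7 rfl).trans ((hk₁.reg 7 rfl).trans h7))
        ((hk.reg 10 rfl).trans ((hk₁.reg 10 rfl).trans h10))
        ((hk.reg 11 rfl).trans ((hk₁.reg 11 rfl).trans h11)) h12 hi hj hn hE hED
        (by rwa [e2]) (by rwa [e2]) fun t s'' hk' ht h => ⟨ht, ?_⟩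
      rw [e2] at h
      exact h
    · intro t₂ s₂ hk₂ hI ht₂
      simp only [RExpr.cost] at ht₁ ht₂
      refine hQ _ s₂ ⟨fun r hr => ?_, fun a ha => ?_⟩ ?_ hI
      · simp only [buildTable, RProg.setsReg, Bool.or_eq_false_iff] at hr
        exact (hk₂.reg r hr.2).trans (hk₁.reg r hr.1)
      · simp only [buildTable, RProg.setsArr, Bool.or_eq_false_iff] at ha
        exact (hk₂.arr a ha.2).trans (hk₁.arr a ha.1)
      · have : n * (60 * D + 100 + 1 + 6) ≤ n * (60 * D + 110) := Nat.mul_le_mul_left _ (by omega)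
        omega

/-! ### Collecting the output -/

/-- The list `L` of indices less than `n` without repetition is stored in the array `1`, its length
in register `0`, and its members are marked in the array `9`. -/
structure Stored (n : ℕ) (L : List ℕ) (s : RState) : Prop where
  nodup : L.Nodup
  lt : ∀ x ∈ L, x < n
  len : s.reg 0 = L.length
  out : ∀ x < L.length, s.arr 1 x = (L.getD x 0 : ℕ)
  mark : ∀ i < n, s.arr 9 i = if i ∈ L then 1 else 0

theorem length_le_of_nodup {n : ℕ} {L : List ℕ} (h : L.Nodup) (hlt : ∀ x ∈ L, x < n) :
    L.length ≤ n := by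
  rw [← List.toFinset_card_of_nodup h, ← card_range n]
  refine card_le_card fun x hx => ?_
  rw [List.mem_toFinset] at hx
  exact mem_range.2 (hlt x hx)

/-- Appends the unmarked indices in the table to the output. -/
def collect : RProg :=
  RProg.for 14 (.mul (.reg 20) (.reg 7)) <|
    .seq (.assign 18 (.load 5 (.reg 14))) <|
    .seq (.assign 16 (.load 9 (.reg 18))) <|
    .cond (.reg 16) (.lit 1)
      (.seq (.store 9 (.reg 18) (.lit 1)) <| .seq (.store 1 (.reg 0) (.reg 18)) <|
        .assign 0 (.add (.reg 0) (.lit 1)))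
      .skip

theorem collect_run {W : ℝ} {s : RState} {Q : ℕ → RState → Prop} {n N : ℕ} {L : List ℕ}
    (hN : s.reg 20 * s.reg 7 = N) (hNW : (N : ℝ) ≤ W) (hnW : (n : ℝ) ≤ W)
    (hid : ∀ t < N, ∃ i < n, s.arr 5 t = (i : ℝ)) (hL : Stored n L s)
    (hQ : ∀ t s' L', Keeps collect s s' → t ≤ 50 * N + 10 → Stored n L' s' → L ⊆ L' →
      L'.length ≤ L.length + N → (∀ t < N, ∀ i : ℕ, s.arr 5 t = i → i ∈ L') → Q t s') :
    Run W collect s Q := by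
  refine Run.for (fun m s' => ∃ L', Stored n L' s' ∧ L ⊆ L' ∧ L'.length ≤ L.length + m ∧
    ∀ t < m, ∀ i : ℕ, s.arr 5 t = i → i ∈ L') N 30 rfl
    (fun s' hk => ⟨⟨trivial, trivial⟩, ?_⟩) ?_ ?_ ?_
  · simp [RExpr.val, hk.reg 20 rfl, hk.reg 7 rfl, hN]
  · refine ⟨L, ⟨hL.nodup, hL.lt, by simp [hL.len], by simpa using hL.out,
      by simpa using hL.mark⟩, by simp, by simp, by simp⟩
  · rintro t s' ht hk h14 ⟨L', hS, hsub, hlen, hmem⟩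
    obtain ⟨i, hi, hti⟩ := hid t ht
    have a5 : s'.arr 5 = s.arr 5 := hk.arr 5 rfl
    have hiW : (i : ℝ) < W := lt_of_lt_of_le (by exact_mod_cast hi) hnW
    refine Run.seq <| Run.load t i trivial (by simp [RExpr.val, h14])
      (lt_of_lt_of_le (by exact_mod_cast ht) hNW) (by rw [a5, hti]) <|
      Run.seq <| Run.load i (if i ∈ L' then 1 else 0) trivial (by simp [RExpr.val]) hiW
      (by simpa using hS.mark i hi) <|
      Run.cond (if i ∈ L' then 1 else 0) 1 trivial trivial (by simp [RExpr.val])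
      (by simp [RExpr.val]) (fun h => ?_) fun h => ?_
    · have hiL : i ∉ L' := by
        intro hm
        simp [hm] at h
      have hnd : (L' ++ [i]).Nodup := by
        rw [List.nodup_append]
        refine ⟨hS.nodup, by simp, ?_⟩
        rintro a ha b hb rfl
        simp only [List.mem_singleton] at hb
        exact hiL (hb ▸ ha)
      have hlt : ∀ x ∈ L' ++ [i], x < n := by
        intro x hx
        rcases List.mem_append.1 hx with hx | hx
        · exact hS.lt x hx
        · rw [List.mem_singleton.1 hx]; exact hi
      -- Marking keeps the list free of repetitions, so the output position is below `n` and within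
      -- capacity even if the table is larger than the input.
      have hln := length_le_of_nodup hnd hlt
      simp only [List.length_append, List.length_singleton] at hln
      refine Run.seq <| Run.store i 1 trivial trivial (by simp [RExpr.val]) hiW
        (by simp [RExpr.val]) <|
        Run.seq <| Run.store L'.length i trivial trivial (by simp [RExpr.val, hS.len])
        (lt_of_lt_of_le (by exact_mod_cast hln) hnW) (by simp [RExpr.val]) <|
        Run.assign ((L'.length + 1 : ℕ) : ℝ) ⟨trivial, trivial⟩ (by simp [RExpr.val, hS.len]) ?_
      refine ⟨by simp [RExpr.cost], L' ++ [i], ⟨hnd, hlt, by simp, fun x hx => ?_,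
        fun y hy => ?_⟩, fun x hx => List.mem_append_left _ (hsub hx), by simp; omega,
        fun t' ht' i' hi' => ?_⟩
      · simp only [List.length_append, List.length_singleton] at hx
        rcases Nat.lt_succ_iff_lt_or_eq.1 hx with h | rfl
        · simp [h.ne, List.getElem?_append_left h, hS.out x h]
        · simp
      · by_cases he : y = i
        · simp [he]
        · simp [he, hS.mark y hy]
      · rcases Nat.lt_succ_iff_lt_or_eq.1 ht' with h | rfl
        · exact List.mem_append_left _ (hmem t' h i' hi')
        · have : i' = i := by
            rw [hti] at hi'; exact_mod_cast hi'.symm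
          simp [this]
    · have hiL : i ∈ L' := by
        by_contra hm
        simp [hm] at h
        linarith
      refine Run.skip ⟨by simp [RExpr.cost], L', ⟨hS.nodup, hS.lt, by simp [hS.len],
        by simpa using hS.out, by simpa using hS.mark⟩, hsub, by omega, fun t' ht' i' hi' => ?_⟩
      rcases Nat.lt_succ_iff_lt_or_eq.1 ht' with h | rfl
      · exact hmem t' h i' hi'
      · have : i' = i := by
          rw [hti] at hi'; exact_mod_cast hi'.symm
        rwa [this]
  · rintro t s' hk ⟨L', hS, hsub, hlen, hmem⟩ ht
    simp only [RExpr.cost] at ht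
    exact hQ t s' L' hk (by omega) hS hsub hlen hmem

/-! ### The extreme points of one face -/

/-- Outputs, for every direction of the grid, an almost extreme point, seen from the face of the
cube that is given by the axis `reg 10` and the sign `reg 11`. -/
def faceProg (D : ℕ) : RProg :=
  .seq (buildTable D (-(5 * D + 2 : ℕ))) <| .seq (tableTransform D) collect

/-- The height of the `i`-th point in the direction `v` of the grid. -/
noncomputable def gain (D K : ℕ) (c : ℕ → ℝ) (σ : ℝ) (j : ℕ) (v : ℕ → ℕ) (i : ℕ) : ℝ :=
  lifted D c σ j i + ∑ k ∈ range D, c (i * (D + 1) + skipAxis j k) * dirPos K (v k)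

/-- The registers with the parameters of the grid. -/
structure GridEnv (D n H K : ℕ) (s : RState) : Prop where
  r3 : s.reg 3 = n
  r5 : s.reg 5 = H
  r6 : s.reg 6 = K
  r7 : s.reg 7 = (2 * H + 1 : ℕ)
  r8 : s.reg 8 = (4 * K + 1 : ℕ)
  r9 : s.reg 9 = ((2 * H + 1) ^ D : ℕ)

theorem GridEnv.of_keeps {D n H K : ℕ} {s s' : RState} (h : GridEnv D n H K s)
    (hr : ∀ r, 3 ≤ r → r ≤ 9 → s'.reg r = s.reg r) : GridEnv D n H K s' :=
  ⟨(hr 3 (by simp) (by simp)).trans h.r3, (hr 5 (by simp) (by simp)).trans h.r5,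
    (hr 6 (by simp) (by simp)).trans h.r6, (hr 7 (by simp) (by simp)).trans h.r7,
    (hr 8 (by simp) (by simp)).trans h.r8, (hr 9 (by simp) (by simp)).trans h.r9⟩

theorem skipAxis_lt {D j k : ℕ} (hk : k < D) : skipAxis j k < D + 1 := by
  unfold skipAxis; split_ifs <;> omega

/-- Rounding moves each coordinate by at most `1 / H`, and directions have coordinates at most `2`.
The paraboloid term is not rounded and contributes no error. -/
theorem abs_pairing_sub_le {D H K j i : ℕ} {c : ℕ → ℝ} {v : ℕ → ℕ} (hH : 0 < H) (hK : 0 < K)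
    (hc : ∀ k < D + 1, |c (i * (D + 1) + k)| ≤ 1) (hv : ∀ k < D, v k < 4 * K + 1) :
    |pairing H K (2 * H + 1) (4 * K + 1) D (encode (4 * K + 1) v D) (cellCode D H c j i) -
      ∑ k ∈ range D, c (i * (D + 1) + skipAxis j k) * dirPos K (v k)| ≤ D * (2 / H) := by
  rw [cellCode, pairing_encode _ _ (fun k hk => cellOf_lt (hc _ (skipAxis_lt hk))) hv,
    ← sum_sub_distrib]
  refine (abs_sum_le_sum_abs _ _).trans ?_
  calc _ ≤ ∑ k ∈ range D, (2 / H : ℝ) := by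
        refine sum_le_sum fun k hk => ?_
        have hk := mem_range.1 hk
        rw [← sub_mul, abs_mul, abs_sub_comm]
        calc _ ≤ 1 / (H : ℝ) * 2 := mul_le_mul (abs_sub_cellPos_le hH (hc _ (skipAxis_lt hk)))
              (abs_dirPos_le hK (hv k hk)) (abs_nonneg _) (by positivity)
          _ = 2 / H := by ring
    _ = D * (2 / H) := by simp

theorem neg_le_lifted {D j i : ℕ} {c : ℕ → ℝ} {σ : ℝ} (hσ : |σ| ≤ 1) (hj : j < D + 1)
    (hc : ∀ k < D + 1, |c (i * (D + 1) + k)| ≤ 1) : -(1 + D : ℝ) ≤ lifted D c σ j i := by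
  have h1 : |σ * c (i * (D + 1) + j)| ≤ 1 * 1 := by
    rw [abs_mul]; exact mul_le_mul hσ (hc j hj) (abs_nonneg _) zero_le_one
  have h2 : ∑ k ∈ range D, c (i * (D + 1) + skipAxis j k) ^ 2 / 2 ≤ ∑ k ∈ range D, (1 : ℝ) := by
    refine sum_le_sum fun k hk => ?_
    have := hc _ (skipAxis_lt (j := j) (mem_range.1 hk))
    rw [← sq_le_one_iff_abs_le_one] at this
    linarith
  rw [sum_const, card_range, nsmul_eq_mul, mul_one] at h2
  have := (abs_le.1 h1).1
  rw [lifted]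
  linarith

/-- The winner of the transformed table maximizes the gain with rounded linear term. Undoing the
rounding once for the competitor and once for the winner costs `D (2 / H)` each, which explains `D
(4 / H)`. -/
theorem faceProg_run {W : ℝ} {s : RState} {Q : ℕ → RState → Prop} {D n H K U j : ℕ} {σ : ℝ}
    {L : List ℕ} (hs : GridEnv D n H K s) (h10 : s.reg 10 = j) (h11 : s.reg 11 = σ)
    (hσ : |σ| ≤ 1) (hj : j < D + 1) (hn0 : 0 < n) (hH : 0 < H) (hK : 0 < K)
    (hEU : 2 * H + 1 ≤ U) (hGU : 4 * K + 1 ≤ U)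
    (hW : ((n * (D + 1) + U ^ D + U : ℕ) : ℝ) ≤ W)
    (hc : ∀ i < n, ∀ k < D + 1, |s.arr 2 (i * (D + 1) + k)| ≤ 1) (hL : Stored n L s)
    (hQ : ∀ t s' L', Keeps (faceProg D) s s' → t ≤ 2000 * (D + 1) * (n + U ^ D) →
      Stored n L' s' → L ⊆ L' → L'.length ≤ L.length + (4 * K + 1) ^ D →
      (∀ v : ℕ → ℕ, (∀ k < D, v k < 4 * K + 1) → ∃ q ∈ L', ∀ i < n,
        gain D K (s.arr 2) σ j v i ≤ gain D K (s.arr 2) σ j v q + D * (4 / H)) → Q t s') :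
    Run W (faceProg D) s Q := by
  have hWle : ∀ x ≤ n * (D + 1) + U ^ D + U, (x : ℝ) ≤ W :=
    fun x hx => le_trans (by exact_mod_cast hx) hW
  have hED : (2 * H + 1) ^ D ≤ U ^ D := Nat.pow_le_pow_left hEU D
  have hGD : (4 * K + 1) ^ D ≤ U ^ D := Nat.pow_le_pow_left hGU D
  have hnD : n ≤ n * (D + 1) := Nat.le_mul_of_pos_right n (by omega)
  have hH' : (0 : ℝ) < H := by exact_mod_cast hH
  have hK' : (0 : ℝ) < K := by exact_mod_cast hK
  refine Run.seq <| buildTable_run hs.r3 hs.r5 hs.r7 hs.r9 h10 h11 hj (hWle _ (by omega))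
    (hWle _ (by omega)) (hWle _ (by omega)) hc fun t₁ s₁ hk₁ ht₁ hT => ?_
  refine Run.seq <| tableTransform_run (U := U)
    ⟨(hk₁.reg 5 rfl).trans hs.r5, (hk₁.reg 6 rfl).trans hs.r6,
    (hk₁.reg 7 rfl).trans hs.r7, (hk₁.reg 8 rfl).trans hs.r8⟩
    (by rw [hk₁.reg 9 rfl, hs.r9]; push_cast; rfl) hH' hK' (by omega) hEU hGU
    (hWle _ (by omega)) fun t₂ s₂ hk₂ ht₂ h20 hTr => ?_
  set B : ℝ := ((-(5 * D + 2 : ℕ) : ℤ) : ℝ) with hB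
  have e7 : s₂.reg 7 = (2 * H + 1 : ℕ) := (hk₂.reg 7 rfl).trans ((hk₁.reg 7 rfl).trans hs.r7)
  have hid₁ : ∀ t < (2 * H + 1) ^ D, ∃ i < n, s₁.arr 5 t = (i : ℝ) := by
    intro t ht
    rcases hT.2 t ht with ⟨-, h⟩ | ⟨i, hi, -, -, h⟩
    -- Empty cells carry the dummy index `0`, a valid input index, so reading the mark array is safe
    -- for every table entry.
    · exact ⟨0, hn0, by simpa using h⟩
    · exact ⟨i, hi, h⟩
  have hS₂ : Stored n L s₂ := by
    have e0 : s₂.reg 0 = s.reg 0 := (hk₂.reg 0 rfl).trans (hk₁.reg 0 rfl)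
    have a1 : s₂.arr 1 = s.arr 1 := (hk₂.arr 1 rfl).trans (hk₁.arr 1 rfl)
    have a9 : s₂.arr 9 = s.arr 9 := (hk₂.arr 9 rfl).trans (hk₁.arr 9 rfl)
    exact ⟨hL.nodup, hL.lt, e0.trans hL.len, by rw [a1]; exact hL.out, by rw [a9]; exact hL.mark⟩
  refine collect_run (n := n) (N := (4 * K + 1) ^ D) (L := L)
    (by rw [e7, h20]; push_cast; rfl) (hWle _ (by omega)) (hWle _ (by omega)) ?_ hS₂ ?_
  · intro t ht
    obtain ⟨lo, hlo, -, h⟩ := (hTr t ht 0 (by simp)).2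
    simp only [pow_zero, mul_one, zero_mul, add_zero, zero_add] at h
    rw [h]
    exact hid₁ lo hlo
  · intro t₃ s₃ L' hk₃ ht₃ hS hsub hlen hmem
    refine hQ _ s₃ L' ⟨fun r hr => ?_, fun a ha => ?_⟩ ?_ hS hsub hlen fun v hv => ?_
    · simp only [faceProg, RProg.setsReg, Bool.or_eq_false_iff] at hr
      exact (hk₃.reg r hr.2.2).trans ((hk₂.reg r hr.2.1).trans (hk₁.reg r hr.1))
    · simp only [faceProg, RProg.setsArr, Bool.or_eq_false_iff] at ha
      exact (hk₃.arr a ha.2.2).trans ((hk₂.arr a ha.2.1).trans (hk₁.arr a ha.1))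
    · have h1 : 1 ≤ n := hn0
      have h2 : 1 ≤ U ^ D := Nat.one_le_pow _ _ (by omega)
      nlinarith [Nat.zero_le (D * n), Nat.zero_le (D * U ^ D), Nat.mul_le_mul_left D h1,
        Nat.mul_le_mul_left D h2]
    · have hjj := encode_lt hv
      obtain ⟨lo, hlo, hval, hid⟩ := (hTr _ hjj 0 (by simp)).2
      have hmax := (hTr _ hjj 0 (by simp)).1
      simp only [pow_zero, mul_one, zero_mul, add_zero, zero_add] at hval hid hmax
      have hcode : ∀ i < n, cellCode D H (s.arr 2) j i < (2 * H + 1) ^ D := fun i hi =>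
        encode_lt fun k hk => cellOf_lt (hc i hi _ (skipAxis_lt hk))
      have hge : ∀ i < n, lifted D (s.arr 2) σ j i +
          pairing H K (2 * H + 1) (4 * K + 1) D (encode (4 * K + 1) v D)
            (cellCode D H (s.arr 2) j i) ≤ s₁.arr 4 lo +
          pairing H K (2 * H + 1) (4 * K + 1) D (encode (4 * K + 1) v D) lo := by
        intro i hi
        rw [← hval]
        have := hmax _ (hcode i hi)
        have := hT.1 i hi
        linarith
      -- An empty cell cannot win: its total is at most `-(5 D + 2) + 2 D = -(3 D + 2)`, whereas any
      -- input point reaches at least `-(D + 1) - 2 D = -(3 D + 1)`.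
      rcases hT.2 lo hlo with ⟨hBv, -⟩ | ⟨q, hq, hqc, hqv, hqi⟩
      · exfalso
        have h1 := hge 0 hn0
        have h2 := (abs_le.1 (abs_pairing_le hH hK hjj (hcode 0 hn0))).1
        have h3 := (abs_le.1 (abs_pairing_le hH hK hjj hlo)).2
        have h4 := neg_le_lifted hσ hj (hc 0 hn0)
        have h5 : B = -(5 * D + 2) := by rw [hB]; push_cast; ring
        rw [hBv, h5] at h1
        have h6 : (0 : ℝ) ≤ D := by positivity
        linarith
      · refine ⟨q, hmem _ hjj q (by rw [hid, hqi]), fun i hi => ?_⟩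
        have h1 := hge i hi
        rw [← hqc, hqc, hqv, ← hqc] at h1
        have h2 := (abs_le.1 (abs_pairing_sub_le (j := j) hH hK (hc i hi) hv)).1
        have h3 := (abs_le.1 (abs_pairing_sub_le (j := j) hH hK (hc q hq) hv)).2
        have h4 : (D : ℝ) * (4 / H) = D * (2 / H) + D * (2 / H) := by ring
        rw [gain, gain, h4]
        linarith

/-! ### Normalization of the points -/

/-- The entries `r` of an in-place elimination of the rows `a i` after `j` columns, with pivot rows
`b`. -/
structure Eliminated (n d : ℕ) (a : ℕ → ℕ → ℝ) (j : ℕ) (b : ℕ → ℕ → ℝ) (r : ℕ → ℝ) : Prop where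
  eq : ∀ i < n, ∀ k < d, a i k = ∑ l ∈ range j, r (i * d + l) * b l k +
    if j ≤ k then r (i * d + k) else 0
  abs_le : ∀ i < n, ∀ l < j, |r (i * d + l)| ≤ 1
  pivot : ∀ (u : ℕ → ℝ) (M : ℝ), (∀ i < n, |∑ k ∈ range d, u k * a i k| ≤ M) →
    ∀ l < j, |∑ k ∈ range d, u k * b l k| ≤ 2 ^ l * M

theorem Eliminated.zero {n d : ℕ} {a : ℕ → ℕ → ℝ} {r : ℕ → ℝ}
    (h : ∀ i < n, ∀ k < d, r (i * d + k) = a i k) : Eliminated n d a 0 (fun _ _ => 0) r :=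
  ⟨fun i hi k hk => by simp [h i hi k hk], by simp, by simp⟩

/-- The next pivot row. -/
noncomputable def pivotRow (d : ℕ) (r : ℕ → ℝ) (j q k : ℕ) : ℝ := if j ≤ k then r (q * d + k) else 0

/-- The largest entry of the column as pivot keeps the new coefficients in `[-1, 1]`. The new pivot
row is an input row minus earlier pivot rows with such coefficients, so a functional bounded by `M`
on the input is bounded on it by `M + ∑_{m < l} 2 ^ m M = 2 ^ l M`. If the column vanishes, any
nonzero divisor `δ` will do. -/
theorem Eliminated.step {n d : ℕ} {a : ℕ → ℕ → ℝ} {j : ℕ} {b : ℕ → ℕ → ℝ} {r r' : ℕ → ℝ}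
    (h : Eliminated n d a j b r) {q : ℕ} (hq : q < n) (hj : j < d) {δ : ℝ}
    (hmax : ∀ i < n, |r (i * d + j)| ≤ |r (q * d + j)|)
    (hδ : r (q * d + j) = 0 ∨ δ = r (q * d + j)) (hδ0 : δ ≠ 0)
    (hlt : ∀ i < n, ∀ k < j, r' (i * d + k) = r (i * d + k))
    (heq : ∀ i < n, r' (i * d + j) = r (i * d + j) / δ)
    (hgt : ∀ i < n, ∀ k < d, j < k →
      r' (i * d + k) = r (i * d + k) - r (i * d + j) / δ * r (q * d + k)) :
    Eliminated n d a (j + 1) (Function.update b j (pivotRow d r j q)) r' := by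
  have hb : ∀ l < j, Function.update b j (pivotRow d r j q) l = b l := fun l hl =>
    Function.update_of_ne hl.ne _ _
  have hzero : r (q * d + j) = 0 → ∀ i < n, r (i * d + j) = 0 := by
    intro h0 i hi
    have := hmax i hi
    rw [h0, abs_zero] at this
    exact abs_eq_zero.1 (le_antisymm this (abs_nonneg _))
  refine ⟨fun i hi k hk => ?_, fun i hi l hl => ?_, fun u M hM l hl => ?_⟩
  · rw [h.eq i hi k hk, sum_range_succ, Function.update_self, heq i hi]
    have : ∑ l ∈ range j, r' (i * d + l) * Function.update b j (pivotRow d r j q) l k =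
        ∑ l ∈ range j, r (i * d + l) * b l k := by
      refine sum_congr rfl fun l hl => ?_
      rw [hb l (mem_range.1 hl), hlt i hi l (mem_range.1 hl)]
    rw [this, add_assoc]
    congr 1
    rcases lt_trichotomy k j with hkj | rfl | hkj
    · simp [pivotRow, not_le.2 hkj, not_le.2 (hkj.trans (Nat.lt_succ_self j))]
    · simp only [pivotRow, le_refl, if_true, Nat.not_succ_le_self, if_false, add_zero]
      rcases hδ with h0 | rfl
      · rw [h0, hzero h0 i hi]; simp
      · field_simp
    · have h1 : j ≤ k := hkj.le
      have h2 : j + 1 ≤ k := hkj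
      simp only [pivotRow, h1, h2, if_true, hgt i hi k hk hkj]
      ring
  · rcases Nat.lt_succ_iff_lt_or_eq.1 hl with hl | rfl
    · rw [hlt i hi l hl]; exact h.abs_le i hi l hl
    · rw [heq i hi, abs_div]
      rcases hδ with h0 | rfl
      · rw [hzero h0 i hi]; simp
      · exact div_le_one_of_le₀ (hmax i hi) (abs_nonneg _)
  · rcases Nat.lt_succ_iff_lt_or_eq.1 hl with hl | rfl
    · rw [hb l hl]; exact h.pivot u M hM l hl
    · rw [Function.update_self]
      -- The row identity `h.eq`, applied to the pivot row's own index and solved for its residual.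
      have e : ∑ k ∈ range d, u k * pivotRow d r l q k = ∑ k ∈ range d, u k * a q k -
          ∑ m ∈ range l, r (q * d + m) * ∑ k ∈ range d, u k * b m k := by
        simp only [mul_sum]
        rw [sum_comm, ← sum_sub_distrib]
        refine sum_congr rfl fun k hk => ?_
        have : ∑ m ∈ range l, u k * (r (q * d + m) * b m k) =
            ∑ m ∈ range l, r (q * d + m) * (u k * b m k) := sum_congr rfl fun m _ => by ring
        rw [h.eq q hq k (mem_range.1 hk), mul_add, mul_sum, pivotRow, this]
        ring
      rw [e]
      have h1 : |∑ m ∈ range l, r (q * d + m) * ∑ k ∈ range d, u k * b m k| ≤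
          ∑ m ∈ range l, 2 ^ m * M := by
        refine (abs_sum_le_sum_abs _ _).trans (sum_le_sum fun m hm => ?_)
        rw [abs_mul]
        have h2 := h.pivot u M hM m (mem_range.1 hm)
        calc _ ≤ 1 * (2 ^ m * M) := mul_le_mul (h.abs_le q hq m (mem_range.1 hm)) h2
              (abs_nonneg _) zero_le_one
          _ = _ := one_mul _
      rw [← sum_mul, geom_sum_eq (by norm_num)] at h1
      have h2 := abs_sub (∑ k ∈ range d, u k * a q k)
        (∑ m ∈ range l, r (q * d + m) * ∑ k ∈ range d, u k * b m k)
      have h3 := hM q hq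
      norm_num at h1
      linarith

/-! ### Elimination in a flat array -/

theorem flat_lt {n d i k : ℕ} (hi : i < n) (hk : k < d) : i * d + k < n * d :=
  calc i * d + k < (i + 1) * d := by rw [add_mul, one_mul]; omega
    _ ≤ n * d := Nat.mul_le_mul_right _ hi

theorem flat_inj {d i k i' k' : ℕ} (hk : k < d) (hk' : k' < d) :
    i * d + k = i' * d + k' ↔ i = i' ∧ k = k' := by
  constructor
  · intro h
    have h1 := congrArg (· % d) h
    simp only [Nat.mul_add_mod', Nat.mod_eq_of_lt hk, Nat.mod_eq_of_lt hk'] at h1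
    have h2 : i * d = i' * d := by omega
    exact ⟨Nat.eq_of_mul_eq_mul_right (by omega) h2, h1⟩
  · rintro ⟨rfl, rfl⟩; rfl

/-- Subtracts the first point from all points. -/
def translate (d : ℕ) : RProg :=
  RProg.for 12 (.reg 3) <| RProg.for 13 (.lit d) <|
    .seq (.assign 16 (.load 0 (.add (.mul (.reg 12) (.lit d)) (.reg 13)))) <|
    .seq (.assign 17 (.load 0 (.reg 13))) <|
    .store 2 (.add (.mul (.reg 12) (.lit d)) (.reg 13)) (.sub (.reg 16) (.reg 17))

/-- Finds the row `reg 18` with the entry of largest absolute value, `reg 17`, in column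
`reg 10`. -/
def findPivot (d : ℕ) : RProg :=
  .seq (.assign 17 (.lit 0)) <| .seq (.assign 18 (.lit 0)) <|
  RProg.for 12 (.reg 3) <|
    .seq (.assign 16 (.load 2 (.add (.mul (.reg 12) (.lit d)) (.reg 10)))) <|
    .seq (.cond (.reg 16) (.lit 0) (.assign 16 (.sub (.lit 0) (.reg 16))) .skip) <|
    .cond (.reg 17) (.reg 16) (.seq (.assign 17 (.reg 16)) (.assign 18 (.reg 12))) .skip

/-- Copies row `reg 18` to the array `3`. -/
def copyRow (d : ℕ) : RProg :=
  RProg.for 13 (.lit d) <|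
    .seq (.assign 16 (.load 2 (.add (.mul (.reg 18) (.lit d)) (.reg 13)))) <|
    .store 3 (.reg 13) (.reg 16)

/-- Eliminates column `reg 10` of row `reg 12`. -/
def eliminateRow (d : ℕ) : RProg :=
  .seq (.assign 16 (.load 2 (.add (.mul (.reg 12) (.lit d)) (.reg 10)))) <|
  .seq (.assign 16 (.div (.reg 16) (.reg 17))) <|
  .seq (.store 2 (.add (.mul (.reg 12) (.lit d)) (.reg 10)) (.reg 16)) <|
  RProg.for 13 (.lit d) <|
    .cond (.reg 10) (.reg 13)
      (.seq (.assign 27 (.load 3 (.reg 13))) <|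
       .seq (.assign 28 (.load 2 (.add (.mul (.reg 12) (.lit d)) (.reg 13)))) <|
       .store 2 (.add (.mul (.reg 12) (.lit d)) (.reg 13))
         (.sub (.reg 28) (.mul (.reg 16) (.reg 27))))
      .skip

/-- Eliminates column `reg 10`. -/
def eliminateColumn (d : ℕ) : RProg :=
  .seq (findPivot d) <| .seq (copyRow d) <|
  .seq (.cond (.lit 0) (.reg 17) (.assign 17 (.load 3 (.reg 10))) (.assign 17 (.lit 1))) <|
  RProg.for 12 (.reg 3) (eliminateRow d)

/-- Replaces the points by normalized ones. -/
def normalize (d : ℕ) : RProg :=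
  .seq (translate d) (RProg.for 10 (.lit d) (eliminateColumn d))

section

variable {W : ℝ} {s : RState} {Q : ℕ → RState → Prop} {d n : ℕ}

theorem translate_run (h3 : s.reg 3 = n) (hn : 0 < n) (hW : ((n * d : ℕ) : ℝ) ≤ W)
    (hQ : ∀ t s', Keeps (translate d) s s' → t ≤ n * (40 * d + 20) + 10 →
      (∀ i < n, ∀ k < d, s'.arr 2 (i * d + k) = s.arr 0 (i * d + k) - s.arr 0 k) → Q t s') :
    Run W (translate d) s Q := by
  have hidx : ∀ i < n, ∀ k < d, ((i * d + k : ℕ) : ℝ) < W := fun i hi k hk =>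
    lt_of_lt_of_le (by exact_mod_cast flat_lt hi hk) hW
  refine Run.for (fun m s' => ∀ i < m, ∀ k < d,
    s'.arr 2 (i * d + k) = s.arr 0 (i * d + k) - s.arr 0 k) n (40 * d + 10) rfl
    (fun s' hk => ⟨trivial, (hk.reg 3 rfl).trans h3⟩) (by simp) ?_ ?_
  · intro i s' hi hk h12 hI
    refine Run.for (fun m s'' => (∀ i' < i, ∀ k < d,
      s''.arr 2 (i' * d + k) = s.arr 0 (i' * d + k) - s.arr 0 k) ∧ ∀ k < m,
      s''.arr 2 (i * d + k) = s.arr 0 (i * d + k) - s.arr 0 k) d 30 rfl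
      (fun s' hk => ⟨trivial, by simp [RExpr.val]⟩) ⟨by simpa using hI, by simp⟩ ?_ ?_
    · rintro k s'' hkd hk' h13 ⟨hI₁, hI₂⟩
      have e12 : s''.reg 12 = i := (hk'.reg 12 rfl).trans h12
      have a0 : s''.arr 0 = s.arr 0 := (hk'.arr 0 rfl).trans (hk.arr 0 rfl)
      refine Run.seq <| Run.load (i * d + k) (s.arr 0 (i * d + k)) ⟨⟨trivial, trivial⟩, trivial⟩
        (by simp [RExpr.val, e12, h13]) (hidx i hi k hkd) (by rw [a0]) <|
        Run.seq <| Run.load k (s.arr 0 k) trivial (by simp [RExpr.val, h13])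
        (by simpa using hidx 0 hn k hkd) (by simp [a0]) <|
        Run.store (i * d + k) (s.arr 0 (i * d + k) - s.arr 0 k) ⟨⟨trivial, trivial⟩, trivial⟩
        ⟨trivial, trivial⟩ (by simp [RExpr.val, e12, h13]) (hidx i hi k hkd)
        (by simp [RExpr.val]) ⟨by simp [RExpr.cost], fun i' hi' k' hk'd => ?_, fun k' hk'd => ?_⟩
      · simpa [flat_inj hk'd hkd, hi'.ne] using hI₁ i' hi' k' hk'd
      · rcases Nat.lt_succ_iff_lt_or_eq.1 hk'd with h | rfl
        · simpa [h.ne] using hI₂ k' h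
        · simp
    · rintro t s'' hk' ⟨hI₁, hI₂⟩ ht
      simp only [RExpr.cost] at ht
      refine ⟨by omega, fun i' hi' k hkd => ?_⟩
      rcases Nat.lt_succ_iff_lt_or_eq.1 hi' with h | rfl
      · exact hI₁ i' h k hkd
      · exact hI₂ k hkd
  · intro t s' hk hI ht
    simp only [RExpr.cost] at ht
    refine hQ t s' hk ?_ hI
    have : n * (40 * d + 10 + 1 + 6) ≤ n * (40 * d + 20) := Nat.mul_le_mul_left _ (by omega)
    omega

theorem findPivot_run {j : ℕ} (h3 : s.reg 3 = n) (h10 : s.reg 10 = j) (hn : 0 < n) (hj : j < d)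
    (hW : ((n * d : ℕ) : ℝ) ≤ W)
    (hQ : ∀ t s' q, Keeps (findPivot d) s s' → t ≤ 50 * n + 20 → q < n → s'.reg 18 = (q : ℕ) →
      0 ≤ s'.reg 17 → s'.reg 17 ≤ |s.arr 2 (q * d + j)| →
      (∀ i < n, |s.arr 2 (i * d + j)| ≤ s'.reg 17) → Q t s') :
    Run W (findPivot d) s Q := by
  have hidx : ∀ i < n, ((i * d + j : ℕ) : ℝ) < W := fun i hi =>
    lt_of_lt_of_le (by exact_mod_cast flat_lt hi hj) hW
  suffices Run W (findPivot d) s fun t s' => t ≤ 50 * n + 20 ∧ ∃ q : ℕ, q < n ∧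
      s'.reg 18 = (q : ℕ) ∧ 0 ≤ s'.reg 17 ∧ s'.reg 17 ≤ |s.arr 2 (q * d + j)| ∧
      (∀ i < n, |s.arr 2 (i * d + j)| ≤ s'.reg 17) from
    this.mono fun t s' hk ⟨ht, q, h1, h2, h3, h4, h5⟩ => hQ t s' q hk ht h1 h2 h3 h4 h5
  refine Run.seq <| Run.assign 0 trivial (by simp [RExpr.val]) <| Run.seq <|
    Run.assign 0 trivial (by simp [RExpr.val]) ?_
  refine Run.for (fun m s' => ∃ q < n, s'.reg 18 = (q : ℕ) ∧ 0 ≤ s'.reg 17 ∧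
    s'.reg 17 ≤ |s.arr 2 (q * d + j)| ∧ ∀ i < m, |s.arr 2 (i * d + j)| ≤ s'.reg 17) n 40 rfl
    (fun s' hk => ⟨trivial, (hk.reg 3 rfl).trans (by simp [h3])⟩) ⟨0, hn, by simp⟩ ?_ ?_
  · rintro i s' hi hk h12 ⟨q, hq, h18, h17, hle, hmax⟩
    have e10 : s'.reg 10 = j := (hk.reg 10 rfl).trans (by simp [h10])
    have a2 : s'.arr 2 = s.arr 2 := (hk.arr 2 rfl).trans rfl
    set x := s.arr 2 (i * d + j) with hx
    have rest : ∀ (t : ℕ) (s₁ : RState), t ≤ 20 → s₁.reg 16 = |x| → s₁.reg 12 = i →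
        s₁.reg 17 = s'.reg 17 → s₁.reg 18 = s'.reg 18 →
        Run W (.cond (.reg 17) (.reg 16) (.seq (.assign 17 (.reg 16)) (.assign 18 (.reg 12))) .skip)
        s₁ fun t' s'' => t + t' ≤ 40 ∧ ∃ q < n, (s''.setReg 12 ((i + 1 : ℕ) : ℝ)).reg 18 = (q : ℕ) ∧
          0 ≤ (s''.setReg 12 ((i + 1 : ℕ) : ℝ)).reg 17 ∧
          (s''.setReg 12 ((i + 1 : ℕ) : ℝ)).reg 17 ≤ |s.arr 2 (q * d + j)| ∧
          ∀ i' < i + 1, |s.arr 2 (i' * d + j)| ≤ (s''.setReg 12 ((i + 1 : ℕ) : ℝ)).reg 17 := by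
      intro t s₁ ht e16 e12 e17 e18
      refine Run.cond (s'.reg 17) |x| trivial trivial (by simp [RExpr.val, e17])
        (by simp [RExpr.val, e16]) (fun hlt => ?_) fun hge => ?_
      · refine Run.seq <| Run.assign |x| trivial (by simp [RExpr.val, e16]) <|
          Run.assign i trivial (by simp [RExpr.val, e12]) ?_
        refine ⟨by simp [RExpr.cost]; omega, i, hi, by simp, by simp, by simp [hx],
          fun i' hi' => ?_⟩
        rcases Nat.lt_succ_iff_lt_or_eq.1 hi' with h | rfl
        · simpa using (hmax i' h).trans hlt.le
        · simp [hx]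
      · refine Run.skip ⟨by simp [RExpr.cost]; omega, q, hq, by simp [e18, h18], by simp [e17, h17],
          by simpa [e17] using hle, fun i' hi' => ?_⟩
        rcases Nat.lt_succ_iff_lt_or_eq.1 hi' with h | rfl
        · simpa [e17] using hmax i' h
        · simpa [e17] using hge
    refine Run.seq <| Run.load (i * d + j) x ⟨⟨trivial, trivial⟩, trivial⟩
      (by simp [RExpr.val, e10, h12]) (hidx i hi) (by rw [a2]) <|
      Run.seq <| Run.cond x 0 trivial trivial (by simp [RExpr.val]) (by simp [RExpr.val])
      (fun hlt => ?_) fun hge => ?_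
    · refine Run.assign |x| ⟨trivial, trivial⟩ (by simp [RExpr.val, abs_of_neg hlt]) ?_
      exact (rest 20 _ le_rfl (by simp) (by simp [h12]) (by simp) (by simp)).mono
        fun t' s'' _ h => ⟨by have := h.1; simp [RExpr.cost]; omega, h.2⟩
    · refine Run.skip ?_
      exact (rest 20 _ le_rfl (by simp [abs_of_nonneg hge]) (by simp [h12]) (by simp)
        (by simp)).mono fun t' s'' _ h => ⟨by have := h.1; simp [RExpr.cost]; omega, h.2⟩
  · rintro t s' hk h ht
    simp only [RExpr.cost] at ht ⊢
    exact ⟨by omega, h⟩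

theorem copyRow_run {q : ℕ} (h18 : s.reg 18 = q) (hq : q < n) (hW : ((n * d : ℕ) : ℝ) ≤ W)
    (hQ : ∀ t s', Keeps (copyRow d) s s' → t ≤ 30 * d + 10 →
      (∀ k < d, s'.arr 3 k = s.arr 2 (q * d + k)) → Q t s') :
    Run W (copyRow d) s Q := by
  have hidx : ∀ i < n, ∀ k < d, ((i * d + k : ℕ) : ℝ) < W := fun i hi k hk =>
    lt_of_lt_of_le (by exact_mod_cast flat_lt hi hk) hW
  refine Run.for (fun m s' => ∀ k < m, s'.arr 3 k = s.arr 2 (q * d + k)) d 20 rfl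
    (fun s' hk => ⟨trivial, by simp [RExpr.val]⟩) (by simp) ?_ ?_
  · intro k s' hkd hk h13 hI
    have e18 : s'.reg 18 = q := (hk.reg 18 rfl).trans h18
    refine Run.seq <| Run.load (q * d + k) (s.arr 2 (q * d + k)) ⟨⟨trivial, trivial⟩, trivial⟩
      (by simp [RExpr.val, e18, h13]) (hidx q hq k hkd) (by rw [hk.arr 2 rfl]) <|
      Run.store k (s.arr 2 (q * d + k)) trivial trivial (by simp [RExpr.val, h13])
      (by simpa using hidx 0 (by omega) k hkd) (by simp [RExpr.val])
      ⟨by simp [RExpr.cost], fun k' hk' => ?_⟩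
    rcases Nat.lt_succ_iff_lt_or_eq.1 hk' with h | rfl
    · simpa [h.ne] using hI k' h
    · simp
  · intro t s' hk hI ht
    simp only [RExpr.cost] at ht
    exact hQ t s' hk (by omega) hI

theorem eliminateRow_run {i j : ℕ} {δ : ℝ} (h10 : s.reg 10 = j) (h12 : s.reg 12 = i)
    (h17 : s.reg 17 = δ) (hδ : δ ≠ 0) (hi : i < n) (hj : j < d) (hW : ((n * d : ℕ) : ℝ) ≤ W)
    (hQ : ∀ t s', Keeps (eliminateRow d) s s' → t ≤ 50 * d + 50 →
      (∀ k < j, s'.arr 2 (i * d + k) = s.arr 2 (i * d + k)) →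
      s'.arr 2 (i * d + j) = s.arr 2 (i * d + j) / δ →
      (∀ k < d, j < k → s'.arr 2 (i * d + k) =
        s.arr 2 (i * d + k) - s.arr 2 (i * d + j) / δ * s.arr 3 k) →
      (∀ i' ≠ i, ∀ k < d, s'.arr 2 (i' * d + k) = s.arr 2 (i' * d + k)) → Q t s') :
    Run W (eliminateRow d) s Q := by
  have hidx : ∀ i < n, ∀ k < d, ((i * d + k : ℕ) : ℝ) < W := fun i hi k hk =>
    lt_of_lt_of_le (by exact_mod_cast flat_lt hi hk) hW
  set x := s.arr 2 (i * d + j) / δ with hx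
  suffices Run W (eliminateRow d) s fun t s' => t ≤ 50 * d + 50 ∧
      (∀ k < j, s'.arr 2 (i * d + k) = s.arr 2 (i * d + k)) ∧
      s'.arr 2 (i * d + j) = x ∧
      (∀ k < d, j < k → s'.arr 2 (i * d + k) = s.arr 2 (i * d + k) - x * s.arr 3 k) ∧
      (∀ i' ≠ i, ∀ k < d, s'.arr 2 (i' * d + k) = s.arr 2 (i' * d + k)) from
    this.mono fun t s' hk ⟨ht, h1, h2, h3, h4⟩ => hQ t s' hk ht h1 h2 h3 h4
  refine Run.seq <| Run.load (i * d + j) (s.arr 2 (i * d + j)) ⟨⟨trivial, trivial⟩, trivial⟩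
    (by simp [RExpr.val, h10, h12]) (hidx i hi j hj) rfl <|
    Run.seq <| Run.assign x ⟨trivial, trivial, by simpa [RExpr.val, h17] using hδ⟩
    (by simp [RExpr.val, h17, hx]) <|
    Run.seq <| Run.store (i * d + j) x ⟨⟨trivial, trivial⟩, trivial⟩ trivial
    (by simp [RExpr.val, h10, h12]) (hidx i hi j hj) (by simp [RExpr.val]) ?_
  -- Column `j` already stores the coefficient; the columns right of it are updated one at a time.
  -- The pivot entries come from array `3`, because the pivot row of array `2` is itself overwritten
  -- when its turn comes.
  refine Run.for (fun m s' => (∀ k < j, s'.arr 2 (i * d + k) = s.arr 2 (i * d + k)) ∧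
      s'.arr 2 (i * d + j) = x ∧
      (∀ k < d, j < k → s'.arr 2 (i * d + k) =
        if k < m then s.arr 2 (i * d + k) - x * s.arr 3 k else s.arr 2 (i * d + k)) ∧
      (∀ i' ≠ i, ∀ k < d, s'.arr 2 (i' * d + k) = s.arr 2 (i' * d + k))) d 40 rfl
    (fun s' hk => ⟨trivial, by simp [RExpr.val]⟩) ?_ ?_ ?_
  · refine ⟨fun k hk => ?_, by simp, fun k _ hk => ?_, fun i' hi' k hk => ?_⟩
    · simp [hk.ne]
    · simp [hk.ne']
    · simp [flat_inj hk hj, hi']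
  · rintro k s' hkd hk h13 ⟨hI₁, hI₂, hI₃, hI₄⟩
    have e10 : s'.reg 10 = j := (hk.reg 10 rfl).trans (by simp [h10])
    have e12 : s'.reg 12 = i := (hk.reg 12 rfl).trans (by simp [h12])
    have e16 : s'.reg 16 = x := (hk.reg 16 rfl).trans (by simp)
    have a3 : s'.arr 3 k = s.arr 3 k := by rw [hk.arr 3 rfl]; simp
    refine Run.cond j k trivial trivial (by simp [RExpr.val, e10]) (by simp [RExpr.val, h13])
      (fun hlt => ?_) fun hge => ?_
    · have hjk : j < k := by exact_mod_cast hlt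
      have hcur := hI₃ k hkd hjk
      rw [if_neg (lt_irrefl k)] at hcur
      refine Run.seq <| Run.load k (s.arr 3 k) trivial (by simp [RExpr.val, h13])
        (by simpa using hidx 0 (by omega) k hkd) a3 <|
        Run.seq <| Run.load (i * d + k) (s.arr 2 (i * d + k)) ⟨⟨trivial, trivial⟩, trivial⟩
        (by simp [RExpr.val, e12, h13]) (hidx i hi k hkd) (by simpa using hcur) <|
        Run.store (i * d + k) (s.arr 2 (i * d + k) - x * s.arr 3 k)
        ⟨⟨trivial, trivial⟩, trivial⟩ ⟨trivial, trivial, trivial⟩ (by simp [RExpr.val, e12, h13])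
        (hidx i hi k hkd) (by simp [RExpr.val, e16]) ?_
      refine ⟨by simp [RExpr.cost], fun k' hk' => ?_, ?_, fun k' hk'd hk' => ?_,
        fun i' hi' k' hk' => ?_⟩
      · simpa [(hk'.trans hjk).ne] using hI₁ k' hk'
      · simpa [hjk.ne] using hI₂
      · by_cases he : k' = k
        · simp [he]
        · have : k' < k + 1 ↔ k' < k := by omega
          simpa [he, this] using hI₃ k' hk'd hk'
      · simpa [flat_inj hk' hkd, hi'] using hI₄ i' hi' k' hk'
    · have hkj : k ≤ j := by exact_mod_cast hge
      refine Run.skip ⟨by simp [RExpr.cost], by simpa using hI₁, by simpa using hI₂,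
        fun k' hk'd hk' => ?_, by simpa using hI₄⟩
      have h1 : ¬ k' < k + 1 := by omega
      have h2 : ¬ k' < k := by omega
      simpa [h1, h2] using hI₃ k' hk'd hk'
  · rintro t s' hk ⟨hI₁, hI₂, hI₃, hI₄⟩ ht
    simp only [RExpr.cost] at ht ⊢
    refine ⟨by omega, hI₁, hI₂, fun k hkd hk => ?_, hI₄⟩
    rw [hI₃ k hkd hk, if_pos hkd]

theorem eliminateColumn_run {j : ℕ} {a b : ℕ → ℕ → ℝ} (h3 : s.reg 3 = n) (h10 : s.reg 10 = j)
    (hn : 0 < n) (hj : j < d) (hW : ((n * d : ℕ) : ℝ) ≤ W) (hE : Eliminated n d a j b (s.arr 2))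
    (hQ : ∀ t s' b', Keeps (eliminateColumn d) s s' → t ≤ (n + 1) * (100 * d + 120) →
      Eliminated n d a (j + 1) b' (s'.arr 2) → Q t s') :
    Run W (eliminateColumn d) s Q := by
  suffices Run W (eliminateColumn d) s fun t s' => t ≤ (n + 1) * (100 * d + 120) ∧
      ∃ b', Eliminated n d a (j + 1) b' (s'.arr 2) from
    this.mono fun t s' hk ⟨ht, b', h⟩ => hQ t s' b' hk ht h
  refine Run.seq <| findPivot_run h3 h10 hn hj hW fun t₁ s₁ q hk₁ ht₁ hq h18 h0 hle hmax => ?_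
  have a2₁ : s₁.arr 2 = s.arr 2 := hk₁.arr 2 rfl
  refine Run.seq <| copyRow_run h18 hq hW fun t₂ s₂ hk₂ ht₂ hrow => ?_
  have a2₂ : s₂.arr 2 = s.arr 2 := (hk₂.arr 2 rfl).trans a2₁
  rw [a2₁] at hrow
  have e17 : s₂.reg 17 = s₁.reg 17 := hk₂.reg 17 rfl
  have e10 : s₂.reg 10 = j := (hk₂.reg 10 rfl).trans ((hk₁.reg 10 rfl).trans h10)
  have e3 : s₂.reg 3 = n := (hk₂.reg 3 rfl).trans ((hk₁.reg 3 rfl).trans h3)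
  have hjW : (j : ℝ) < W := lt_of_lt_of_le
    (by exact_mod_cast (by simpa using flat_lt hn hj : j < n * d)) hW
  -- Common to a nonzero pivot, with the signed entry as divisor, and a zero column, with divisor
  -- `1`. Rows not yet treated are tracked as unchanged, since their old entries are still needed.
  have rest : ∀ (t : ℕ) (s₃ : RState) (δ : ℝ), t ≤ 10 → s₃.reg 3 = n → s₃.reg 10 = j →
      s₃.reg 17 = δ → s₃.arr = s₂.arr → δ ≠ 0 →
      (s.arr 2 (q * d + j) = 0 ∨ δ = s.arr 2 (q * d + j)) →
      Run W (RProg.for 12 (.reg 3) (eliminateRow d)) s₃ fun t' s' =>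
        t₁ + (t₂ + (t + t')) ≤ (n + 1) * (100 * d + 120) ∧
        ∃ b', Eliminated n d a (j + 1) b' (s'.arr 2) := by
    intro t s₃ δ ht f3 f10 f17 farr hδ0 hδ
    refine Run.for (fun m s' => (∀ i < m, (∀ k < j, s'.arr 2 (i * d + k) = s.arr 2 (i * d + k)) ∧
      s'.arr 2 (i * d + j) = s.arr 2 (i * d + j) / δ ∧
      (∀ k < d, j < k → s'.arr 2 (i * d + k) =
        s.arr 2 (i * d + k) - s.arr 2 (i * d + j) / δ * s.arr 2 (q * d + k))) ∧
      ∀ i, m ≤ i → ∀ k < d, s'.arr 2 (i * d + k) = s.arr 2 (i * d + k)) n (50 * d + 50) rfl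
      (fun s' hk => ⟨trivial, (hk.reg 3 rfl).trans f3⟩) ?_ ?_ ?_
    · exact ⟨by simp, fun i _ k _ => by simp [farr, a2₂]⟩
    · rintro i s' hi hk h12 ⟨hI₁, hI₂⟩
      have a3 : s'.arr 3 = s₂.arr 3 := (hk.arr 3 rfl).trans (by rw [farr])
      refine eliminateRow_run ((hk.reg 10 rfl).trans f10) h12 ((hk.reg 17 rfl).trans f17) hδ0 hi hj
        hW fun t' s'' hk' ht' h1 h2 h3 h4 => ⟨ht', fun i' hi' => ?_, fun i' hi' k hk => ?_⟩
      · rcases Nat.lt_succ_iff_lt_or_eq.1 hi' with h | rfl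
        · obtain ⟨g1, g2, g3⟩ := hI₁ i' h
          refine ⟨fun k hk => ?_, ?_, fun k hk hjk => ?_⟩
          · simpa [h4 i' h.ne k (hk.trans hj)] using g1 k hk
          · simpa [h4 i' h.ne j hj] using g2
          · simpa [h4 i' h.ne k hk] using g3 k hk hjk
        · refine ⟨fun k hk => ?_, ?_, fun k hk hjk => ?_⟩
          · simp [h1 k hk, hI₂ i' le_rfl k (hk.trans hj)]
          · simp [h2, hI₂ i' le_rfl j hj]
          · simp [h3 k hk hjk, hI₂ i' le_rfl k hk, hI₂ i' le_rfl j hj, a3, hrow k hk]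
      · simp [h4 i' (by omega) k hk, hI₂ i' (by omega) k hk]
    · rintro t' s' hk ⟨hI, -⟩ ht'
      simp only [RExpr.cost] at ht'
      refine ⟨?_, _, hE.step hq hj (fun i hi => (hmax i hi).trans hle) hδ hδ0
        (fun i hi => (hI i hi).1) (fun i hi => (hI i hi).2.1) fun i hi => (hI i hi).2.2⟩
      nlinarith [Nat.zero_le (n * d)]
  refine Run.seq <| Run.cond 0 (s₁.reg 17) trivial trivial (by simp [RExpr.val])
    (by simp [RExpr.val, e17]) (fun hlt => ?_) fun hge => ?_
  · refine Run.load j (s.arr 2 (q * d + j)) trivial (by simp [RExpr.val, e10]) hjW (hrow j hj) ?_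
    refine rest _ _ _ (by simp [RExpr.cost]) (by simp [e3]) (by simp [e10]) (by simp) (by simp) ?_
      (Or.inr rfl)
    exact abs_pos.1 (hlt.trans_le hle)
  · refine Run.assign 1 trivial (by simp [RExpr.val]) ?_
    refine rest _ _ _ (by simp [RExpr.cost]) (by simp [e3]) (by simp [e10]) (by simp) (by simp)
      one_ne_zero (Or.inl ?_)
    exact abs_eq_zero.1 (le_antisymm ((hmax q hq).trans hge) (abs_nonneg _))

theorem normalize_run (h3 : s.reg 3 = n) (hn : 0 < n) (hW : ((n * d : ℕ) : ℝ) ≤ W)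
    (hQ : ∀ t s' b, Keeps (normalize d) s s' → t ≤ 1000 * (d + 1) ^ 2 * n →
      Eliminated n d (fun i k => s.arr 0 (i * d + k) - s.arr 0 k) d b (s'.arr 2) → Q t s') :
    Run W (normalize d) s Q := by
  refine Run.seq <| translate_run h3 hn hW fun t₁ s₁ hk₁ ht₁ ha => ?_
  refine Run.for (fun m s' => ∃ b, Eliminated n d (fun i k => s.arr 0 (i * d + k) - s.arr 0 k) m b
    (s'.arr 2)) d ((n + 1) * (100 * d + 120)) rfl (fun s' hk => ⟨trivial, by simp [RExpr.val]⟩)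
    ⟨_, .zero (by simpa using ha)⟩ ?_ ?_
  · rintro j s' hj hk h10 ⟨b, hb⟩
    exact eliminateColumn_run ((hk.reg 3 rfl).trans ((hk₁.reg 3 rfl).trans h3)) h10 hn hj hW hb
      fun t s'' b' hk' ht hb' => ⟨ht, b', hb'⟩
  · rintro t s' hk ⟨b, hb⟩ ht
    simp only [RExpr.cost] at ht
    refine hQ _ s' b ⟨fun r hr => ?_, fun a ha => ?_⟩ ?_ hb
    · simp only [normalize, RProg.setsReg, Bool.or_eq_false_iff] at hr
      exact (hk.reg r hr.2).trans (hk₁.reg r hr.1)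
    · simp only [normalize, RProg.setsArr, Bool.or_eq_false_iff] at ha
      exact (hk.arr a ha.2).trans (hk₁.arr a ha.1)
    · have h1 : 1 ≤ n := hn
      have h2 : (n + 1) * (100 * d + 120) ≤ 2 * n * (100 * d + 120) :=
        Nat.mul_le_mul_right _ (by omega)
      have h3 : d * ((n + 1) * (100 * d + 120) + 1 + 6) ≤ d * (2 * n * (100 * d + 120) + 7) :=
        Nat.mul_le_mul_left _ (by omega)
      nlinarith [Nat.mul_le_mul_left d h1, Nat.zero_le (d * n), Nat.zero_le (d ^ 2 * n)]

end

/-! ### The quality of the output -/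

theorem sum_skipAxis {D j : ℕ} (hj : j < D + 1) (f : ℕ → ℝ) :
    ∑ l ∈ range (D + 1), f l = f j + ∑ k ∈ range D, f (skipAxis j k) := by
  rw [sum_range, sum_range, Fin.sum_univ_succAbove _ ⟨j, hj⟩]
  congr 1
  refine sum_congr rfl fun k _ => ?_
  congr 1
  rw [skipAxis, Fin.succAbove]
  simp only [Fin.lt_def, Fin.val_castSucc]
  split_ifs <;> simp

/-- In one coordinate, with `x` for `i`, `y` for `q` and direction `x + w - e`, the gain difference
is `w (y - x) - e (y - x) - (y - x)² / 2`. Completing the square bounds it by `w (y - x) + e² / 2`: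
the paraboloid turns a linear rounding error into a quadratic one. -/
theorem gain_sub_le {D K j i q : ℕ} {c : ℕ → ℝ} {σ : ℝ} {w : ℕ → ℝ} {v : ℕ → ℕ} {κ : ℝ}
    (hj : j < D + 1) (hσ : w j = σ)
    (hv : ∀ k < D, |c (i * (D + 1) + skipAxis j k) + w (skipAxis j k) - dirPos K (v k)| ≤ κ) :
    gain D K c σ j v q - gain D K c σ j v i ≤ ∑ l ∈ range (D + 1), w l * c (q * (D + 1) + l) -
      ∑ l ∈ range (D + 1), w l * c (i * (D + 1) + l) + D * (κ ^ 2 / 2) := by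
  rw [sum_skipAxis hj, sum_skipAxis hj, hσ]
  have key : ∑ k ∈ range D, (c (q * (D + 1) + skipAxis j k) * dirPos K (v k) -
      c (q * (D + 1) + skipAxis j k) ^ 2 / 2 -
      (c (i * (D + 1) + skipAxis j k) * dirPos K (v k) -
      c (i * (D + 1) + skipAxis j k) ^ 2 / 2)) ≤ ∑ k ∈ range D,
      (w (skipAxis j k) * c (q * (D + 1) + skipAxis j k) -
      w (skipAxis j k) * c (i * (D + 1) + skipAxis j k) + κ ^ 2 / 2) := by
    refine sum_le_sum fun k hk => ?_
    have h := sq_le_sq' (abs_le.1 (hv k (mem_range.1 hk))).1 (abs_le.1 (hv k (mem_range.1 hk))).2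
    set x := c (i * (D + 1) + skipAxis j k)
    set y := c (q * (D + 1) + skipAxis j k)
    set e := x + w (skipAxis j k) - dirPos K (v k) with he
    have : dirPos K (v k) = x + w (skipAxis j k) - e := by rw [he]; ring
    rw [this]
    nlinarith [sq_nonneg (y - x + e)]
  simp only [sum_sub_distrib, sum_add_distrib, sum_const, card_range, nsmul_eq_mul] at key
  simp only [gain, lifted]
  linarith

/-- The targets `x + w` fill `[-2, 2]`, which is why the direction grid is offset by `2` and has `4
K + 1` nodes per axis. -/
theorem exists_dirPos {K : ℕ} (hK : 0 < K) {x w : ℝ} (hx : |x| ≤ 1) (hw : |w| ≤ 1) :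
    ∃ v < 4 * K + 1, |x + w - dirPos K v| ≤ 1 / K := by
  have hK' : (0 : ℝ) < K := by exact_mod_cast hK
  have hx := abs_le.1 hx
  have hw := abs_le.1 hw
  have h0 : 0 ≤ (x + w + 2) * K := by nlinarith
  refine ⟨⌊(x + w + 2) * K⌋₊, ?_, ?_⟩
  · rw [Nat.floor_lt h0]
    push_cast
    nlinarith
  · have h1 := Nat.floor_le h0
    have h2 := Nat.lt_floor_add_one ((x + w + 2) * (K : ℝ))
    have e : x + w - dirPos K ⌊(x + w + 2) * K⌋₊ =
        ((x + w + 2) * K - (⌊(x + w + 2) * K⌋₊ : ℝ)) / K := by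
      simp only [dirPos]; field_simp; ring
    rw [e, abs_div, abs_of_pos hK']
    gcongr
    rw [abs_le]
    constructor <;> linarith

/-- For every face of the cube and every direction of the grid, `L` has an almost highest point. -/
def Covers (D n K : ℕ) (c : ℕ → ℝ) (δ : ℝ) (L : List ℕ) : Prop :=
  ∀ j < D + 1, ∀ σ : ℝ, σ = 1 ∨ σ = -1 → ∀ v : ℕ → ℕ, (∀ k < D, v k < 4 * K + 1) →
    ∃ q ∈ L, ∀ i < n, gain D K c σ j v i ≤ gain D K c σ j v q + δ

theorem Covers.exists_le {D n K : ℕ} {c : ℕ → ℝ} {δ : ℝ} {L : List ℕ} (h : Covers D n K c δ L)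
    (hK : 0 < K) (hc : ∀ i < n, ∀ k < D + 1, |c (i * (D + 1) + k)| ≤ 1) {w : ℕ → ℝ}
    (hw : ∀ k < D + 1, |w k| ≤ 1) {j : ℕ} (hj : j < D + 1) (hwj : |w j| = 1) {i : ℕ} (hi : i < n) :
    ∃ q ∈ L, ∑ l ∈ range (D + 1), w l * c (i * (D + 1) + l) ≤
      ∑ l ∈ range (D + 1), w l * c (q * (D + 1) + l) + (δ + D / (2 * K ^ 2)) := by
  -- The grid direction approximates `x_i + w`, so it depends on the point `i` to be matched and not
  -- only on `w`.
  have hex : ∀ k, ∃ v : ℕ, k < D → v < 4 * K + 1 ∧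
      |c (i * (D + 1) + skipAxis j k) + w (skipAxis j k) - dirPos K v| ≤ 1 / K := by
    intro k
    by_cases hk : k < D
    · obtain ⟨v, hv⟩ := exists_dirPos hK (hc i hi _ (skipAxis_lt (j := j) hk))
        (hw _ (skipAxis_lt (j := j) hk))
      exact ⟨v, fun _ => hv⟩
    · exact ⟨0, fun h => absurd h hk⟩
  choose v hv using hex
  obtain ⟨q, hq, hle⟩ := h j hj (w j) ((abs_eq zero_le_one).1 hwj) v fun k hk => (hv k hk).1
  refine ⟨q, hq, ?_⟩
  have h1 := gain_sub_le (q := q) hj rfl fun k hk => (hv k hk).2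
  have h2 := hle i hi
  have h3 : (D : ℝ) * ((1 / K) ^ 2 / 2) = D / (2 * K ^ 2) := by field_simp
  rw [h3] at h1
  linarith

/-- In the normalized coordinates the functional has coefficients `θ`. Dividing by `max |θ_l|` makes
one of them `±1`, so a face applies; multiplying back scales the error by at most `2 ^ D M`. -/
theorem Eliminated.exists_le {D n K : ℕ} {a b : ℕ → ℕ → ℝ} {c : ℕ → ℝ} {δ : ℝ} {L : List ℕ}
    (hE : Eliminated n (D + 1) a (D + 1) b c) (h : Covers D n K c δ L) (hK : 0 < K)
    (hL : ∀ q ∈ L, q < n) (hδ : 0 ≤ δ) (u : ℕ → ℝ) {M : ℝ}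
    (hM : ∀ i < n, |∑ k ∈ range (D + 1), u k * a i k| ≤ M) {i : ℕ} (hi : i < n) :
    ∃ q ∈ L, ∑ k ∈ range (D + 1), u k * a i k ≤ ∑ k ∈ range (D + 1), u k * a q k +
      (δ + D / (2 * K ^ 2)) * (2 ^ D * M) := by
  set θ : ℕ → ℝ := fun l => ∑ k ∈ range (D + 1), u k * b l k with hθ
  have hsum : ∀ i < n, ∑ k ∈ range (D + 1), u k * a i k =
      ∑ l ∈ range (D + 1), θ l * c (i * (D + 1) + l) := by
    intro i hi
    simp only [hθ, sum_mul]
    rw [sum_comm]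
    refine sum_congr rfl fun k hk => ?_
    have hk := mem_range.1 hk
    rw [hE.eq i hi k hk, if_neg (by omega), add_zero, mul_sum]
    exact sum_congr rfl fun l _ => by ring
  have hM0 : 0 ≤ M := (abs_nonneg _).trans (hM i hi)
  obtain ⟨j, hj, hmax⟩ := exists_max_image (range (D + 1)) (fun l => |θ l|) ⟨0, by simp⟩
  have hj := mem_range.1 hj
  have hθM : |θ j| ≤ 2 ^ D * M := (hE.pivot u M hM j hj).trans <| by
    gcongr
    · norm_num
    · omega
  have hη : 0 ≤ δ + D / (2 * (K : ℝ) ^ 2) := by positivity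
  -- If `θ = 0`, all translated scores vanish and any member of `L` serves; one exists because
  -- `Covers` supplies a witness for every direction.
  rcases (abs_nonneg (θ j)).eq_or_lt with h0 | hpos
  · obtain ⟨q, hq, -⟩ := h 0 (by omega) 1 (Or.inl rfl) (fun _ => 0) (by simp)
    refine ⟨q, hq, ?_⟩
    have hz : ∀ l ∈ range (D + 1), θ l = 0 := by
      intro l hl
      have := hmax l hl
      rw [← h0] at this
      exact abs_eq_zero.1 (le_antisymm this (abs_nonneg _))
    rw [hsum i hi, hsum q (hL q hq), sum_eq_zero fun l hl => by rw [hz l hl, zero_mul],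
      sum_eq_zero fun l hl => by rw [hz l hl, zero_mul]]
    positivity
  · obtain ⟨q, hq, hle⟩ := h.exists_le (w := fun l => θ l / |θ j|) hK
      (fun i hi k hk => hE.abs_le i hi k hk) (fun k hk => by
        rw [abs_div, abs_abs]
        exact div_le_one_of_le₀ (hmax k (mem_range.2 hk)) (abs_nonneg _)) hj
      (by rw [abs_div, abs_abs, div_self hpos.ne']) hi
    refine ⟨q, hq, ?_⟩
    rw [hsum i hi, hsum q (hL q hq)]
    have e : ∀ i, ∑ l ∈ range (D + 1), θ l * c (i * (D + 1) + l) =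
        |θ j| * ∑ l ∈ range (D + 1), θ l / |θ j| * c (i * (D + 1) + l) := by
      intro i
      rw [mul_sum]
      exact sum_congr rfl fun l _ => by field_simp
    rw [e, e]
    calc _ ≤ |θ j| * (∑ l ∈ range (D + 1), θ l / |θ j| * c (q * (D + 1) + l) +
          (δ + D / (2 * K ^ 2))) := mul_le_mul_of_nonneg_left hle hpos.le
      _ = |θ j| * ∑ l ∈ range (D + 1), θ l / |θ j| * c (q * (D + 1) + l) +
          (δ + D / (2 * K ^ 2)) * |θ j| := by ring
      _ ≤ _ := by gcongr

/-! ### From one-sided score bounds to kernels and regret -/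

theorem le_topScore {d : ℕ} (u : Point d) {P : Finset (Point d)} {p : Point d} (hp : p ∈ P) :
    score u p ≤ topScore u P := by
  have h := (kthScore_spec u le_rfl (card_pos.2 ⟨p, hp⟩)).2.1
  rw [Nat.lt_one_iff, card_eq_zero, filter_eq_empty_iff] at h
  exact not_lt.1 (h hp)

theorem exists_score_eq_topScore {d : ℕ} (u : Point d) {P : Finset (Point d)} (hP : P.Nonempty) :
    ∃ p ∈ P, score u p = topScore u P :=
  (kthScore_spec u le_rfl (card_pos.2 hP)).1

theorem score_neg {d : ℕ} (u p : Point d) : score (-u) p = -score u p := by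
  simp [score]

theorem abs_score_sub_le {d : ℕ} (u : Point d) {P : Finset (Point d)} {p q : Point d} (hp : p ∈ P)
    (hq : q ∈ P) : |score u p - score u q| ≤ width u P := by
  have h1 := le_topScore u hp
  have h2 := le_topScore u hq
  have h3 := le_topScore (-u) hp
  have h4 := le_topScore (-u) hq
  rw [score_neg] at h3 h4
  rw [width, abs_le]
  constructor <;> linarith

/-- The width sees the loss in both `u` and `-u`, so each side may lose half of `ε` times the width.
-/
theorem isKernel_of_topScore {d : ℕ} {ε : ℝ} {Q P : Finset (Point d)} (hQP : Q ⊆ P)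
    (h : ∀ u, topScore u P ≤ topScore u Q + ε / 2 * width u P) : IsKernel ε Q P := by
  refine ⟨hQP, fun u => ?_⟩
  have h1 := h u
  have h2 := h (-u)
  have h3 : width (-u) P = width u P := by rw [width, width, neg_neg, add_comm]
  rw [h3] at h2
  have h4 : width u P = topScore u P + topScore (-u) P := rfl
  have h5 : width u Q = topScore u Q + topScore (-u) Q := rfl
  linarith

theorem regretRatio_le_of_isKernel {d k : ℕ} {ε : ℝ} {Q P : Finset (Point d)} (hε : 0 ≤ ε)
    (hk : 1 ≤ k) (hkP : k ≤ #P) (hP : ∀ p ∈ P, p ∈ orthant d) (hQ : Q.Nonempty)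
    (h : IsKernel ε Q P) : regretRatio k Q P ≤ ε := by
  refine Real.iSup_le (fun u => ?_) hε
  have hk0 : 0 ≤ kthScore k u.1 P := kthScore_nonneg hk hkP u.2 hP
  have hPne : P.Nonempty := hQ.mono h.1
  obtain ⟨⟨p, hp, hpk⟩, -⟩ := kthScore_spec u.1 hk hkP
  have h1 : kthScore k u.1 P ≤ topScore u.1 P := hpk ▸ le_topScore u.1 hp
  have hneg : ∀ S : Finset (Point d), S.Nonempty → S ⊆ P → topScore (-u.1) S ≤ 0 ∧
      topScore (-u.1) S ≤ topScore (-u.1) P := by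
    intro S hS hSP
    obtain ⟨q, hq, hqe⟩ := exists_score_eq_topScore (-u.1) hS
    rw [← hqe]
    refine ⟨?_, le_topScore _ (hSP hq)⟩
    rw [score_neg]
    linarith [score_nonneg u.2 (hP q (hSP hq))]
  have h2 := h.2 u.1
  have h3 := (hneg Q hQ h.1).2
  have h4 := (hneg P hPne (Subset.refl P)).1
  have h5 : topScore u.1 P - topScore u.1 Q ≤ ε * width u.1 P := by
    have h4 : width u.1 P = topScore u.1 P + topScore (-u.1) P := rfl
    have h5 : width u.1 Q = topScore u.1 Q + topScore (-u.1) Q := rfl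
    linarith
  have hQ0 : 0 ≤ topScore u.1 Q :=
    kthScore_nonneg le_rfl (card_pos.2 hQ) u.2 fun p hp => hP p (h.1 hp)
  refine div_le_of_le_mul₀ hk0 hε (max_le (by positivity) ?_)
  -- Replacing `ω` by `ω_k` multiplies an inequality by `1 - ε`, which needs `ε ≤ 1`. For larger
  -- `ε`, nonnegativity of the score of `Q` is enough.
  rcases le_or_gt ε 1 with hε1 | hε1
  · have h6 : ε * width u.1 P ≤ ε * topScore u.1 P :=
      mul_le_mul_of_nonneg_left (by rw [width]; linarith) hε
    have h7 : (1 - ε) * kthScore k u.1 P ≤ (1 - ε) * topScore u.1 P :=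
      mul_le_mul_of_nonneg_left h1 (by linarith)
    linarith
  · nlinarith

/-! ### The algorithm -/

/-- The resolution of the grid. -/
noncomputable def gridSize (D : ℕ) (ε : ℝ) : ℕ := max 1 ⌈√(D / ε)⌉₊

/-- The constant factor between the resolution and the grid. -/
def gridFactor (D : ℕ) : ℕ := 2 ^ (D + 4)

/-- A bound for the number of cells and the number of directions on an axis. -/
noncomputable def gridBound (D : ℕ) (ε : ℝ) : ℕ := 5 * gridFactor D * gridSize D ε ^ 2

/-- Computes the resolution of the grid. -/
def resolution (D : ℕ) : RProg :=
  .seq (.assign 4 (.lit 1)) <|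
  .loop (.mul (.mul (.reg 4) (.reg 4)) (.reg 2)) (.lit D) (.assign 4 (.add (.reg 4) (.lit 1)))

/-- Computes the parameters of the grid. -/
def setup (D : ℕ) : RProg :=
  .seq (.assign 3 (.reg 0)) <|
  .seq (resolution D) <|
  .seq (.assign 6 (.mul (.lit (gridFactor D)) (.reg 4))) <|
  .seq (.assign 5 (.mul (.reg 6) (.reg 4))) <|
  .seq (.assign 7 (.add (.mul (.lit 2) (.reg 5)) (.lit 1))) <|
  .seq (.assign 8 (.add (.mul (.lit 4) (.reg 6)) (.lit 1))) <|
  .seq (.assign 9 (.lit 1)) <|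
  RProg.for 13 (.lit D) (.assign 9 (.mul (.reg 9) (.reg 7)))

/-- Empties the output. -/
def clearOutput : RProg :=
  .seq (.assign 0 (.lit 0)) <| RProg.for 12 (.reg 3) (.store 9 (.reg 12) (.lit 0))

/-- Outputs almost extreme points for all faces of the cube. -/
def allFaces (D : ℕ) : RProg :=
  RProg.for 10 (.lit (D + 1 : ℕ)) <|
    .seq (.assign 11 (.lit 1)) <| .seq (faceProg D) <|
    .seq (.assign 11 (.lit (-1))) (faceProg D)

/-- Computes a kernel of points in dimension `D + 1`. -/
def kernelProg (D : ℕ) : RProg :=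
  .seq (setup D) <| .seq (normalize (D + 1)) <| .seq clearOutput (allFaces D)

section

variable {W : ℝ} {s : RState} {Q : ℕ → RState → Prop} {D n : ℕ} {ε : ℝ}

theorem gridSize_pos (D : ℕ) (ε : ℝ) : 0 < gridSize D ε := lt_max_of_lt_left one_pos

theorem le_gridSize_sq (D : ℕ) (hε : 0 < ε) : D ≤ (gridSize D ε : ℝ) ^ 2 * ε := by
  have h : √(D / ε) ≤ gridSize D ε :=
    (Nat.le_ceil _).trans (by exact_mod_cast le_max_right _ _)
  rw [Real.sqrt_le_left (by positivity), div_le_iff₀ hε] at h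
  exact h

/-- The machine has no square root. Counting up to the least `F ≥ 1` with `F² ε ≥ D` takes `O(F)`
steps, which is within budget. -/
theorem resolution_run (h2 : s.reg 2 = ε) (hε : 0 < ε)
    (hQ : ∀ t s', Keeps (resolution D) s s' → t ≤ 20 * gridSize D ε + 20 →
      s'.reg 4 = gridSize D ε → Q t s') :
    Run W (resolution D) s Q := by
  refine Run.seq <| Run.assign 1 trivial (by simp [RExpr.val]) ?_
  refine Run.loop (fun μ s' => s'.reg 2 = ε ∧ ∃ F : ℕ, 1 ≤ F ∧ F ≤ gridSize D ε ∧ s'.reg 4 = F ∧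
    μ + F = gridSize D ε) 5 (gridSize D ε - 1)
    (fun m s' _ => ⟨⟨⟨trivial, trivial⟩, trivial⟩, trivial⟩) ?_ ?_ ?_
  · have := gridSize_pos D ε
    exact ⟨by simp [h2], 1, le_rfl, this, by simp, by omega⟩
  · rintro μ s' hk ⟨e2, F, hF1, hF, h4, hμ⟩ hlt
    simp only [RExpr.val, h4, e2, Int.cast_natCast] at hlt
    have hFs : F < gridSize D ε := by
      have h1 : (F : ℝ) < √(D / ε) := by
        rw [Real.lt_sqrt (by positivity), lt_div_iff₀ hε, sq]
        exact hlt
      have h2 : (F : ℝ) < ⌈√(D / ε)⌉₊ := h1.trans_le (Nat.le_ceil _)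
      exact lt_max_of_lt_right (by exact_mod_cast h2)
    refine Run.assign ((F + 1 : ℕ) : ℝ) ⟨trivial, trivial⟩ (by simp [RExpr.val, h4]) ?_
    exact ⟨by simp [RExpr.cost], μ - 1, by omega, by simp [e2], F + 1, by omega, by omega,
      by simp, by omega⟩
  · rintro μ t s' hk ⟨e2, F, hF1, hF, h4, hμ⟩ hge ht
    simp only [RExpr.val, h4, e2, Int.cast_natCast] at hge
    have hFs : gridSize D ε ≤ F := by
      refine max_le hF1 (Nat.ceil_le.2 ?_)
      rw [Real.sqrt_le_left (by positivity), div_le_iff₀ hε, sq]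
      exact hge
    refine hQ _ s' ⟨fun r hr => ?_, fun a ha => hk.arr a ha⟩ ?_ (by rw [h4, le_antisymm hF hFs])
    · simp only [resolution, RProg.setsReg, Bool.or_eq_false_iff, beq_eq_false_iff_ne] at hr
      rw [hk.reg r (by simpa [RProg.setsReg] using hr.1)]
      simp [hr.1]
    · simp only [RExpr.cost] at ht ⊢
      omega

theorem setup_run (h0 : s.reg 0 = n) (h2 : s.reg 2 = ε) (hε : 0 < ε)
    (hQ : ∀ t s', Keeps (setup D) s s' → t ≤ 20 * gridSize D ε + 20 * D + 100 →
      GridEnv D n (gridFactor D * gridSize D ε * gridSize D ε) (gridFactor D * gridSize D ε) s' →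
      Q t s') :
    Run W (setup D) s Q := by
  suffices Run W (setup D) s fun t s' => t ≤ 20 * gridSize D ε + 20 * D + 100 ∧
      GridEnv D n (gridFactor D * gridSize D ε * gridSize D ε) (gridFactor D * gridSize D ε) s' from
    this.mono fun t s' hk h => hQ t s' hk h.1 h.2
  set F := gridSize D ε
  refine Run.seq <| Run.assign n trivial (by simp [RExpr.val, h0]) <| Run.seq <|
    resolution_run (ε := ε) (by simp [h2]) hε fun t₁ s₁ hk₁ ht₁ h4 => ?_
  have h3 : s₁.reg 3 = n := (hk₁.reg 3 rfl).trans (by simp)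
  set K := gridFactor D * F with hK
  set H := K * F with hH
  refine Run.seq <| Run.assign K ⟨trivial, trivial⟩ (by simp [RExpr.val, h4, hK, F]) <|
    Run.seq <| Run.assign H ⟨trivial, trivial⟩ (by simp [RExpr.val, h4, hH, F]) <|
    Run.seq <| Run.assign (2 * H + 1 : ℕ) ⟨⟨trivial, trivial⟩, trivial⟩ (by simp [RExpr.val]) <|
    Run.seq <| Run.assign (4 * K + 1 : ℕ) ⟨⟨trivial, trivial⟩, trivial⟩ (by simp [RExpr.val]) <|
    Run.seq <| Run.assign 1 trivial (by simp [RExpr.val]) ?_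
  refine Run.for (fun m s' => s'.reg 9 = ((2 * H + 1) ^ m : ℕ)) D 5 rfl
    (fun s' hk => ⟨trivial, by simp [RExpr.val]⟩) (by simp) ?_ ?_
  · intro m s' hm hk h13 h9
    refine Run.assign (((2 * H + 1) ^ (m + 1) : ℕ) : ℝ) ⟨trivial, trivial⟩ ?_
      ⟨by simp [RExpr.cost], by simp⟩
    have h7 : s'.reg 7 = (2 * H + 1 : ℕ) := (hk.reg 7 rfl).trans (by simp)
    simp [RExpr.val, h9, h7, pow_succ]
  · intro t s' hk h9 ht
    simp only [RExpr.cost] at ht ⊢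
    refine ⟨by omega, ⟨(hk.reg 3 rfl).trans (by simp [h3]), (hk.reg 5 rfl).trans (by simp),
      (hk.reg 6 rfl).trans (by simp), (hk.reg 7 rfl).trans (by simp),
      (hk.reg 8 rfl).trans (by simp), h9⟩⟩

theorem clearOutput_run (h3 : s.reg 3 = n) (hW : (n : ℝ) ≤ W)
    (hQ : ∀ t s', Keeps clearOutput s s' → t ≤ 20 * n + 20 → Stored n [] s' → Q t s') :
    Run W clearOutput s Q := by
  suffices Run W clearOutput s fun t s' => t ≤ 20 * n + 20 ∧ Stored n [] s' from
    this.mono fun t s' hk h => hQ t s' hk h.1 h.2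
  refine Run.seq <| Run.assign 0 trivial (by simp [RExpr.val]) ?_
  refine Run.for (fun m s' => ∀ i < m, s'.arr 9 i = 0) n 5 rfl
    (fun s' hk => ⟨trivial, (hk.reg 3 rfl).trans (by simp [h3])⟩) (by simp) ?_ ?_
  · intro i s' hi hk h12 hI
    refine Run.store i 0 trivial trivial (by simp [RExpr.val, h12])
      (lt_of_lt_of_le (by exact_mod_cast hi) hW) (by simp [RExpr.val])
      ⟨by simp [RExpr.cost], fun i' hi' => ?_⟩
    rcases Nat.lt_succ_iff_lt_or_eq.1 hi' with h | rfl
    · simpa [h.ne] using hI i' h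
    · simp
  · intro t s' hk hI ht
    simp only [RExpr.cost] at ht ⊢
    exact ⟨by omega, by simp, by simp, (hk.reg 0 rfl).trans (by simp), by simp, by simpa using hI⟩

theorem allFaces_run {H K U : ℕ} (hs : GridEnv D n H K s) (hn0 : 0 < n) (hH : 0 < H) (hK : 0 < K)
    (hEU : 2 * H + 1 ≤ U) (hGU : 4 * K + 1 ≤ U)
    (hW : ((n * (D + 1) + U ^ D + U : ℕ) : ℝ) ≤ W)
    (hc : ∀ i < n, ∀ k < D + 1, |s.arr 2 (i * (D + 1) + k)| ≤ 1) (hL : Stored n [] s)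
    (hQ : ∀ t s' L, Keeps (allFaces D) s s' →
      t ≤ (D + 1) * (4000 * (D + 1) * (n + U ^ D) + 20) + 10 → Stored n L s' →
      L.length ≤ 2 * (D + 1) * (4 * K + 1) ^ D → Covers D n K (s.arr 2) (D * (4 / H)) L → Q t s') :
    Run W (allFaces D) s Q := by
  refine Run.for (fun m s' => ∃ L, Stored n L s' ∧ L.length ≤ 2 * m * (4 * K + 1) ^ D ∧
    ∀ j < m, ∀ σ : ℝ, σ = 1 ∨ σ = -1 → ∀ v : ℕ → ℕ, (∀ k < D, v k < 4 * K + 1) →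
    ∃ q ∈ L, ∀ i < n, gain D K (s.arr 2) σ j v i ≤ gain D K (s.arr 2) σ j v q + D * (4 / H))
    (D + 1) (4000 * (D + 1) * (n + U ^ D) + 10) rfl (fun s' hk => ⟨trivial, by simp [RExpr.val]⟩)
    ?_ ?_ ?_
  · exact ⟨[], ⟨hL.nodup, hL.lt, by simp [hL.len], by simp,
      by simpa using hL.mark⟩, by simp, by simp⟩
  · rintro j s₁ hj hk₁ h10 ⟨L, hS, hlen, hcov⟩
    have a2₁ : s₁.arr 2 = s.arr 2 := hk₁.arr 2 rfl
    have env : ∀ s' : RState, (∀ r, 3 ≤ r → r ≤ 9 → s'.reg r = s₁.reg r) → GridEnv D n H K s' := by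
      intro s' h
      refine hs.of_keeps fun r h1 h2 => (h r h1 h2).trans (hk₁.reg r ?_)
      interval_cases r <;> rfl
    refine Run.seq <| Run.assign 1 trivial (by simp [RExpr.val]) <| Run.seq ?_
    refine faceProg_run (U := U) (L := L) (σ := 1) (j := j)
      (env _ fun r h1 h2 => by simp; omega) (by simp [h10]) (by simp) (by simp) hj hn0 hH hK hEU hGU
      hW (by simpa [a2₁] using hc) ⟨hS.nodup, hS.lt, by simp [hS.len], by simpa using hS.out,
      by simpa using hS.mark⟩ fun t₂ s₂ L₂ hk₂ ht₂ hS₂ hsub₂ hlen₂ hcov₂ => ?_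
    have a2₂ : s₂.arr 2 = s.arr 2 := (hk₂.arr 2 rfl).trans a2₁
    refine Run.seq <| Run.assign (-1) trivial (by simp [RExpr.val]) ?_
    refine faceProg_run (U := U) (L := L₂) (σ := -1) (j := j)
      (env _ fun r h1 h2 => ?_) (by simp [hk₂.reg 10 rfl, h10]) (by simp) (by simp) hj hn0
      hH hK hEU hGU hW (by simpa [a2₂] using hc) ⟨hS₂.nodup, hS₂.lt, by simp [hS₂.len],
      by simpa using hS₂.out, by simpa using hS₂.mark⟩
      fun t₃ s₃ L₃ hk₃ ht₃ hS₃ hsub₃ hlen₃ hcov₃ => ?_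
    · have : r ≠ 11 := by omega
      rw [setReg_reg, if_neg this, hk₂.reg r (by interval_cases r <;> rfl), setReg_reg, if_neg this]
    refine ⟨?_, L₃, ⟨hS₃.nodup, hS₃.lt, by simp [hS₃.len], by simpa using hS₃.out,
      by simpa using hS₃.mark⟩, ?_, fun j' hj' σ hσ v hv => ?_⟩
    · have : 4000 * (D + 1) * (n + U ^ D) =
        2000 * (D + 1) * (n + U ^ D) + 2000 * (D + 1) * (n + U ^ D) := by ring
      simp only [RExpr.cost]
      omega
    · have : 2 * (j + 1) * (4 * K + 1) ^ D =
        2 * j * (4 * K + 1) ^ D + (4 * K + 1) ^ D + (4 * K + 1) ^ D := by ring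
      omega
    · rcases Nat.lt_succ_iff_lt_or_eq.1 hj' with h | rfl
      · obtain ⟨q, hq, hle⟩ := hcov j' h σ hσ v hv
        exact ⟨q, hsub₃ (hsub₂ hq), hle⟩
      · rcases hσ with rfl | rfl
        · obtain ⟨q, hq, hle⟩ := hcov₂ v hv
          simp only [setReg_arr, a2₁] at hle
          exact ⟨q, hsub₃ hq, hle⟩
        · obtain ⟨q, hq, hle⟩ := hcov₃ v hv
          simp only [setReg_arr, a2₂] at hle
          exact ⟨q, hq, hle⟩
  · rintro t s' hk ⟨L, hS, hlen, hcov⟩ ht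
    simp only [RExpr.cost] at ht
    refine hQ t s' L hk ?_ hS hlen hcov
    have : (D + 1) * (4000 * (D + 1) * (n + U ^ D) + 10 + 1 + 6) ≤
      (D + 1) * (4000 * (D + 1) * (n + U ^ D) + 20) := Nat.mul_le_mul_left _ (by omega)
    omega

/-- The summand `gridBound D ε` beside its power matters only for `D = 0`, where the power is `1`
but the capacity must still cover the parameters of an axis. -/
theorem kernelProg_run (h0 : s.reg 0 = n) (h2 : s.reg 2 = ε) (hε : 0 < ε) (hn : 0 < n)
    (hW : ((n * (D + 1) + gridBound D ε ^ D + gridBound D ε : ℕ) : ℝ) ≤ W)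
    (hQ : ∀ t s' L b c, t ≤ 100000 * (D + 2) ^ 2 * (n + gridBound D ε ^ D + gridBound D ε) →
      Stored n L s' → L.length ≤ 2 * (D + 1) * (4 * (gridFactor D * gridSize D ε) + 1) ^ D →
      Eliminated n (D + 1) (fun i k => s.arr 0 (i * (D + 1) + k) - s.arr 0 k) (D + 1) b c →
      Covers D n (gridFactor D * gridSize D ε) c
        (D * (4 / ((gridFactor D * gridSize D ε * gridSize D ε : ℕ) : ℝ))) L → Q t s') :
    Run W (kernelProg D) s Q := by
  have hF := gridSize_pos D ε
  have hA : 0 < gridFactor D := by unfold gridFactor; positivity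
  have hU : gridBound D ε = 5 * (gridFactor D * gridSize D ε * gridSize D ε) := by
    rw [gridBound]; ring
  refine Run.seq <| setup_run h0 h2 hε fun t₁ s₁ hk₁ ht₁ henv => ?_
  set F := gridSize D ε with hFdef
  set K := gridFactor D * F with hK
  set H := K * F with hH
  set U := gridBound D ε
  have hKpos : 0 < K := Nat.mul_pos hA hF
  have hHpos : 0 < H := Nat.mul_pos hKpos hF
  have hKH : K ≤ H := Nat.le_mul_of_pos_right K hF
  have hFK : F ≤ K := Nat.le_mul_of_pos_left F hA
  have hWle : ∀ x ≤ n * (D + 1) + U ^ D + U, (x : ℝ) ≤ W :=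
    fun x hx => le_trans (by exact_mod_cast hx) hW
  have hnD : n ≤ n * (D + 1) := Nat.le_mul_of_pos_right n (by omega)
  refine Run.seq <| normalize_run henv.r3 hn (hWle _ (by omega)) fun t₂ s₂ b hk₂ ht₂ hE => ?_
  have env₂ : GridEnv D n H K s₂ := ⟨(hk₂.reg 3 rfl).trans henv.r3, (hk₂.reg 5 rfl).trans henv.r5,
    (hk₂.reg 6 rfl).trans henv.r6, (hk₂.reg 7 rfl).trans henv.r7, (hk₂.reg 8 rfl).trans henv.r8,
    (hk₂.reg 9 rfl).trans henv.r9⟩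
  refine Run.seq <| clearOutput_run env₂.r3 (hWle _ (by omega)) fun t₃ s₃ hk₃ ht₃ hS => ?_
  have env₃ : GridEnv D n H K s₃ := ⟨(hk₃.reg 3 rfl).trans env₂.r3, (hk₃.reg 5 rfl).trans env₂.r5,
    (hk₃.reg 6 rfl).trans env₂.r6, (hk₃.reg 7 rfl).trans env₂.r7, (hk₃.reg 8 rfl).trans env₂.r8,
    (hk₃.reg 9 rfl).trans env₂.r9⟩
  have a2 : s₃.arr 2 = s₂.arr 2 := hk₃.arr 2 rfl
  refine allFaces_run (U := U) env₃ hn hHpos hKpos (by omega) (by omega) hW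
    (fun i hi k hk => by rw [a2]; exact hE.abs_le i hi k hk) hS
    fun t₄ s₄ L hk₄ ht₄ hS₄ hlen hcov => ?_
  rw [hk₁.arr 0 rfl] at hE
  refine hQ _ s₄ L b (s₂.arr 2) ?_ hS₄ hlen hE (by rwa [a2] at hcov)
  have e1 : (D + 1) * (4000 * (D + 1) * (n + U ^ D) + 20) ≤
      5000 * (D + 2) ^ 2 * (n + U ^ D + U) := by
    have : (D + 1) * (D + 1) ≤ (D + 2) ^ 2 := by nlinarith
    have h1 : D + 1 ≤ (D + 2) ^ 2 * n := by nlinarith [Nat.zero_le (D ^ 2)]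
    calc (D + 1) * (4000 * (D + 1) * (n + U ^ D) + 20)
        = 4000 * ((D + 1) * (D + 1) * (n + U ^ D)) + 20 * (D + 1) := by ring
      _ ≤ 4000 * ((D + 2) ^ 2 * (n + U ^ D)) + 20 * ((D + 2) ^ 2 * n) := by gcongr
      _ ≤ 5000 * (D + 2) ^ 2 * (n + U ^ D + U) := by
        nlinarith [Nat.zero_le ((D + 2) ^ 2 * n), Nat.zero_le ((D + 2) ^ 2 * U ^ D),
          Nat.zero_le ((D + 2) ^ 2 * U)]
  have e2 : 1000 * (D + 1 + 1) ^ 2 * n ≤ 1000 * (D + 2) ^ 2 * (n + U ^ D + U) := by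
    gcongr; omega
  have e3 : 20 * F + 20 * D + 100 + (20 * n + 20) + 10 ≤
      1000 * (D + 2) ^ 2 * (n + U ^ D + U) := by
    have h1 : 1 ≤ (D + 2) ^ 2 := Nat.one_le_pow _ _ (by omega)
    have h2 : D ≤ (D + 2) ^ 2 := by nlinarith
    have h3 : F ≤ U := by omega
    have h4 : D ≤ (D + 2) ^ 2 * n := h2.trans (Nat.le_mul_of_pos_right _ hn)
    have h5 := Nat.mul_le_mul_right (n + U ^ D + U) h1
    nlinarith [Nat.zero_le ((D + 2) ^ 2 * U ^ D), Nat.zero_le ((D + 2) ^ 2 * U),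
      Nat.zero_le ((D + 2) ^ 2 * n), Nat.zero_le (U ^ D)]
  have e4 : 100000 * (D + 2) ^ 2 * (n + U ^ D + U) = 93000 * (D + 2) ^ 2 * (n + U ^ D + U) +
      1000 * (D + 2) ^ 2 * (n + U ^ D + U) + 1000 * (D + 2) ^ 2 * (n + U ^ D + U) +
      5000 * (D + 2) ^ 2 * (n + U ^ D + U) := by ring
  omega

end

/-! ### Sizes -/

theorem gridSize_le (D : ℕ) {ε : ℝ} (hε : 0 < ε) :
    (gridSize D ε : ℝ) ≤ (D + 1) * max 1 (ε ^ (-(1 / 2 : ℝ))) := by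
  set z := ε ^ (-(1 / 2 : ℝ)) with hz
  have hz0 : 0 < z := Real.rpow_pos_of_pos hε _
  have hz2 : z ^ 2 = 1 / ε := by
    rw [hz, ← Real.rpow_natCast, ← Real.rpow_mul hε.le]
    norm_num [Real.rpow_neg_one]
  have h1 : √(D / ε) ≤ D * z := by
    rw [Real.sqrt_le_left (by positivity), mul_pow, hz2, mul_one_div]
    gcongr
    exact_mod_cast Nat.le_self_pow two_ne_zero D
  have hm : (1 : ℝ) ≤ max 1 z := le_max_left _ _
  have h2 : (D : ℝ) * z ≤ D * max 1 z := by gcongr; exact le_max_right _ _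
  have h3 := Nat.ceil_lt_add_one (Real.sqrt_nonneg (D / ε))
  rw [gridSize, Nat.cast_max, Nat.cast_one]
  refine max_le ?_ (by linarith)
  have : (0 : ℝ) ≤ D * max 1 z := by positivity
  linarith

theorem max_one_pow_le (z : ℝ) (m : ℕ) : max 1 z ^ m ≤ max 1 (z ^ m) := by
  rcases max_choice 1 z with h | h
  · rw [h, one_pow]; exact le_max_left _ _
  · rw [h]; exact le_max_right _ _

theorem gridSize_pow_le (D m : ℕ) {ε : ℝ} (hε : 0 < ε) :
    (gridSize D ε : ℝ) ^ m ≤ (D + 1) ^ m * max 1 (ε ^ (-((m : ℝ) / 2))) := by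
  have h1 : (ε ^ (-(1 / 2 : ℝ))) ^ m = ε ^ (-((m : ℝ) / 2)) := by
    rw [← Real.rpow_natCast, ← Real.rpow_mul hε.le]
    congr 1; ring
  calc (gridSize D ε : ℝ) ^ m ≤ ((D + 1) * max 1 (ε ^ (-(1 / 2 : ℝ)))) ^ m := by
        gcongr; exact gridSize_le D hε
    _ ≤ (D + 1) ^ m * max 1 (ε ^ (-((m : ℝ) / 2))) := by
        rw [mul_pow, ← h1]
        gcongr
        exact max_one_pow_le _ _

theorem gridBound_pow_le (D n : ℕ) {ε : ℝ} (hε : 0 < ε) (hn : 0 < n) :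
    (gridBound D ε : ℝ) ^ D ≤
      (5 * gridFactor D * (D + 1) ^ 2) ^ D * (n + ε ^ (-(D : ℝ))) := by
  have h1 : (1 : ℝ) ≤ n := by exact_mod_cast hn
  have h2 := Real.rpow_pos_of_pos hε (-(D : ℝ))
  have h3 := gridSize_pow_le D (2 * D) hε
  have h4 : -((2 * D : ℕ) : ℝ) / 2 = -(D : ℝ) := by push_cast; ring
  rw [← neg_div, h4] at h3
  calc (gridBound D ε : ℝ) ^ D
      = (5 * gridFactor D) ^ D * (gridSize D ε : ℝ) ^ (2 * D) := by
        rw [gridBound]; push_cast; rw [mul_pow, ← pow_mul]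
    _ ≤ (5 * gridFactor D) ^ D * ((D + 1) ^ (2 * D) * (n + ε ^ (-(D : ℝ)))) := by
        gcongr
        refine h3.trans ?_
        gcongr
        exact max_le (by linarith) (by linarith)
    _ = _ := by rw [mul_pow (5 * (gridFactor D : ℝ)), ← pow_mul]; ring

theorem gridBound_le (D n : ℕ) {ε : ℝ} (hε : 0 < ε) (hn : 0 < n) :
    (gridBound D ε : ℝ) ≤
      (5 * gridFactor D + (5 * gridFactor D * (D + 1) ^ 2) ^ D) * (n + ε ^ (-(D : ℝ))) := by
  have h1 : (1 : ℝ) ≤ n := by exact_mod_cast hn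
  have h2 := Real.rpow_pos_of_pos hε (-(D : ℝ))
  rw [add_mul]
  -- On the line the resolution is `1` for every `ε`, so the bound is a constant; otherwise it is at
  -- most its own `D`-th power.
  rcases Nat.eq_zero_or_pos D with rfl | hD
  · have h3 : gridSize 0 ε = 1 := by simp [gridSize]
    have h4 : (gridBound 0 ε : ℝ) = 5 * gridFactor 0 * 1 := by simp [gridBound, h3]
    rw [h4]
    have h5 : 5 * (gridFactor 0 : ℝ) * 1 ≤ 5 * gridFactor 0 * (n + ε ^ (-((0 : ℕ) : ℝ))) := by
      gcongr; linarith
    refine h5.trans (le_add_of_nonneg_right (by positivity))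
  · have h3 : (gridBound D ε : ℝ) ≤ (gridBound D ε : ℝ) ^ D := by
      exact_mod_cast Nat.le_self_pow hD.ne' _
    refine (h3.trans (gridBound_pow_le D n hε hn)).trans (le_add_of_nonneg_left (by positivity))

/-- With `p = 2 ^ D`, resolution `F`, `K = 16 p F` and `H = K F`, the cell error contributes `D / (4
F²)` and the direction error `D / (512 p F²)` after multiplication by `p`. Since `D / F² ≤ ε`, the
sum stays below `ε / 2`. -/
theorem error_le (D : ℕ) {ε : ℝ} (hε : 0 < ε) :
    (D * (4 / ((gridFactor D * gridSize D ε * gridSize D ε : ℕ) : ℝ)) +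
      D / (2 * ((gridFactor D * gridSize D ε : ℕ) : ℝ) ^ 2)) * 2 ^ D ≤ ε / 2 := by
  have hF : (0 : ℝ) < gridSize D ε := by exact_mod_cast gridSize_pos D ε
  have hD := le_gridSize_sq D hε
  set F : ℝ := (gridSize D ε : ℝ)
  have hA : (gridFactor D : ℝ) = 2 ^ D * 16 := by
    rw [gridFactor, pow_add]; push_cast; norm_num
  push_cast
  rw [hA]
  have hp : (1 : ℝ) ≤ 2 ^ D := one_le_pow₀ (by norm_num)
  set p : ℝ := 2 ^ D
  have hp0 : 0 < p := by linarith
  have e : (D * (4 / (p * 16 * F * F)) + D / (2 * (p * 16 * F) ^ 2)) * p =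
      D / F ^ 2 * (1 / 4 + 1 / (512 * p)) := by
    field_simp; ring
  have h1 : (D : ℝ) / F ^ 2 ≤ ε := by
    rw [div_le_iff₀ (by positivity)]; linarith
  have h2 : 1 / (512 * p) ≤ 1 / 512 := by
    apply one_div_le_one_div_of_le <;> linarith
  rw [e]
  calc (D : ℝ) / F ^ 2 * (1 / 4 + 1 / (512 * p)) ≤ ε * (1 / 2) := by
        gcongr; linarith
    _ = ε / 2 := by ring

theorem score_sub_eq_sum {D n : ℕ} {p : Fin n → Point (D + 1)} {x : ℕ → ℝ}
    (hx : ∀ (i : Fin n) (j : Fin (D + 1)), x (i.1 * (D + 1) + j.1) = p i j) (hn : 0 < n)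
    (u : Point (D + 1)) (i : Fin n) :
    ∑ k ∈ range (D + 1), (if h : k < D + 1 then u ⟨k, h⟩ else 0) *
      (x (i * (D + 1) + k) - x k) = score u (p i) - score u (p ⟨0, hn⟩) := by
  rw [sum_range, score, score, ← sum_sub_distrib]
  refine sum_congr rfl fun k _ => ?_
  have h0 := hx ⟨0, hn⟩ k
  simp only [zero_mul, zero_add] at h0
  rw [hx i k, h0, dif_pos k.2]
  ring

end RegretSet

/-! ### Assembly of the theorem -/

theorem mainTheorem3 (d : ℕ) (hd : 1 ≤ d) :
    ∃ (prog : RegretSet.RProg) (C : ℝ), ∀ (n k : ℕ) (ε : ℝ) (p : Fin n → RegretSet.Point d)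
      (P : Finset (RegretSet.Point d)), Function.Injective p → P = Finset.univ.image p →
      (∀ x ∈ P, x ∈ RegretSet.orthant d) → 0 < ε → 1 ≤ k → k ≤ n →
      ∀ s : RegretSet.RState, RegretSet.IsInput p ε k s →
        ∃ (t : ℕ) (s' : RegretSet.RState) (Q : Finset (RegretSet.Point d)),
          RegretSet.Exec (C * ((n : ℝ) + ε ^ (-((d : ℝ) - 1)))) prog s t s' ∧
          (t : ℝ) ≤ C * ((n : ℝ) + ε ^ (-((d : ℝ) - 1))) ∧
          RegretSet.IsOutput p Q s' ∧
          Q ⊆ P ∧ Q.Nonempty ∧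
          (Q.card : ℝ) ≤ C * max 1 (ε ^ (-(((d : ℝ) - 1) / 2))) ∧
          RegretSet.IsKernel ε Q P ∧
          RegretSet.regretRatio k Q P ≤ ε := by
  open RegretSet in
  obtain ⟨D, rfl⟩ : ∃ D, d = D + 1 := ⟨d - 1, by omega⟩
  have hdD : ((D + 1 : ℕ) : ℝ) - 1 = D := by push_cast; ring
  rw [hdD]
  set B : ℝ := (5 * gridFactor D * (D + 1) ^ 2) ^ D with hB
  set c₀ : ℝ := (D + 1) + B + (5 * gridFactor D + B) with hc₀
  set c₁ : ℝ := 100000 * (D + 2) ^ 2 with hc₁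
  set c₂ : ℝ := 2 * (D + 1) * ((5 * gridFactor D) ^ D * (D + 1) ^ D) with hc₂
  have hB0 : 0 ≤ B := by positivity
  have hc₀0 : 0 ≤ c₀ := by positivity
  have hc₁1 : 1 ≤ c₁ := by rw [hc₁]; nlinarith [sq_nonneg (D : ℝ), Nat.cast_nonneg (α := ℝ) D]
  have hc₂0 : 0 ≤ c₂ := by positivity
  -- `c₀` bounds the number of array entries in units of `n + ε^{-D}`, `c₁` the steps per entry, and
  -- `c₂` the output size. One constant serves for capacity, time and size.
  refine ⟨kernelProg D, c₁ * c₀ + c₂, ?_⟩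
  rintro n k ε p P hp rfl hP hε hk hkn s ⟨h0, -, h2, harr⟩
  have hn : 0 < n := by omega
  have hn1 : (1 : ℝ) ≤ n := by exact_mod_cast hn
  set Y : ℝ := n + ε ^ (-(D : ℝ)) with hY
  have hεD := Real.rpow_pos_of_pos hε (-(D : ℝ))
  have hY0 : 0 < Y := by positivity
  have hM : (n * (D + 1) : ℝ) + gridBound D ε ^ D + gridBound D ε ≤ c₀ * Y := by
    have h1 := gridBound_pow_le D n hε hn
    have h2 := gridBound_le D n hε hn
    have h3 : (n * (D + 1) : ℝ) ≤ (D + 1) * Y := by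
      rw [mul_comm]; gcongr; linarith
    rw [hc₀, add_mul, add_mul]
    linarith
  have hC : c₁ * (c₀ * Y) ≤ (c₁ * c₀ + c₂) * Y := by nlinarith [mul_nonneg hc₂0 hY0.le]
  have hW : ((n * (D + 1) + gridBound D ε ^ D + gridBound D ε : ℕ) : ℝ) ≤
      (c₁ * c₀ + c₂) * Y := by
    push_cast
    refine (hM.trans ?_).trans hC
    exact le_mul_of_one_le_left (by positivity) hc₁1
  have hrun := kernelProg_run h0 h2 hε hn hW
    (Q := fun t s' => (t : ℝ) ≤ (c₁ * c₀ + c₂) * Y ∧ ∃ L b c, Stored n L s' ∧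
      L.length ≤ 2 * (D + 1) * (4 * (gridFactor D * gridSize D ε) + 1) ^ D ∧
      Eliminated n (D + 1) (fun i k => s.arr 0 (i * (D + 1) + k) - s.arr 0 k) (D + 1) b c ∧
      Covers D n (gridFactor D * gridSize D ε) c
        (D * (4 / ((gridFactor D * gridSize D ε * gridSize D ε : ℕ) : ℝ))) L)
    fun t s' L b c ht hS hlen hE hcov => ⟨?_, L, b, c, hS, hlen, hE, hcov⟩
  · obtain ⟨t, s', hex, ht, L, b, c, hS, hlen, hE, hcov⟩ := hrun
    have hA : 0 < gridFactor D := by unfold gridFactor; positivity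
    have hK : 0 < gridFactor D * gridSize D ε := Nat.mul_pos hA (gridSize_pos D ε)
    have hget : ∀ x : Fin L.length, L.get x < n := fun x => hS.lt _ (L.get_mem x)
    set f : Fin L.length → Fin n := fun x => ⟨L.get x, hget x⟩ with hf
    have hfinj : Function.Injective f := by
      intro x y hxy
      exact List.nodup_iff_injective_get.1 hS.nodup (by simpa [hf] using hxy)
    set Q : Finset (Point (D + 1)) := univ.image fun x => p (f x) with hQdef
    have hcard : #Q = L.length := by
      rw [hQdef, card_image_of_injective _ (show Function.Injective fun x => p (f x) from hp.comp hfinj),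
        card_univ, Fintype.card_fin]
    have hmem : ∀ (q : ℕ) (hq : q ∈ L), p ⟨q, hS.lt q hq⟩ ∈ Q := by
      intro q hq
      obtain ⟨x, rfl⟩ := List.get_of_mem hq
      exact mem_image.2 ⟨x, mem_univ _, rfl⟩
    have hQP : Q ⊆ univ.image p := by
      intro x hx
      obtain ⟨y, -, rfl⟩ := mem_image.1 hx
      exact mem_image_of_mem _ (mem_univ _)
    have hQne : Q.Nonempty := by
      obtain ⟨q, hq, -⟩ := hcov 0 (by omega) 1 (Or.inl rfl) (fun _ => 0) (by simp)
      exact ⟨_, hmem q hq⟩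
    have hker : IsKernel ε Q (univ.image p) := by
      refine isKernel_of_topScore hQP fun u => ?_
      obtain ⟨x, hx, hxe⟩ := exists_score_eq_topScore u
        (P := univ.image p) ⟨p ⟨0, hn⟩, mem_image_of_mem _ (mem_univ _)⟩
      obtain ⟨i, -, rfl⟩ := mem_image.1 hx
      have hmemP : ∀ i, p i ∈ univ.image p := fun i => mem_image_of_mem _ (mem_univ _)
      -- Normalized scores are differences with the score of the first point, so the width of `P` is
      -- an admissible bound `M`, and the error becomes relative to the width.
      obtain ⟨q, hq, hle⟩ := hE.exists_le hcov hK hS.lt (by positivity)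
        (fun k => if h : k < D + 1 then u ⟨k, h⟩ else 0) (M := width u (univ.image p))
        (fun i hi => by
          rw [score_sub_eq_sum harr hn u ⟨i, hi⟩]
          exact abs_score_sub_le u (hmemP _) (hmemP _)) i.2
      rw [score_sub_eq_sum harr hn u i, score_sub_eq_sum harr hn u ⟨q, hS.lt q hq⟩,
        ← mul_assoc] at hle
      have hw : 0 ≤ width u (univ.image p) :=
        (abs_nonneg _).trans (abs_score_sub_le u (hmemP i) (hmemP i))
      have h1 := mul_le_mul_of_nonneg_right (error_le D hε) hw
      have h2 := le_topScore u (hmem q hq)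
      rw [← hxe]
      linarith
    refine ⟨t, s', Q, hex, ht, ⟨?_, fun i => f (Fin.cast hcard i), ?_, ?_, ?_⟩, hQP, hQne, ?_,
      hker, ?_⟩
    · rw [hS.len, hcard]
    · exact hfinj.comp (Fin.cast_injective hcard)
    · intro i
      have hi : i.1 < L.length := hcard ▸ i.2
      rw [hS.out _ hi]
      simp [hf, hi]
    · ext x
      simp only [hQdef, coe_image, coe_univ, Set.image_univ, Set.mem_range]
      constructor
      · rintro ⟨y, rfl⟩
        exact ⟨Fin.cast hcard.symm y, rfl⟩
      · rintro ⟨y, rfl⟩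
        exact ⟨Fin.cast hcard y, rfl⟩
    · rw [hcard]
      set F := gridSize D ε
      have hF1 : 1 ≤ F := gridSize_pos D ε
      have h1 : 4 * (gridFactor D * F) + 1 ≤ 5 * gridFactor D * F := by nlinarith
      have h2 : (L.length : ℝ) ≤ 2 * (D + 1) * (5 * gridFactor D * F) ^ D := by
        exact_mod_cast hlen.trans (Nat.mul_le_mul_left _ (Nat.pow_le_pow_left h1 D))
      have h3 := gridSize_pow_le D D hε
      calc (L.length : ℝ) ≤ 2 * (D + 1) * (5 * gridFactor D * F) ^ D := h2
        _ = 2 * (D + 1) * ((5 * gridFactor D) ^ D * (F : ℝ) ^ D) := by rw [mul_pow]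
        _ ≤ 2 * (D + 1) * ((5 * gridFactor D) ^ D *
            ((D + 1) ^ D * max 1 (ε ^ (-((D : ℝ) / 2))))) := by gcongr
        _ = c₂ * max 1 (ε ^ (-((D : ℝ) / 2))) := by rw [hc₂]; ring
        _ ≤ (c₁ * c₀ + c₂) * max 1 (ε ^ (-((D : ℝ) / 2))) := by
          gcongr
          exact le_add_of_nonneg_left (by positivity)
    · refine regretRatio_le_of_isKernel hε.le hk ?_ hP hQne hker
      rw [card_image_of_injective _ hp, card_univ, Fintype.card_fin]
      exact hkn
  · have h1 : (t : ℝ) ≤ c₁ * (n + gridBound D ε ^ D + gridBound D ε) := by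
      rw [hc₁]; exact_mod_cast ht
    refine (h1.trans ?_).trans hC
    gcongr
    refine le_trans ?_ hM
    gcongr
    nlinarith [Nat.cast_nonneg (α := ℝ) D]
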